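/- Fix an integer $m\ge 1$, put $n=2m+2$ and $p_j=e^{2\pi i j/n}$ for $0\le j\le n-1$, and fix $\rho>1$. Let $\mathcal W^{\ge0}_{\mathbb R}$ be the real Banach space of series $f(\lambda)=\sum_{k\ge0}f_k\lambda^k$ with $f_k\in\mathbb R$ and $\|f\|_\rho=\sum_k|f_k|\rho^k<\infty$. For $\mathbf x=(r,a,b,c)\in\mathbb R\times(\mathcal W^{\ge0}_{\mathbb R})^3$ and $t\in\mathbb R$ let $$\eta_t^{\mathbf x}=\begin{pmatrix}0&0\\ mrz^{m-1}dz&0\end{pmatrix}+t\sum_{j=0}^{n-1}A_j(\lambda)\frac{dz}{z-p_j},\qquad A_0(\lambda)=\begin{pmatrix}a(\lambda)&\lambda^{-1}b(\lambda)\\ \lambda c(\lambda)&-a(\lambda)\end{pmatrix},$$ $$A_{j+1}(\lambda)=D^{-1}A_j(-\lambda)D,\qquad D=\operatorname{diag}(e^{i\pi m/n},e^{-i\pi m/n}).$$ Let $\Phi_t$ solve $d\Phi_t=\Phi_t\,\eta^{\mathbf x}_t$, $\Phi_t(0)=\mathrm{Id}$. Let $\gamma_j$ be the loop based at $0$ that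 runs once counterclockwise along the circle through $0$ with centre $p_j/(2\cos(\pi/n))$; it encloses $p_j$ and no other $p_i$. Let $M_j(t)(\lambda)$ be the monodromy of $\Phi_t$ along $\gamma_j$, that is, the value at the end point of the continuation of $\Phi_t(\cdot,\lambda)$ along $\gamma_j$. For $t\neq0$ put $\widetilde M(t)=\frac1t\log M_0(t)$, where $\log M=\sum_{k\ge1}\frac{(-1)^{k-1}}{k}(M-\mathrm{Id})^k$. With $f^*(\lambda)=\overline{f(1/\overline\lambda)}$ and $f^0$ the constant coefficient of $f$, consider for $(t,\mathbf x)$ the system $$\tfrac1{2\pi i}\big(\widetilde M_{11}+\widetilde M_{11}^*\big)=0,\quad \tfrac1{2\pi i}\big(\widetilde M_{21}+\widetilde M_{12}^*\big)=0\ \text{ on }\mathbb S^1,\quad \tfrac{1}{2\pi i}\widetilde M_{12}(\lambda=\pm1)=0,\quad (a^0)^2+b^0c^0=1.\qquad(\ast)$$ Let $\mathbf x_0=(1,\ \lambda,\ \tfrac{\lambda^2-1}2,\ -2)$. Then there are $\delta>0$ and $\varepsilon>0$ such that for every real $t$ with $0<|t|<\varepsilon$ there is exactly one $\mathbf x(t)=(r,a,b,c)$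 with $|r-1|<\delta$, $\|a-\lambda\|_\rho<\delta$, $\|b-\tfrac{\lambda^2-1}2\|_\rho<\delta$, $\|c+2\|_\rho<\delta$ that solves $(\ast)$. For this $\mathbf x(t)$, and all $0\le j\le n-1$, the monodromies of the solution $\Phi_t$ for $\eta_t^{\mathbf x(t)}$ satisfy $$M_j(t)(1)=\begin{pmatrix}e^{2\pi it}&0\\0&e^{-2\pi it}\end{pmatrix}^{(-1)^j},\qquad M_j(t)(-1)=\begin{pmatrix}e^{-2\pi it}&0\\0&e^{2\pi it}\end{pmatrix}^{(-1)^j},$$ and $\det A_j(t)(\lambda)=-1$ for all $\lambda\in\mathbb S^1$, where $A_j(t)$ are the matrices $A_j$ formed from $\mathbf x(t)$. -/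

import Mathlib

open Complex Matrix

namespace DPW

/-! ### Loops in the spectral parameter

A real loop `f(lam) = ∑_{k ≥ 0} f_k lam^k` without negative Fourier modes is represented by the
sequence `f : ℕ → ℝ` of its Fourier coefficients. -/

/-- `‖f‖_ρ < ∞`, where `‖f‖_ρ = ∑ |f_k| ρ^k`. -/
def MemLoop (ρ : ℝ) (f : ℕ → ℝ) : Prop :=
  Summable fun k => |f k| * ρ ^ k

/-- The norm `‖f‖_ρ = ∑ |f_k| ρ^k`. -/
noncomputable def loopNorm (ρ : ℝ) (f : ℕ → ℝ) : ℝ :=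
  ∑' k, |f k| * ρ ^ k

/-- The value `f(lam) = ∑ f_k lam^k`. -/
noncomputable def evalLoop (f : ℕ → ℝ) (lam : ℂ) : ℂ :=
  ∑' k, (f k : ℂ) * lam ^ k

/-- The parameter vector `x = (r, a, b, c)`. -/
@[ext]
structure Param where
  r : ℝ
  a : ℕ → ℝ
  b : ℕ → ℝ
  c : ℕ → ℝ

/-- The central value `r = 1`, `a = lam`, `b = (lam^2 - 1) / 2`, `c = -2`. -/
noncomputable def centre : Param where
  r := 1
  a := fun k => if k = 1 then 1 else 0
  b := fun k => if k = 0 then -1 / 2 else if k = 2 then 1 / 2 else 0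
  c := fun k => if k = 0 then -2 else 0

/-- The open ball of radius `δ` about the central value in the Banach space of parameters
(with the maximum of the four norms). -/
def paramBall (ρ δ : ℝ) : Set Param :=
  {x | MemLoop ρ x.a ∧ MemLoop ρ x.b ∧ MemLoop ρ x.c ∧
    |x.r - centre.r| < δ ∧ loopNorm ρ (x.a - centre.a) < δ ∧
    loopNorm ρ (x.b - centre.b) < δ ∧ loopNorm ρ (x.c - centre.c) < δ}

/-! ### The potential -/

/-- The number of finite singularities, `n = 2 m + 2`. -/
def nSing (m : ℕ) : ℕ := 2 * m + 2

/-- The singularities `p_j = exp (2 π i j / n)`. -/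
noncomputable def pole (m j : ℕ) : ℂ :=
  exp (2 * Real.pi * I * j / nSing m)

/-- `D = diag (exp (i π m / n), exp (-i π m / n))`. -/
noncomputable def matD (m : ℕ) : Matrix (Fin 2) (Fin 2) ℂ :=
  !![exp (I * Real.pi * m / nSing m), 0; 0, exp (-(I * Real.pi * m / nSing m))]

/-- The residue matrices `A_j(lam)`: `A_0 = (a, lam⁻¹ b; lam c, -a)` and
`A_{j+1}(lam) = D⁻¹ A_j(-lam) D`. -/
noncomputable def matA (m : ℕ) (x : Param) : ℕ → ℂ → Matrix (Fin 2) (Fin 2) ℂ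
  | 0, lam => !![evalLoop x.a lam, lam⁻¹ * evalLoop x.b lam;
      lam * evalLoop x.c lam, -evalLoop x.a lam]
  | j + 1, lam => (matD m)⁻¹ * matA m x j (-lam) * matD m

/-- The coefficient of `dz` in the potential
`η_t = (0, 0; m r z^(m-1) dz, 0) + t ∑_{j < n} A_j(lam) dz / (z - p_j)`. -/
noncomputable def potential (m : ℕ) (t : ℝ) (x : Param) (lam z : ℂ) :
    Matrix (Fin 2) (Fin 2) ℂ :=
  !![0, 0; (m : ℂ) * x.r * z ^ (m - 1), 0] +
    (t : ℂ) • ∑ j ∈ Finset.range (nSing m), (z - pole m j)⁻¹ • matA m x j lam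

/-! ### Monodromy -/

/-- `X` is the continuation, along the closed curve `γ` (of period 1), of the solution of
`dΦ = Φ η`, `Φ(γ 0) = Id`; here `η z` is the coefficient of `dz`. -/
def IsContinuation (η : ℂ → Matrix (Fin 2) (Fin 2) ℂ) (γ : ℝ → ℂ)
    (X : ℝ → Matrix (Fin 2) (Fin 2) ℂ) : Prop :=
  X 0 = 1 ∧ ∀ (s : ℝ) (i k : Fin 2),
    HasDerivAt (fun u => X u i k) ((deriv γ s • (X s * η (γ s))) i k) s

open Classical in
/-- The monodromy along `γ` of the solution of `dΦ = Φ η`, `Φ(γ 0) = Id`: the value reached after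
continuation once along `γ`. (If `γ` avoids the poles of `η`, the continuation exists and is
unique.) -/
noncomputable def monodromy (η : ℂ → Matrix (Fin 2) (Fin 2) ℂ) (γ : ℝ → ℂ) :
    Matrix (Fin 2) (Fin 2) ℂ :=
  if h : ∃ X, IsContinuation η γ X then h.choose 1 else 0

/-- The loop `γ_j` based at `0`: the circle through `0` with centre `p_j / (2 cos (π / n))`, run
through once counterclockwise. It encloses `p_j` and no other singularity, since `|w - q| < |q|`
holds for `|w| = 1` and `q > 0` exactly when `Re w > 1 / (2 q)`. -/
noncomputable def loopAt (m j : ℕ) (s : ℝ) : ℂ :=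
  pole m j * ((2 * Real.cos (Real.pi / nSing m) : ℝ) : ℂ)⁻¹ * (1 - exp (2 * Real.pi * I * s))

/-- The monodromy `M_j(t)(lam)` of `Φ_t` along `γ_j`. -/
noncomputable def matM (m j : ℕ) (t : ℝ) (x : Param) (lam : ℂ) : Matrix (Fin 2) (Fin 2) ℂ :=
  monodromy (potential m t x lam) (loopAt m j)

/-- The principal logarithm of a matrix near the identity,
`log M = ∑_{k ≥ 1} (-1)^(k-1) (M - Id)^k / k`. -/
noncomputable def matLog (M : Matrix (Fin 2) (Fin 2) ℂ) : Matrix (Fin 2) (Fin 2) ℂ :=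
  ∑' k : ℕ, ((-1 : ℂ) ^ k / ((k : ℂ) + 1)) • (M - 1) ^ (k + 1)

/-- `(1 / t) log M_0(t)`, for `t ≠ 0`. -/
noncomputable def matMtilde (m : ℕ) (t : ℝ) (x : Param) (lam : ℂ) :
    Matrix (Fin 2) (Fin 2) ℂ :=
  (t : ℂ)⁻¹ • matLog (matM m 0 t x lam)

/-! ### The equations determining the parameters

On the unit circle, the involution `f^*(lam) = conj (f (1 / conj lam))` is
complex conjugation of the value. -/

noncomputable def eqF (m : ℕ) (t : ℝ) (x : Param) (lam : ℂ) : ℂ :=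
  (2 * Real.pi * I)⁻¹ *
    (matMtilde m t x lam 0 0 + (starRingEnd ℂ) (matMtilde m t x lam 0 0))

noncomputable def eqG (m : ℕ) (t : ℝ) (x : Param) (lam : ℂ) : ℂ :=
  (2 * Real.pi * I)⁻¹ *
    (matMtilde m t x lam 1 0 + (starRingEnd ℂ) (matMtilde m t x lam 0 1))

noncomputable def eqH (m : ℕ) (t : ℝ) (x : Param) (lam : ℂ) : ℂ :=
  (2 * Real.pi * I)⁻¹ * matMtilde m t x lam 0 1

/-- The constant Fourier coefficient of `-det A_0 = a^2 + b c`. -/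
def eqK (x : Param) : ℝ := x.a 0 ^ 2 + x.b 0 * x.c 0

/-- The system `F = 0`, `G = 0` (as functions on the unit circle), `H_1 = H_2 = 0`, `K = 1`. -/
def SolvesSystem (m : ℕ) (t : ℝ) (x : Param) : Prop :=
  (∀ lam : ℂ, ‖lam‖ = 1 → eqF m t x lam = 0) ∧
  (∀ lam : ℂ, ‖lam‖ = 1 → eqG m t x lam = 0) ∧
  eqH m t x 1 = 0 ∧ eqH m t x (-1) = 0 ∧ eqK x = 1

/-- `diag (exp (2 π i t), exp (-2 π i t))`. -/
noncomputable def diagExp (t : ℝ) : Matrix (Fin 2) (Fin 2) ℂ :=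
  !![exp (2 * Real.pi * I * t), 0; 0, exp (-(2 * Real.pi * I * t))]

end DPW

/-!
Dressing by the explicit solution `Φ_0(z) = 1 + r z ^ m N` at `t = 0`, with `N` lower triangular
nilpotent, turns the potential into `t` times a potential with a simple pole at `p_0 = 1` and
residue `R = Φ_0(1) A_0 Φ_0(1)⁻¹`. On the disc bounded by `γ_0` a gauge `P`, holomorphic across
`p_0` and smooth in all the data, reduces it to `t R dz / (z - 1)`, so
`M_0 = P(0)⁻¹ exp (2 π i t R) P(0)`. Hence `log M_0 / t` extends smoothly to `t = 0`, where it is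
`2 π i R`, and it is conjugate to `2 π i A_0` for every `t`.

The reality of the coefficients makes the Fourier coefficients of `log M_0 / (2 π i t)` real, so
the system becomes a smooth map between real Banach spaces of coefficient sequences. Its derivative
in the parameters at the central value decouples into triangular equations for the coefficients of
high index and a regular linear system for the remaining seven unknowns. It is therefore bijective,
and the implicit function theorem yields existence and uniqueness.

By `F = 0` and `G = 0` the function `a ^ 2 + b c = -det A_0` is real on the circle. Having no
negative Fourier coefficients it is then constant, and the normalization makes the constant `1`. At
`λ = ± 1` the condition `H = 0` makes `log M_0 / (2 π i t)` diagonal with eigenvalues `± 1`, and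
continuity at `t = 0` fixes the sign. The rotation by `p_1`, which conjugates by `D` and changes the
sign of `λ`, carries `M_j` to `M_{j + 1}`.
-/

namespace DPW

/-! ### Bounded holomorphic functions on a disc -/

section BoundedHolomorphic

open BoundedContinuousFunction Metric

/-- The bounded holomorphic functions, as a subalgebra of the bounded continuous functions. -/
def boundedHolomorphicSubalgebra (U : Set ℂ) (E : Type*) [NormedRing E] [NormedAlgebra ℂ E] :
    Subalgebra ℂ (U →ᵇ E) where
  carrier := {f | ∃ g : ℂ → E, DifferentiableOn ℂ g U ∧ ∀ z : U, f z = g z}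
  mul_mem' := by
    rintro f₁ f₂ ⟨g₁, hg₁, hfg₁⟩ ⟨g₂, hg₂, hfg₂⟩
    exact ⟨fun z => g₁ z * g₂ z, hg₁.mul hg₂, fun z => by simp [hfg₁, hfg₂]⟩
  add_mem' := by
    rintro f₁ f₂ ⟨g₁, hg₁, hfg₁⟩ ⟨g₂, hg₂, hfg₂⟩
    exact ⟨fun z => g₁ z + g₂ z, hg₁.add hg₂, fun z => by simp [hfg₁, hfg₂]⟩
  algebraMap_mem' c := ⟨fun _ => algebraMap ℂ E c, differentiableOn_const _, fun _ => rfl⟩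

lemma isClosed_boundedHolomorphicSubalgebra {U : Set ℂ} (hU : IsOpen U) {E : Type*} [NormedRing E]
    [NormedAlgebra ℂ E] [CompleteSpace E] :
    IsClosed (boundedHolomorphicSubalgebra U E : Set (U →ᵇ E)) := by
  classical
  refine isClosed_of_closure_subset fun f hf => ?_
  obtain ⟨u, hu, hlim⟩ := mem_closure_iff_seq_limit.mp hf
  choose g hg hug using hu
  refine ⟨fun z => if hz : z ∈ U then f ⟨z, hz⟩ else 0, ?_, fun z => by simp⟩
  refine TendstoLocallyUniformlyOn.differentiableOn (φ := Filter.atTop) (F := g) ?_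
    (Filter.Eventually.of_forall hg) hU
  refine TendstoUniformlyOn.tendstoLocallyUniformlyOn (Metric.tendstoUniformlyOn_iff.mpr ?_)
  intro ε hε
  filter_upwards [Metric.tendsto_nhds.mp hlim ε hε] with n hn z hz
  rw [dif_pos hz, ← hug n ⟨z, hz⟩, dist_comm]
  exact (BoundedContinuousFunction.dist_coe_le_dist _).trans_lt hn

/-- The normed algebra of bounded holomorphic functions `U → E`, under the supremum norm. -/
def BoundedHolomorphic (U : Set ℂ) (E : Type*) [NormedRing E] [NormedAlgebra ℂ E] : Type _ :=
  boundedHolomorphicSubalgebra U E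

namespace BoundedHolomorphic

variable {U : Set ℂ} {E : Type*} [NormedRing E] [NormedAlgebra ℂ E]

noncomputable instance : NormedRing (BoundedHolomorphic U E) :=
  inferInstanceAs (NormedRing (boundedHolomorphicSubalgebra U E))

noncomputable instance : NormedAlgebra ℂ (BoundedHolomorphic U E) :=
  inferInstanceAs (NormedAlgebra ℂ (boundedHolomorphicSubalgebra U E))

open Classical in
/-- Evaluation at a point of `U`. It is set to zero at the points outside `U`, so that `evalAt z`
makes sense for every `z : ℂ`. -/
noncomputable def evalAt (z : ℂ) : BoundedHolomorphic U E →L[ℂ] E :=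
  if hz : z ∈ U then
    (evalCLM ℂ ⟨z, hz⟩).comp (boundedHolomorphicSubalgebra U E).toSubmodule.subtypeL
  else 0

lemma evalAt_of_mem (f : BoundedHolomorphic U E) {z : ℂ} (hz : z ∈ U) :
    evalAt z f = f.1 ⟨z, hz⟩ := by
  rw [evalAt, dif_pos hz]
  rfl

lemma evalAt_of_notMem (f : BoundedHolomorphic U E) {z : ℂ} (hz : z ∉ U) : evalAt z f = 0 := by
  rw [evalAt, dif_neg hz]
  rfl

lemma evalAt_mul (f g : BoundedHolomorphic U E) (z : ℂ) :
    evalAt z (f * g) = evalAt z f * evalAt z g := by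
  by_cases hz : z ∈ U
  · rw [evalAt_of_mem _ hz, evalAt_of_mem _ hz, evalAt_of_mem _ hz]
    rfl
  · simp only [evalAt_of_notMem _ hz, mul_zero]

lemma evalAt_one {z : ℂ} (hz : z ∈ U) : evalAt z (1 : BoundedHolomorphic U E) = 1 :=
  evalAt_of_mem _ hz

lemma evalAt_pow (f : BoundedHolomorphic U E) {z : ℂ} (hz : z ∈ U) (k : ℕ) :
    evalAt z (f ^ k) = evalAt z f ^ k := by
  induction k with
  | zero => rw [pow_zero, pow_zero, evalAt_one hz]
  | succ k ih => rw [pow_succ, evalAt_mul, ih, pow_succ]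

lemma norm_evalAt_le (f : BoundedHolomorphic U E) (z : ℂ) : ‖evalAt z f‖ ≤ ‖f‖ := by
  by_cases hz : z ∈ U
  · exact (congrArg norm (evalAt_of_mem f hz)).trans_le (f.1.norm_coe_le_norm _)
  · simp [evalAt_of_notMem _ hz]

lemma ext_evalAt {f g : BoundedHolomorphic U E} (h : ∀ z ∈ U, evalAt z f = evalAt z g) :
    f = g :=
  Subtype.ext <| BoundedContinuousFunction.ext fun z => by
    simpa only [evalAt_of_mem _ z.2] using h z z.2

lemma norm_le_of_forall_evalAt {f : BoundedHolomorphic U E} {C : ℝ} (hC : 0 ≤ C)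
    (h : ∀ z ∈ U, ‖evalAt z f‖ ≤ C) : ‖f‖ ≤ C :=
  (BoundedContinuousFunction.norm_le hC).mpr fun z => by
    simpa [evalAt_of_mem _ z.2] using h z z.2

lemma differentiableOn_evalAt (f : BoundedHolomorphic U E) :
    DifferentiableOn ℂ (fun z => evalAt z f) U := by
  obtain ⟨g, hg, hfg⟩ := f.2
  exact hg.congr fun z hz => by rw [evalAt_of_mem f hz, hfg]

/-- The element of the algebra given by a holomorphic function `g` with `‖g‖ ≤ C` on `U`. -/
noncomputable def ofBound (g : ℂ → E) (hg : DifferentiableOn ℂ g U) (C : ℝ)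
    (hC : ∀ z ∈ U, ‖g z‖ ≤ C) : BoundedHolomorphic U E :=
  ⟨BoundedContinuousFunction.ofNormedAddCommGroup (fun z : U => g z)
    (continuousOn_iff_continuous_domRestrict.mp hg.continuousOn) C (fun z => hC z z.2),
    g, hg, fun _ => rfl⟩

lemma evalAt_ofBound {g : ℂ → E} {hg : DifferentiableOn ℂ g U} {C : ℝ}
    {hC : ∀ z ∈ U, ‖g z‖ ≤ C} {z : ℂ} (hz : z ∈ U) : evalAt z (ofBound g hg C hC) = g z := by
  rw [evalAt_of_mem _ hz]
  rfl

lemma completeSpace [CompleteSpace E] (hU : IsOpen U) : CompleteSpace (BoundedHolomorphic U E) :=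
  (isClosed_boundedHolomorphicSubalgebra hU).completeSpace_coe

/-- The operator `e ↦ s • e` from constants to `E`-valued functions, for a scalar function `s`. -/
noncomputable def smulConst (s : BoundedHolomorphic U ℂ) : E →L[ℂ] BoundedHolomorphic U E :=
  LinearMap.mkContinuous
    { toFun := fun e => ofBound (fun z => evalAt z s • e)
        ((differentiableOn_evalAt s).smul_const e) (‖s‖ * ‖e‖) fun z _ =>
          (norm_smul_le _ _).trans (by gcongr; exact norm_evalAt_le s z)
      map_add' := fun e₁ e₂ => ext_evalAt fun z hz => by
        simp only [map_add, evalAt_ofBound hz, smul_add]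
      map_smul' := fun a e => ext_evalAt fun z hz => by
        simp only [RingHom.id_apply, map_smul, evalAt_ofBound hz, smul_comm a] } ‖s‖
    fun e => norm_le_of_forall_evalAt (by positivity) fun z hz => by
      simp only [LinearMap.coe_mk, AddHom.coe_mk, evalAt_ofBound hz]
      exact (norm_smul_le _ _).trans (by gcongr; exact norm_evalAt_le s z)

lemma evalAt_smulConst (s : BoundedHolomorphic U ℂ) (e : E) {z : ℂ} (hz : z ∈ U) :
    evalAt z (smulConst s e) = evalAt z s • e :=
  evalAt_ofBound (g := fun z => evalAt z s • e) (hg := (differentiableOn_evalAt s).smul_const e)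
    (hC := fun z _ => (norm_smul_le _ _).trans (by gcongr; exact norm_evalAt_le s z)) hz

section Ball

variable {q c : ℂ} {r : ℝ}

/-- The coordinate function `z` on a ball. -/
noncomputable def coord (q : ℂ) (r : ℝ) : BoundedHolomorphic (ball q r) ℂ :=
  ofBound (fun z => z) differentiableOn_id (‖q‖ + r) fun z hz =>
    (norm_le_norm_add_norm_sub' z q).trans (by gcongr; exact (mem_ball_iff_norm.mp hz).le)

lemma evalAt_coord {z : ℂ} (hz : z ∈ ball q r) : evalAt z (coord q r) = z :=
  evalAt_ofBound (g := fun z => z) hz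

lemma segment_mem_ball (hc : c ∈ ball q r) {z : ℂ} (hz : z ∈ ball q r) {s : ℝ}
    (hs : s ∈ Set.Icc (0 : ℝ) 1) : c + (s : ℂ) * (z - c) ∈ ball q r := by
  simpa using (convex_ball q r).add_smul_sub_mem hc hz hs

lemma continuousOn_evalAt_segment (f : BoundedHolomorphic (ball q r) E) (hc : c ∈ ball q r)
    {z : ℂ} (hz : z ∈ ball q r) :
    ContinuousOn (fun s : ℝ => evalAt (c + (s : ℂ) * (z - c)) f) (Set.uIcc 0 1) := by
  refine (differentiableOn_evalAt f).continuousOn.comp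
    (f := fun s : ℝ => c + (s : ℂ) * (z - c)) (by fun_prop) fun s hs => ?_
  exact segment_mem_ball hc hz (by rwa [Set.uIcc_of_le zero_le_one] at hs)

/-- The radial average `∫₀¹ f (c + s (z - c)) ds`. -/
noncomputable def radialAverage (c : ℂ) (f : BoundedHolomorphic (ball q r) E) (z : ℂ) : E :=
  ∫ s in (0 : ℝ)..1, evalAt (c + (s : ℂ) * (z - c)) f

lemma norm_radialAverage_le (f : BoundedHolomorphic (ball q r) E) (z : ℂ) :
    ‖radialAverage c f z‖ ≤ ‖f‖ := by
  simpa [radialAverage] using intervalIntegral.norm_integral_le_of_norm_le_const (a := (0 : ℝ))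
    (b := 1) fun s _ => norm_evalAt_le f (c + (s : ℂ) * (z - c))

variable [CompleteSpace E]

lemma radialAverage_self (f : BoundedHolomorphic (ball q r) E) :
    radialAverage c f c = evalAt c f := by
  simp [radialAverage]

lemma exists_hasDerivAt_and_sub_smul_radialAverage (f : BoundedHolomorphic (ball q r) E)
    (hc : c ∈ ball q r) :
    ∃ F : ℂ → E, (∀ z ∈ ball q r, HasDerivAt F (evalAt z f) z) ∧
      ∀ z ∈ ball q r, (z - c) • radialAverage c f z = F z - F c := by
  obtain ⟨F, hF⟩ := (differentiableOn_evalAt f).isExactOn_ball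
  refine ⟨F, hF, fun z hz => ?_⟩
  have hderiv : ∀ s ∈ Set.uIcc (0 : ℝ) 1, HasDerivAt (fun s : ℝ => F (c + (s : ℂ) * (z - c)))
      ((z - c) • evalAt (c + (s : ℂ) * (z - c)) f) s := by
    intro s hs
    rw [Set.uIcc_of_le zero_le_one] at hs
    have hsegment : HasDerivAt (fun s : ℝ => c + (s : ℂ) * (z - c)) (z - c) s := by
      simpa using ((Complex.ofRealCLM.hasDerivAt (x := s)).mul_const (z - c)).const_add c
    exact (hF _ (segment_mem_ball hc hz hs)).scomp s hsegment
  simpa [radialAverage, intervalIntegral.integral_smul] using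
    intervalIntegral.integral_eq_sub_of_hasDerivAt hderiv
      ((continuousOn_evalAt_segment f hc hz).const_smul (z - c)).intervalIntegrable

lemma differentiableOn_radialAverage (f : BoundedHolomorphic (ball q r) E) (hc : c ∈ ball q r) :
    DifferentiableOn ℂ (radialAverage c f) (ball q r) := by
  obtain ⟨F, hF, hradial⟩ := exists_hasDerivAt_and_sub_smul_radialAverage f hc
  have hslope : DifferentiableOn ℂ (dslope F c) (ball q r) :=
    (Complex.differentiableOn_dslope (isOpen_ball.mem_nhds hc)).mpr
      fun z hz => (hF z hz).differentiableAt.differentiableWithinAt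
  refine hslope.congr fun z hz => ?_
  rcases eq_or_ne z c with rfl | hne
  · rw [radialAverage_self, dslope_same, (hF z hz).deriv]
  · rw [dslope_of_ne _ hne, slope_def_module, ← hradial z hz, smul_smul,
      inv_mul_cancel₀ (sub_ne_zero.mpr hne), one_smul]

/-- The operator `J` that takes radial averages from the point `c` of a ball. It inverts
`g ↦ ((z - c) g)'`. -/
noncomputable def radialAverageL (hc : c ∈ ball q r) :
    BoundedHolomorphic (ball q r) E →L[ℂ] BoundedHolomorphic (ball q r) E :=
  LinearMap.mkContinuous
    { toFun := fun f => ofBound (radialAverage c f) (differentiableOn_radialAverage f hc) ‖f‖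
        fun z _ => norm_radialAverage_le f z
      map_add' := fun f g => ext_evalAt fun z hz => by
        simp only [map_add, evalAt_ofBound hz, radialAverage]
        exact intervalIntegral.integral_add
          (continuousOn_evalAt_segment f hc hz).intervalIntegrable
          (continuousOn_evalAt_segment g hc hz).intervalIntegrable
      map_smul' := fun a f => ext_evalAt fun z hz => by
        simp only [RingHom.id_apply, map_smul, evalAt_ofBound hz, radialAverage]
        exact intervalIntegral.integral_smul a _ } 1
    fun f => by
      simpa using norm_le_of_forall_evalAt (norm_nonneg f) fun z hz => by
        simpa [evalAt_ofBound hz] using norm_radialAverage_le f z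

lemma evalAt_radialAverageL (hc : c ∈ ball q r) (f : BoundedHolomorphic (ball q r) E) {z : ℂ}
    (hz : z ∈ ball q r) : evalAt z (radialAverageL hc f) = radialAverage c f z :=
  evalAt_ofBound (hg := differentiableOn_radialAverage f hc)
    (hC := fun z _ => norm_radialAverage_le f z) hz

lemma hasDerivAt_sub_smul_evalAt_radialAverageL (hc : c ∈ ball q r)
    (f : BoundedHolomorphic (ball q r) E) {z : ℂ} (hz : z ∈ ball q r) :
    HasDerivAt (fun w => (w - c) • evalAt w (radialAverageL hc f)) (evalAt z f) z := by
  obtain ⟨F, hF, hradial⟩ := exists_hasDerivAt_and_sub_smul_radialAverage f hc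
  refine ((hF z hz).sub_const (F c)).congr_of_eventuallyEq ?_
  filter_upwards [isOpen_ball.mem_nhds hz] with w hw
  rw [evalAt_radialAverageL hc f hw, hradial w hw]

end Ball

end BoundedHolomorphic

end BoundedHolomorphic

/-! ### Gauging away the regular part of a Fuchsian system -/

section ResolventFamily

variable {X H : Type*} [NormedAddCommGroup X] [NormedSpace ℝ X] [NormedAddCommGroup H]
  [NormedSpace ℂ H] {n : WithTop ℕ∞} {x : X}

lemma contDiffAt_one_sub_smul {T : X → H →L[ℂ] H} (hT : ContDiffAt ℝ n T x) (t : ℝ) :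
    ContDiffAt ℝ n (fun p : ℝ × X => 1 - (p.1 : ℂ) • T p.2) (t, x) :=
  contDiffAt_const.sub <| (Complex.ofRealCLM.contDiff.comp contDiff_fst).contDiffAt.smul <|
    ContDiffAt.comp (t, x) hT contDiffAt_snd

variable [CompleteSpace H]

lemma eventually_isUnit_one_sub_smul {T : X → H →L[ℂ] H} (hT : ContDiffAt ℝ 0 T x) :
    ∀ᶠ p in nhds ((0 : ℝ), x), IsUnit (1 - (p.1 : ℂ) • T p.2) := by
  refine (contDiffAt_one_sub_smul hT 0).continuousAt.eventually (p := IsUnit)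
    (Units.isOpen.mem_nhds ?_)
  simp

lemma contDiffAt_inverse_one_sub_smul_apply {T : X → H →L[ℂ] H} (hT : ContDiffAt ℝ n T x)
    {g : X → H} (hg : ContDiffAt ℝ n g x) :
    ContDiffAt ℝ n (fun p : ℝ × X => Ring.inverse (1 - (p.1 : ℂ) • T p.2) ((p.1 : ℂ) • g p.2))
      (0, x) := by
  have hinverse : ContDiffAt ℝ n (fun p : ℝ × X => Ring.inverse (1 - (p.1 : ℂ) • T p.2))
      (0, x) := by
    refine ContDiffAt.comp (g := Ring.inverse) (0, x) ?_ (contDiffAt_one_sub_smul hT 0)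
    have hone : 1 - ((0 : ℝ) : ℂ) • T x = ((1 : (H →L[ℂ] H)ˣ) : H →L[ℂ] H) := by simp
    rw [hone]
    exact contDiffAt_ringInverse ℝ _
  have hrestrict : ContDiffAt ℝ n (fun p : ℝ × X =>
      (Ring.inverse (1 - (p.1 : ℂ) • T p.2)).restrictScalars ℝ) (0, x) :=
    (ContinuousLinearMap.restrictScalarsL ℂ H H ℝ ℝ).contDiff.contDiffAt.comp _ hinverse
  have hrhs : ContDiffAt ℝ n (fun p : ℝ × X => (p.1 : ℂ) • g p.2) (0, x) :=
    (Complex.ofRealCLM.contDiff.comp contDiff_fst).contDiffAt.smul <|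
      ContDiffAt.comp ((0 : ℝ), x) hg contDiffAt_snd
  exact hrestrict.clm_apply hrhs

omit [CompleteSpace H] in
lemma inverse_one_sub_apply_eq {T : H →L[ℂ] H} (hT : IsUnit (1 - T)) (g : H) :
    Ring.inverse (1 - T) g = T (Ring.inverse (1 - T) g) + g := by
  have hsolves : (1 - T) (Ring.inverse (1 - T) g) = g := by
    rw [← mul_apply_eq_comp, Ring.mul_inverse_cancel _ hT]
    rfl
  rwa [_root_.sub_apply, sub_eq_iff_eq_add, add_comm] at hsolves

end ResolventFamily

section FuchsianGauge

open Metric BoundedHolomorphic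

variable {E : Type*} [NormedRing E] [NormedAlgebra ℂ E] [CompleteSpace E] {q b c : ℂ} {r : ℝ}

/-- The operator `Q ↦ J (Q R - R Q + (z - c) Q h)`, where `J` is the radial average from `c`, as a
function of the residue `R` and the regular part `h` of a Fuchsian system
`Y' = t Y (R / (z - c) + h)`. -/
noncomputable def gaugeOp (hc : c ∈ ball q r) :
    E × BoundedHolomorphic (ball q r) E →L[ℂ]
      BoundedHolomorphic (ball q r) E →L[ℂ] BoundedHolomorphic (ball q r) E :=
  let mulL := ContinuousLinearMap.mul ℂ (BoundedHolomorphic (ball q r) E)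
  let compL := ContinuousLinearMap.compL ℂ (BoundedHolomorphic (ball q r) E)
    (BoundedHolomorphic (ball q r) E) (BoundedHolomorphic (ball q r) E)
  compL (radialAverageL hc) ∘L
    (((mulL.flip - mulL) ∘L smulConst 1).coprod
      (compL.flip (mulL (smulConst (coord q r - c • 1) 1)) ∘L mulL.flip))

lemma gaugeOp_apply (hc : c ∈ ball q r) (x : E × BoundedHolomorphic (ball q r) E)
    (Q : BoundedHolomorphic (ball q r) E) :
    gaugeOp hc x Q = radialAverageL hc (Q * smulConst 1 x.1 - smulConst 1 x.1 * Q +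
      smulConst (coord q r - c • 1) 1 * Q * x.2) := by
  simp [gaugeOp, map_add, map_sub]

/-- The solution `Q` of `Q = t J (Q R - R Q + (1 + (z - c) Q) h)`, for `p = (t, (R, h))`. -/
noncomputable def gaugeCoeff (hc : c ∈ ball q r)
    (p : ℝ × E × BoundedHolomorphic (ball q r) E) : BoundedHolomorphic (ball q r) E :=
  Ring.inverse (1 - (p.1 : ℂ) • gaugeOp hc p.2) ((p.1 : ℂ) • radialAverageL hc p.2.2)

/-- The gauge `P = 1 + (z - c) Q`. It removes the regular part of `Y' = t Y (R / (z - c) + h)`: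
solutions are `Y = exp (t log (z - c) R) P`. -/
noncomputable def gauge (hc : c ∈ ball q r) (p : ℝ × E × BoundedHolomorphic (ball q r) E)
    (z : ℂ) : E :=
  1 + (z - c) • evalAt z (gaugeCoeff hc p)

/-- The system with data `p = (t, (R, h))` is regular at the base point `b` if the equation for the
gauge is uniquely solvable and the gauge is invertible at `b`. -/
def IsRegularAt (hc : c ∈ ball q r) (b : ℂ) (p : ℝ × E × BoundedHolomorphic (ball q r) E) :
    Prop :=
  IsUnit (1 - (p.1 : ℂ) • gaugeOp hc p.2) ∧ IsUnit (gauge hc p b)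

/-- The logarithm of the monodromy, based at `b`, of a Fuchsian system around its pole, divided by
`2 π i t`. It is conjugate to the residue. -/
noncomputable def logMonodromy (hc : c ∈ ball q r) (b : ℂ)
    (p : ℝ × E × BoundedHolomorphic (ball q r) E) : E :=
  Ring.inverse (gauge hc p b) * p.2.1 * gauge hc p b

/-- The solution of a Fuchsian system along a curve `γ` with initial value `1` at `b`, where `ℓ` is
a logarithm of `γ - c`. -/
noncomputable def fuchsianSolution (hc : c ∈ ball q r) (b : ℂ) (ℓ γ : ℝ → ℂ)
    (p : ℝ × E × BoundedHolomorphic (ball q r) E) (s : ℝ) : E :=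
  Ring.inverse (gauge hc p b) *
    (NormedSpace.exp (((p.1 : ℂ) * ℓ s) • p.2.1) * gauge hc p (γ s))

variable (hc : c ∈ ball q r) (x : E × BoundedHolomorphic (ball q r) E)

lemma gauge_zero (z : ℂ) : gauge hc (0, x) z = 1 := by
  simp [gauge, gaugeCoeff]

lemma logMonodromy_zero : logMonodromy hc b (0, x) = x.1 := by
  simp [logMonodromy, gauge_zero]

lemma contDiff_gaugeOp {n : WithTop ℕ∞} : ContDiff ℝ n (gaugeOp (E := E) hc) :=
  (gaugeOp (E := E) hc).contDiff.restrict_scalars ℝ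

lemma contDiffAt_gaugeCoeff {n : WithTop ℕ∞} : ContDiffAt ℝ n (gaugeCoeff hc) (0, x) :=
  have := BoundedHolomorphic.completeSpace (E := E) (isOpen_ball (x := q) (ε := r))
  contDiffAt_inverse_one_sub_smul_apply (contDiff_gaugeOp hc).contDiffAt
    (((radialAverageL hc).restrictScalars ℝ).contDiff.contDiffAt.comp x contDiffAt_snd)

lemma contDiffAt_gauge {n : WithTop ℕ∞} (z : ℂ) :
    ContDiffAt ℝ n (fun p => gauge hc p z) (0, x) := by
  have heval : ContDiffAt ℝ n (fun p => evalAt z (gaugeCoeff hc p)) (0, x) :=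
    ((evalAt z).restrictScalars ℝ).contDiff.contDiffAt.comp _ (contDiffAt_gaugeCoeff hc x)
  exact contDiffAt_const.add (heval.const_smul (z - c))

lemma contDiffAt_logMonodromy {n : WithTop ℕ∞} :
    ContDiffAt ℝ n (logMonodromy hc b) (0, x) := by
  have hgauge := contDiffAt_gauge hc x b (n := n)
  have hinverse : ContDiffAt ℝ n (fun p => Ring.inverse (gauge hc p b)) (0, x) := by
    refine ContDiffAt.comp (g := Ring.inverse) (0, x) ?_ hgauge
    rw [gauge_zero, ← Units.val_one]
    exact contDiffAt_ringInverse ℝ _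
  exact (hinverse.mul contDiffAt_snd.fst).mul hgauge

lemma eventually_isRegularAt : ∀ᶠ p in nhds ((0 : ℝ), x), IsRegularAt hc b p := by
  have := BoundedHolomorphic.completeSpace (E := E) (isOpen_ball (x := q) (ε := r))
  refine (eventually_isUnit_one_sub_smul (contDiff_gaugeOp hc).contDiffAt).and ?_
  refine (contDiffAt_gauge hc x b (n := 0)).continuousAt.eventually (p := IsUnit)
    (Units.isOpen.mem_nhds ?_)
  exact (congrArg IsUnit (gauge_zero hc x b)).mpr isUnit_one

variable {hc} {p : ℝ × E × BoundedHolomorphic (ball q r) E}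

lemma gaugeCoeff_eq (hp : IsUnit (1 - (p.1 : ℂ) • gaugeOp hc p.2)) :
    gaugeCoeff hc p = (p.1 : ℂ) • radialAverageL hc
      (gaugeCoeff hc p * smulConst 1 p.2.1 - smulConst 1 p.2.1 * gaugeCoeff hc p +
        smulConst (coord q r - c • 1) 1 * gaugeCoeff hc p * p.2.2 + p.2.2) := by
  rw [map_add, smul_add, ← gaugeOp_apply, gaugeCoeff]
  exact inverse_one_sub_apply_eq hp _

lemma hasDerivAt_gauge (hp : IsUnit (1 - (p.1 : ℂ) • gaugeOp hc p.2)) {z : ℂ}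
    (hz : z ∈ ball q r) :
    HasDerivAt (gauge hc p) ((p.1 : ℂ) • (evalAt z (gaugeCoeff hc p) * p.2.1 -
      p.2.1 * evalAt z (gaugeCoeff hc p) + gauge hc p z * evalAt z p.2.2)) z := by
  set f := gaugeCoeff hc p * smulConst 1 p.2.1 - smulConst 1 p.2.1 * gaugeCoeff hc p +
    smulConst (coord q r - c • 1) 1 * gaugeCoeff hc p * p.2.2 + p.2.2 with hf
  have hQ : gaugeCoeff hc p = (p.1 : ℂ) • radialAverageL hc f := gaugeCoeff_eq hp
  have hgauge : gauge hc p = fun w => 1 + (p.1 : ℂ) • (w - c) • evalAt w (radialAverageL hc f) := by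
    funext w
    rw [gauge, hQ, map_smul, smul_comm]
  have hderiv : HasDerivAt (gauge hc p) ((p.1 : ℂ) • evalAt z f) z := by
    rw [hgauge]
    exact ((hasDerivAt_sub_smul_evalAt_radialAverageL hc f hz).const_smul (p.1 : ℂ)).const_add 1
  convert hderiv using 2
  simp only [hf, map_add, map_sub, map_smul, evalAt_mul, evalAt_smulConst _ _ hz,
    evalAt_coord hz, evalAt_one hz, one_smul, gauge, smul_eq_mul, mul_one, smul_mul_assoc,
    one_mul, add_mul]
  abel

lemma hasDerivAt_exp_mul_gauge (hp : IsUnit (1 - (p.1 : ℂ) • gaugeOp hc p.2)) {γ ℓ : ℝ → ℂ}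
    {γ' : ℂ} {s : ℝ} (hγ : HasDerivAt γ γ' s) (hmem : γ s ∈ ball q r) (hne : γ s ≠ c)
    (hℓ : HasDerivAt ℓ (γ' / (γ s - c)) s) :
    HasDerivAt (fun s => NormedSpace.exp (((p.1 : ℂ) * ℓ s) • p.2.1) * gauge hc p (γ s))
      (γ' • ((NormedSpace.exp (((p.1 : ℂ) * ℓ s) • p.2.1) * gauge hc p (γ s)) *
        ((p.1 : ℂ) • ((γ s - c)⁻¹ • p.2.1 + evalAt (γ s) p.2.2)))) s := by
  have hexp := (hasDerivAt_exp_smul_const (𝕂 := ℂ) p.2.1 (p.1 * ℓ s)).scomp s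
    (hℓ.const_mul (p.1 : ℂ))
  have hgauge := (hasDerivAt_gauge hp hmem).scomp s hγ
  refine (hexp.mul hgauge).congr_deriv ?_
  simp only [Function.comp_apply]
  have hne' := sub_ne_zero.mpr hne
  generalize NormedSpace.exp (((p.1 : ℂ) * ℓ s) • p.2.1) = e
  unfold gauge
  generalize evalAt (γ s) (gaugeCoeff hc p) = Q
  generalize evalAt (γ s) p.2.2 = h
  generalize γ s - c = w at hne'
  simp only [smul_mul_assoc, mul_smul_comm, mul_add, mul_sub, mul_assoc, add_mul, one_mul,
    smul_smul, mul_one]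
  match_scalars <;> field_simp
  ring

lemma hasDerivAt_fuchsianSolution (hp : IsRegularAt hc b p) {γ ℓ : ℝ → ℂ} {γ' : ℂ} {s : ℝ}
    (hγ : HasDerivAt γ γ' s) (hmem : γ s ∈ ball q r) (hne : γ s ≠ c)
    (hℓ : HasDerivAt ℓ (γ' / (γ s - c)) s) :
    HasDerivAt (fuchsianSolution hc b ℓ γ p) (γ' • (fuchsianSolution hc b ℓ γ p s *
      ((p.1 : ℂ) • ((γ s - c)⁻¹ • p.2.1 + evalAt (γ s) p.2.2)))) s := by
  refine ((hasDerivAt_exp_mul_gauge hp.1 hγ hmem hne hℓ).const_mul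
    (Ring.inverse (gauge hc p b))).congr_deriv ?_
  rw [fuchsianSolution, mul_smul_comm, mul_assoc (Ring.inverse _)]

lemma fuchsianSolution_of_eq (hp : IsRegularAt hc b p) {γ ℓ : ℝ → ℂ} {s : ℝ} (hs : γ s = b) :
    fuchsianSolution hc b ℓ γ p s =
      NormedSpace.exp (((p.1 : ℂ) * ℓ s) • logMonodromy hc b p) := by
  let _ : NormedAlgebra ℚ E := NormedAlgebra.restrictScalars ℚ ℂ E
  obtain ⟨u, hu⟩ := hp.2
  rw [fuchsianSolution, hs, logMonodromy, ← hu, Ring.inverse_unit, ← mul_assoc,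
    ← smul_mul_assoc, ← mul_smul_comm, NormedSpace.exp_units_conj']

end FuchsianGauge

/-! ### A quantitative implicit function theorem -/

section ImplicitFunction

variable {E F : Type*} [NormedAddCommGroup E] [NormedSpace ℝ E] [CompleteSpace E]
  [NormedAddCommGroup F] [NormedSpace ℝ F] [CompleteSpace F]

lemma exists_ball_existsUnique_eq {f : ℝ × E → F} {v₀ : E} (hf : ContDiffAt ℝ 1 f (0, v₀))
    (hinv : (fderiv ℝ f (0, v₀) ∘L .inr ℝ ℝ E).IsInvertible) {P : ℝ × E → Prop}
    (hP : ∀ᶠ p in nhds (0, v₀), P p) :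
    ∃ δ > 0, ∃ ε > 0, ∀ t : ℝ, |t| < ε → (∃! v, ‖v - v₀‖ < δ ∧ f (t, v) = f (0, v₀)) ∧
      ∀ v, ‖v - v₀‖ < δ → P (t, v) := by
  have hstrict := hf.hasStrictFDerivAt one_ne_zero
  let ψ := hstrict.implicitFunctionOfProdDomain hinv
  have hψ : Filter.Tendsto ψ (nhds 0) (nhds v₀) :=
    hstrict.tendsto_implicitFunctionOfProdDomain hinv
  obtain ⟨δ, hδ, hball⟩ := Metric.eventually_nhds_iff.mp
    ((hstrict.eventually_apply_eq_iff_implicitFunctionOfProdDomain hinv).and hP)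
  obtain ⟨ε, hε, hψball⟩ := Metric.eventually_nhds_iff.mp (Metric.tendsto_nhds.mp hψ δ hδ)
  refine ⟨δ, hδ, min δ ε, lt_min hδ hε, fun t ht => ?_⟩
  have hnear (v : E) (hv : ‖v - v₀‖ < δ) : (f (t, v) = f (0, v₀) ↔ ψ t = v) ∧ P (t, v) :=
    hball (by simpa [Prod.dist_eq, dist_eq_norm] using ⟨ht.trans_le (min_le_left _ _), hv⟩)
  have hψt : ‖ψ t - v₀‖ < δ := by
    rw [← dist_eq_norm]
    exact hψball (by simpa using ht.trans_le (min_le_right _ _))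
  exact ⟨⟨ψ t, ⟨hψt, (hnear _ hψt).1.mpr rfl⟩, fun v hv => ((hnear v hv.1).1.mp hv.2).symm⟩,
    fun v hv => (hnear v hv).2⟩

end ImplicitFunction

/-! ### The weighted Wiener algebra -/

section AbsolutelySummable

open scoped lp

variable {ι 𝕜 F : Type*} [NontriviallyNormedField 𝕜] [NormedAddCommGroup F] [NormedSpace 𝕜 F]

lemma summable_norm_ell1 {G : Type*} [NormedAddCommGroup G] (f : ℓ¹(ι, G)) :
    Summable fun i => ‖f i‖ := by
  simpa using (lp.memℓp f).summable (by simp)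

lemma norm_ell1 {G : Type*} [NormedAddCommGroup G] (f : ℓ¹(ι, G)) : ‖f‖ = ∑' i, ‖f i‖ := by
  rw [lp.norm_eq_tsum_rpow (by simp)]
  simp

lemma ext_clm_ell1 [DecidableEq ι] {A B : ℓ¹(ι, 𝕜) →L[𝕜] F}
    (h : ∀ i, A (lp.single 1 i 1) = B (lp.single 1 i 1)) : A = B :=
  lp.ext_continuousLinearMap (by simp) fun i => ContinuousLinearMap.ext_ring (h i)

variable [CompleteSpace F] {C : ℝ} {T : ι → F}

/-- The operator `f ↦ ∑ f i • T i` on `ℓ¹` given by a bounded family `T`. -/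
noncomputable def sumSMul (T : ι → F) (hC : 0 ≤ C) (hT : ∀ i, ‖T i‖ ≤ C) :
    ℓ¹(ι, 𝕜) →L[𝕜] F :=
  (lp.tsumCLM 𝕜 ι F).comp <| lp.mapCLM 1 (fun i => ContinuousLinearMap.toSpanSingleton 𝕜 (T i)) hC
    fun i => (ContinuousLinearMap.norm_toSpanSingleton (T i)).trans_le (hT i)

lemma sumSMul_apply (hC : 0 ≤ C) (hT : ∀ i, ‖T i‖ ≤ C) (f : ℓ¹(ι, 𝕜)) :
    sumSMul T hC hT f = ∑' i, f i • T i := by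
  simp [sumSMul]

lemma norm_sumSMul_le (hC : 0 ≤ C) (hT : ∀ i, ‖T i‖ ≤ C) : ‖sumSMul (𝕜 := 𝕜) T hC hT‖ ≤ C := by
  refine (ContinuousLinearMap.opNorm_comp_le _ _).trans ?_
  simpa using mul_le_mul lp.norm_tsumCLM_le (lp.norm_mapCLM_le 1 _ hC _) (norm_nonneg _)
    zero_le_one

lemma hasSum_sumSMul (hC : 0 ≤ C) (hT : ∀ i, ‖T i‖ ≤ C) (f : ℓ¹(ι, 𝕜)) :
    HasSum (fun i => f i • T i) (sumSMul T hC hT f) := by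
  rw [sumSMul_apply]
  refine Summable.hasSum (.of_norm_bounded ((summable_norm_ell1 f).mul_right C) fun i => ?_)
  exact (norm_smul_le _ _).trans (by gcongr; exact hT i)

lemma sumSMul_single [DecidableEq ι] (hC : 0 ≤ C) (hT : ∀ i, ‖T i‖ ≤ C) (i : ι) (a : 𝕜) :
    sumSMul T hC hT (lp.single 1 i a) = a • T i := by
  rw [sumSMul_apply, tsum_eq_single i fun j hj => by rw [lp.single_apply_ne _ _ _ hj, zero_smul],
    lp.single_apply_self]

end AbsolutelySummable

section LoopAlgebra

open scoped lp

variable {ρ : ℝ}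

/-- The weight `ρ^|k|` of the Fourier mode `λ^k`. The coefficient `f_k` of a loop is stored as
`ρ^|k| f_k`, so that the norm `∑ |f_k| ρ^|k|` becomes the norm of `ℓ¹`. -/
noncomputable def weight (ρ : ℝ) (k : ℤ) : ℝ := ρ ^ k.natAbs

lemma weight_zero : weight ρ 0 = 1 := pow_zero ρ

variable [Fact (1 ≤ ρ)]

lemma one_le_weight (k : ℤ) : 1 ≤ weight ρ k := one_le_pow₀ Fact.out

lemma weight_pos (k : ℤ) : 0 < weight ρ k := zero_lt_one.trans_le (one_le_weight k)

lemma ofReal_weight_ne_zero (k : ℤ) : (weight ρ k : ℂ) ≠ 0 :=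
  Complex.ofReal_ne_zero.mpr (weight_pos k).ne'

lemma weight_add_le (k j : ℤ) : weight ρ (k + j) ≤ weight ρ k * weight ρ j :=
  (pow_le_pow_right₀ Fact.out (Int.natAbs_add_le k j)).trans_eq (pow_add _ _ _)

lemma norm_single_weight_div_le (j k : ℤ) :
    ‖(lp.single 1 (k + j) (weight ρ (k + j) / weight ρ k : ℂ) : ℓ¹(ℤ, ℂ))‖ ≤ weight ρ j := by
  rw [lp.norm_single one_pos, ← Complex.ofReal_div, Complex.norm_of_nonneg
    (div_nonneg (weight_pos _).le (weight_pos _).le), div_le_iff₀ (weight_pos _), mul_comm]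
  exact weight_add_le k j

/-- Multiplication by `λ^j` on weighted coefficient sequences. -/
noncomputable def shiftOp (ρ : ℝ) [Fact (1 ≤ ρ)] (j : ℤ) : ℓ¹(ℤ, ℂ) →L[ℂ] ℓ¹(ℤ, ℂ) :=
  sumSMul (fun k => lp.single 1 (k + j) (weight ρ (k + j) / weight ρ k : ℂ)) (weight_pos j).le
    (norm_single_weight_div_le j)

lemma norm_shiftOp_le (j : ℤ) : ‖shiftOp ρ j‖ ≤ weight ρ j :=
  norm_sumSMul_le _ _

lemma shiftOp_single (j k : ℤ) (a : ℂ) : shiftOp ρ j (lp.single 1 k a) =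
    lp.single 1 (k + j) (a * (weight ρ (k + j) / weight ρ k)) := by
  rw [shiftOp, sumSMul_single, ← lp.single_smul, smul_eq_mul]

lemma shiftOp_mul (i j : ℤ) : shiftOp ρ i * shiftOp ρ j = shiftOp ρ (j + i) :=
  ext_clm_ell1 fun k => by
    have hweight := ofReal_weight_ne_zero (ρ := ρ) (k + j)
    rw [mul_apply_eq_comp, shiftOp_single, shiftOp_single, shiftOp_single, add_assoc]
    congr 1
    field_simp

lemma shiftOp_apply (j : ℤ) (f : ℓ¹(ℤ, ℂ)) (k : ℤ) :
    shiftOp ρ j f k = weight ρ k / weight ρ (k - j) * f (k - j) := by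
  have hcomp : (lp.evalCLM ℂ (fun _ : ℤ => ℂ) 1 k).comp (shiftOp ρ j) =
      (weight ρ k / weight ρ (k - j) : ℂ) • lp.evalCLM ℂ (fun _ : ℤ => ℂ) 1 (k - j) := by
    refine ext_clm_ell1 fun i => ?_
    rw [ContinuousLinearMap.comp_apply, shiftOp_single, _root_.smul_apply]
    change (lp.single 1 (i + j) _ : ℓ¹(ℤ, ℂ)) k = _ • (lp.single 1 i 1 : ℓ¹(ℤ, ℂ)) (k - j)
    by_cases hk : k = i + j
    · simp [hk]
    · rw [lp.single_apply_ne _ _ _ hk, lp.single_apply_ne _ _ _ fun h => hk (by lia), smul_zero]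
  exact DFunLike.congr_fun hcomp f

lemma norm_zpow_div_weight_le (lam : Circle) (k : ℤ) : ‖(lam : ℂ) ^ k / weight ρ k‖ ≤ 1 := by
  rw [norm_div, norm_zpow, Circle.norm_coe, _root_.one_zpow, Complex.norm_of_nonneg
    (weight_pos _).le]
  exact (div_le_one (weight_pos _)).mpr (one_le_weight _)

/-- Evaluation at a point of the unit circle, on weighted coefficient sequences. -/
noncomputable def evalSeq (ρ : ℝ) [Fact (1 ≤ ρ)] (lam : Circle) : ℓ¹(ℤ, ℂ) →L[ℂ] ℂ :=
  sumSMul (fun k => (lam : ℂ) ^ k / weight ρ k) zero_le_one (norm_zpow_div_weight_le lam)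

lemma evalSeq_single (lam : Circle) (k : ℤ) (a : ℂ) :
    evalSeq ρ lam (lp.single 1 k a) = a * ((lam : ℂ) ^ k / weight ρ k) :=
  sumSMul_single _ _ _ _

lemma evalSeq_shiftOp (lam : Circle) (j : ℤ) (f : ℓ¹(ℤ, ℂ)) :
    evalSeq ρ lam (shiftOp ρ j f) = (lam : ℂ) ^ j * evalSeq ρ lam f := by
  have hcomp : (evalSeq ρ lam).comp (shiftOp ρ j) = (lam : ℂ) ^ j • evalSeq ρ lam := by
    refine ext_clm_ell1 fun k => ?_
    have hweight := ofReal_weight_ne_zero (ρ := ρ) (k + j)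
    simp only [ContinuousLinearMap.comp_apply, shiftOp_single, evalSeq_single,
      _root_.smul_apply, smul_eq_mul, zpow_add₀ (Circle.coe_ne_zero lam)]
    field_simp
  exact DFunLike.congr_fun hcomp f

/-- The Banach algebra of Laurent series `f = ∑ f_k λ^k` with `∑ |f_k| ρ^|k| < ∞`. It is
encoded as the algebra of all operators on the weighted coefficient sequences that commute with
multiplication by the powers of `λ`. -/
def LoopAlg (ρ : ℝ) [Fact (1 ≤ ρ)] : Type :=
  Subalgebra.centralizer ℂ (Set.range (shiftOp ρ))

namespace LoopAlg

noncomputable instance : NormedRing (LoopAlg ρ) :=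
  inferInstanceAs (NormedRing (Subalgebra.centralizer ℂ (Set.range (shiftOp ρ))))

noncomputable instance : NormedAlgebra ℂ (LoopAlg ρ) :=
  inferInstanceAs (NormedAlgebra ℂ (Subalgebra.centralizer ℂ (Set.range (shiftOp ρ))))

instance : CompleteSpace (LoopAlg ρ) :=
  (Set.isClosed_centralizer (Set.range (shiftOp ρ))).completeSpace_coe

/-- The inclusion into the bounded operators. -/
noncomputable def toOp : LoopAlg ρ →L[ℂ] ℓ¹(ℤ, ℂ) →L[ℂ] ℓ¹(ℤ, ℂ) :=
  (Subalgebra.centralizer ℂ (Set.range (shiftOp ρ))).toSubmodule.subtypeL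

lemma toOp_mul (S T : LoopAlg ρ) : toOp (S * T) = toOp S * toOp T := rfl

lemma toOp_one : toOp (1 : LoopAlg ρ) = 1 := rfl

lemma toOp_shiftOp (T : LoopAlg ρ) (k : ℤ) (f : ℓ¹(ℤ, ℂ)) :
    toOp T (shiftOp ρ k f) = shiftOp ρ k (toOp T f) :=
  DFunLike.congr_fun (T.2 _ ⟨k, rfl⟩).symm f

/-- The sequence `ρ^|k| f_k` of weighted Fourier coefficients of a loop. -/
noncomputable def weightedCoeff : LoopAlg ρ →L[ℂ] ℓ¹(ℤ, ℂ) :=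
  (ContinuousLinearMap.apply ℂ ℓ¹(ℤ, ℂ) (lp.single 1 0 1)).comp toOp

lemma weightedCoeff_apply (T : LoopAlg ρ) : weightedCoeff T = toOp T (lp.single 1 0 1) := rfl

/-- The Fourier coefficient of index `k`. -/
noncomputable def coeff (k : ℤ) : LoopAlg ρ →L[ℂ] ℂ :=
  (weight ρ k : ℂ)⁻¹ • (lp.evalCLM ℂ (fun _ : ℤ => ℂ) 1 k).comp weightedCoeff

lemma coeff_eq (k : ℤ) (T : LoopAlg ρ) : coeff k T = (weight ρ k : ℂ)⁻¹ * weightedCoeff T k := rfl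

lemma weightedCoeff_eq (T : LoopAlg ρ) (k : ℤ) : weightedCoeff T k = coeff k T * weight ρ k := by
  rw [coeff_eq, mul_comm, mul_inv_cancel_left₀ (ofReal_weight_ne_zero k)]

lemma summable_norm_coeff (T : LoopAlg ρ) : Summable fun k => ‖coeff k T‖ := by
  refine .of_nonneg_of_le (fun _ => norm_nonneg _) (fun k => ?_)
    (summable_norm_ell1 (weightedCoeff T))
  rw [weightedCoeff_eq, norm_mul, Complex.norm_of_nonneg (weight_pos k).le]
  exact le_mul_of_one_le_right (norm_nonneg _) (one_le_weight k)

lemma evalSeq_toOp (lam : Circle) (T : LoopAlg ρ) (f : ℓ¹(ℤ, ℂ)) :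
    evalSeq ρ lam (toOp T f) = evalSeq ρ lam (weightedCoeff T) * evalSeq ρ lam f := by
  have hcomp : (evalSeq ρ lam).comp (toOp T) =
      evalSeq ρ lam (weightedCoeff T) • evalSeq ρ lam := by
    refine ext_clm_ell1 fun k => ?_
    have hsingle : (lp.single 1 k 1 : ℓ¹(ℤ, ℂ)) =
        (weight ρ k : ℂ)⁻¹ • shiftOp ρ k (lp.single 1 0 1) := by
      rw [shiftOp_single, ← lp.single_smul, zero_add, weight_zero, Complex.ofReal_one, div_one,
        one_mul, smul_eq_mul, inv_mul_cancel₀ (ofReal_weight_ne_zero k)]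
    rw [ContinuousLinearMap.comp_apply, _root_.smul_apply, evalSeq_single, hsingle, map_smul,
      map_smul, toOp_shiftOp, evalSeq_shiftOp, ← weightedCoeff_apply]
    simp only [smul_eq_mul]
    ring
  exact DFunLike.congr_fun hcomp f

/-- Evaluation at a point of the unit circle. -/
noncomputable def evalHom (lam : Circle) : LoopAlg ρ →ₐ[ℂ] ℂ :=
  .ofLinearMap ((evalSeq ρ lam).comp weightedCoeff).toLinearMap
    (by
      change evalSeq ρ lam (lp.single 1 0 1) = 1
      simp [evalSeq_single, weight_zero])
    fun S T => evalSeq_toOp lam S (weightedCoeff T)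

lemma evalHom_apply (lam : Circle) (T : LoopAlg ρ) :
    evalHom lam T = evalSeq ρ lam (weightedCoeff T) := rfl

lemma norm_evalHom_le (lam : Circle) (T : LoopAlg ρ) : ‖evalHom lam T‖ ≤ ‖weightedCoeff T‖ := by
  simpa [evalHom_apply] using (evalSeq ρ lam).le_of_opNorm_le (norm_sumSMul_le _ _)
    (weightedCoeff T)

lemma continuous_evalHom (lam : Circle) : Continuous (evalHom (ρ := ρ) lam) :=
  ((evalSeq ρ lam).comp weightedCoeff).continuous

lemma hasSum_evalHom (lam : Circle) (T : LoopAlg ρ) :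
    HasSum (fun k => coeff k T * (lam : ℂ) ^ k) (evalHom lam T) := by
  convert! hasSum_sumSMul (𝕜 := ℂ) zero_le_one (norm_zpow_div_weight_le (ρ := ρ) lam)
    (weightedCoeff T) using 2 with k
  rw [coeff_eq, smul_eq_mul]
  ring

/-- The loop `λ^j`. -/
noncomputable def shift (ρ : ℝ) [Fact (1 ≤ ρ)] (j : ℤ) : LoopAlg ρ :=
  ⟨shiftOp ρ j, by
    rintro _ ⟨k, rfl⟩
    rw [shiftOp_mul, shiftOp_mul, add_comm]⟩

lemma toOp_shift (j : ℤ) : toOp (shift ρ j) = shiftOp ρ j := rfl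

lemma norm_shift_le (j : ℤ) : ‖shift ρ j‖ ≤ weight ρ j :=
  norm_shiftOp_le j

lemma coeff_shift_mul (j k : ℤ) (T : LoopAlg ρ) : coeff k (shift ρ j * T) = coeff (k - j) T := by
  have hweight := ofReal_weight_ne_zero (ρ := ρ) k
  rw [coeff_eq, coeff_eq, weightedCoeff_apply, toOp_mul, toOp_shift, mul_apply_eq_comp,
    ← weightedCoeff_apply, shiftOp_apply]
  field_simp

lemma coeff_one (k : ℤ) : coeff k (1 : LoopAlg ρ) = if k = 0 then 1 else 0 := by
  rw [coeff_eq, weightedCoeff_apply, toOp_one, one_apply_eq_self]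
  split_ifs with hk
  · simp [hk, weight_zero]
  · rw [lp.single_apply_ne _ _ _ hk, mul_zero]

lemma coeff_shift (j k : ℤ) : coeff k (shift ρ j) = if k = j then 1 else 0 := by
  simpa [sub_eq_zero] using (coeff_shift_mul (ρ := ρ) j k 1).trans (coeff_one (k - j))

lemma evalHom_shift (lam : Circle) (j : ℤ) : evalHom lam (shift ρ j) = (lam : ℂ) ^ j := by
  refine (evalSeq_shiftOp lam j (lp.single 1 0 1)).trans ?_
  simp [evalSeq_single, weight_zero]

lemma norm_smul_shift_le (ε : ℤˣ) (k : ℕ) :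
    ‖(((ε : ℤ) : ℝ) ^ k * (ρ ^ k)⁻¹) • shift ρ k‖ ≤ 1 := by
  have hρ : 0 < ρ ^ k := weight_pos (ρ := ρ) k
  have hε : |((ε : ℤ) : ℝ)| = 1 := by
    rcases Int.units_eq_one_or ε with rfl | rfl <;> simp
  refine (norm_smul_le _ _).trans ?_
  rw [norm_mul, norm_pow, Real.norm_eq_abs, hε, one_pow, one_mul, norm_inv,
    Real.norm_of_nonneg hρ.le, inv_mul_le_iff₀ hρ, mul_one]
  exact norm_shift_le (ρ := ρ) k

/-- The loop `f(ε λ)` for `ε = ±1`, where `f = ∑ v_k ρ^(-k) λ^k`. -/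
noncomputable def ofSeq (ε : ℤˣ) : ℓ¹(ℕ, ℝ) →L[ℝ] LoopAlg ρ :=
  sumSMul (fun k => (((ε : ℤ) : ℝ) ^ k * (ρ ^ k)⁻¹) • shift ρ k) zero_le_one
    (norm_smul_shift_le ε)

lemma hasSum_ofSeq (ε : ℤˣ) (v : ℓ¹(ℕ, ℝ)) (L : LoopAlg ρ →L[ℂ] ℂ) :
    HasSum (fun k : ℕ => ((v k / ρ ^ k : ℝ) : ℂ) * (((ε : ℤ) : ℂ) ^ k * L (shift ρ k)))
      (L (ofSeq ε v)) := by
  convert! (hasSum_sumSMul (𝕜 := ℝ) zero_le_one (norm_smul_shift_le ε) v).mapL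
    (L.restrictScalars ℝ) using 2 with k
  simp only [map_smul, ContinuousLinearMap.coe_restrictScalars', Complex.real_smul]
  push_cast
  ring

lemma evalHom_ofSeq (lam : Circle) (ε : ℤˣ) (v : ℓ¹(ℕ, ℝ)) : evalHom lam (ofSeq (ρ := ρ) ε v) =
    evalLoop (fun k => v k / ρ ^ k) (((ε : ℤ) : ℂ) * lam) := by
  refine (hasSum_ofSeq ε v ((evalSeq ρ lam).comp weightedCoeff)).tsum_eq.symm.trans
    (tsum_congr fun k => ?_)
  rw [mul_pow, ← zpow_natCast (lam : ℂ) k, ← evalHom_shift (ρ := ρ)]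
  rfl

lemma coeff_ofSeq_one (v : ℓ¹(ℕ, ℝ)) (k : ℤ) : coeff k (ofSeq (ρ := ρ) 1 v) =
    if 0 ≤ k then ((v k.toNat / ρ ^ k.toNat : ℝ) : ℂ) else 0 := by
  rw [← (hasSum_ofSeq 1 v (coeff k)).tsum_eq]
  simp only [coeff_shift, Units.val_one, Int.cast_one, one_pow, one_mul]
  split_ifs with hk
  · obtain ⟨n, rfl⟩ := Int.eq_ofNat_of_zero_le hk
    rw [tsum_eq_single n fun j hj => by rw [if_neg (by exact_mod_cast hj.symm), mul_zero]]
    simp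
  · exact (tsum_congr fun j => by rw [if_neg (by lia), mul_zero]).trans tsum_zero

lemma hasSum_coeff_ofSeq_mul (v : ℓ¹(ℕ, ℝ)) (T : LoopAlg ρ) (k : ℤ) :
    HasSum (fun n : ℕ => ((v n / ρ ^ n : ℝ) : ℂ) * coeff (k - n) T)
      (coeff k (ofSeq 1 v * T)) := by
  simpa [coeff_shift_mul] using
    hasSum_ofSeq 1 v ((coeff k).comp ((ContinuousLinearMap.mul ℂ (LoopAlg ρ)).flip T))

lemma coeff_ofSeq_mul_ofSeq_of_neg (v w : ℓ¹(ℕ, ℝ)) {k : ℤ} (hk : k < 0) :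
    coeff k (ofSeq 1 v * ofSeq 1 w : LoopAlg ρ) = 0 := by
  refine (hasSum_coeff_ofSeq_mul v _ k).unique (hasSum_zero.congr_fun fun n => ?_)
  rw [coeff_ofSeq_one, if_neg (by lia), mul_zero]

lemma coeff_zero_ofSeq_mul_ofSeq (v w : ℓ¹(ℕ, ℝ)) :
    coeff 0 (ofSeq 1 v * ofSeq 1 w : LoopAlg ρ) = ((v 0 * w 0 : ℝ) : ℂ) := by
  refine (hasSum_coeff_ofSeq_mul v _ 0).unique ?_
  convert! hasSum_single (f := fun n : ℕ => ((v n / ρ ^ n : ℝ) : ℂ) *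
    coeff (0 - n) (ofSeq (ρ := ρ) 1 w)) 0 fun n hn => ?_ using 1
  · simp [coeff_ofSeq_one]
  · rw [coeff_ofSeq_one, if_neg (by lia), mul_zero]

end LoopAlg

end LoopAlgebra

/-! ### Logarithms of matrices and Fourier uniqueness -/

section MatrixLogarithm

open scoped Matrix.Norms.Operator

lemma hasSum_log_exp {l : ℂ} (hl : ‖l‖ < 1 / 2) :
    HasSum (fun k : ℕ => (-1 : ℂ) ^ k / ((k : ℂ) + 1) * (exp l - 1) ^ (k + 1)) l := by
  have hexp : ‖exp l - 1‖ < 1 := by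
    linarith [norm_exp_sub_one_le (x := l) (by linarith)]
  have him := abs_lt.mp ((abs_im_le_norm l).trans_lt hl)
  have hsum := hasSum_taylorSeries_log hexp
  rw [add_sub_cancel, log_exp (by linarith [Real.pi_gt_three]) (by linarith [Real.pi_gt_three]),
    ← hasSum_nat_add_iff' 1] at hsum
  simp only [Finset.range_one, Finset.sum_singleton, Nat.cast_zero, div_zero, sub_zero] at hsum
  convert! hsum using 2 with k
  push_cast
  ring

/-- The algebra homomorphism `(a, b) ↦ a p + b (1 - p)` attached to an idempotent `p`. -/
def idempotentHom {R A : Type*} [CommRing R] [Ring A] [Algebra R A] {p : A}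
    (hp : IsIdempotentElem p) : R × R →ₐ[R] A :=
  .ofLinearMap ((LinearMap.toSpanSingleton R A p).coprod (LinearMap.toSpanSingleton R A (1 - p)))
    (by simp) fun x y => by
      simp [add_mul, mul_add, smul_smul, mul_comm, hp.eq, hp.one_sub.eq, hp.mul_one_sub_self,
        hp.one_sub_mul_self]

lemma idempotentHom_apply {R A : Type*} [CommRing R] [Ring A] [Algebra R A] {p : A}
    (hp : IsIdempotentElem p) (x : R × R) : idempotentHom hp x = x.1 • p + x.2 • (1 - p) := rfl

lemma isIdempotentElem_half_one_add {A : Type*} [Ring A] [Algebra ℂ A] {u : A} (hu : u * u = 1) :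
    IsIdempotentElem ((1 / 2 : ℂ) • (1 + u)) := by
  rw [IsIdempotentElem, smul_mul_smul_comm, add_mul, mul_add, mul_add, hu]
  simp only [mul_one, one_mul]
  module

lemma matLog_exp_of_sq_eq_zero {Y : Matrix (Fin 2) (Fin 2) ℂ} (hY : Y * Y = 0) :
    matLog (NormedSpace.exp Y) = Y := by
  have hpow (n : ℕ) : Y ^ (n + 2) = 0 := by rw [pow_add, pow_two, hY, mul_zero]
  have hexp : NormedSpace.exp Y = 1 + Y := by
    refine (congrFun (NormedSpace.exp_eq_tsum ℂ) Y).trans ?_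
    rw [tsum_eq_sum (s := Finset.range 2)]
    · simp [Finset.sum_range_succ]
    · intro n hn
      obtain ⟨k, rfl⟩ := Nat.exists_eq_add_of_le' (not_lt.mp (mt Finset.mem_range.mpr hn))
      rw [hpow, smul_zero]
  rw [matLog, hexp, add_sub_cancel_left, tsum_eq_single 0]
  · simp
  · intro k hk
    obtain ⟨j, rfl⟩ := Nat.exists_eq_succ_of_ne_zero hk
    rw [hpow, smul_zero]

lemma matLog_exp_of_sq_eq_sq {Y : Matrix (Fin 2) (Fin 2) ℂ} {l : ℂ} (hl₀ : l ≠ 0)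
    (hl : ‖l‖ < 1 / 2) (hY : Y * Y = (l ^ 2) • 1) : matLog (NormedSpace.exp Y) = Y := by
  have hunit : (l⁻¹ • Y) * (l⁻¹ • Y) = 1 := by
    rw [smul_mul_smul_comm, hY, smul_smul, ← mul_inv, ← pow_two,
      inv_mul_cancel₀ (pow_ne_zero 2 hl₀), one_smul]
  have hp := isIdempotentElem_half_one_add hunit
  let φ : ℂ × ℂ →ₐ[ℂ] Matrix (Fin 2) (Fin 2) ℂ := idempotentHom hp
  have hφ : Continuous φ := φ.toLinearMap.continuous_of_finiteDimensional
  have hφY : φ (l, -l) = Y := by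
    rw [idempotentHom_apply]
    calc l • ((1 / 2 : ℂ) • (1 + l⁻¹ • Y)) + -l • (1 - (1 / 2 : ℂ) • (1 + l⁻¹ • Y))
        = (l * l⁻¹) • Y := by module
      _ = Y := by rw [mul_inv_cancel₀ hl₀, one_smul]
  have hφexp : NormedSpace.exp Y = φ (exp l, exp (-l)) := by
    rw [← hφY, exp_eq_exp_ℂ]
    refine (NormedSpace.map_exp φ hφ (l, -l)).symm.trans (congrArg φ (Prod.ext ?_ ?_))
    · exact Prod.fst_exp _
    · exact Prod.snd_exp _
  have hsum := (hasSum_log_exp hl).prodMk (hasSum_log_exp (l := -l) (by rwa [norm_neg]))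
  rw [matLog, hφexp]
  refine (HasSum.tsum_eq ?_).trans hφY
  convert! hsum.map φ hφ using 2 with k
  rw [← map_one φ, ← map_sub, ← map_pow, ← map_smul]
  rfl

lemma matLog_exp {Y : Matrix (Fin 2) (Fin 2) ℂ} {w : ℂ} (hY : Y * Y = w • 1)
    (hw : ‖w‖ < 1 / 4) : matLog (NormedSpace.exp Y) = Y := by
  obtain ⟨l, rfl⟩ := IsAlgClosed.exists_pow_nat_eq w two_pos
  rcases eq_or_ne l 0 with rfl | hl₀
  · exact matLog_exp_of_sq_eq_zero (by rw [hY, zero_pow two_ne_zero, zero_smul])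
  · refine matLog_exp_of_sq_eq_sq hl₀ ?_ hY
    rw [norm_pow] at hw
    nlinarith [norm_nonneg l]

end MatrixLogarithm

section FourierUniqueness

lemma eq_zero_of_forall_hasSum_circle {f : ℤ → ℂ} (hf : Summable fun k => ‖f k‖)
    (h : ∀ lam : Circle, HasSum (fun k => f k * (lam : ℂ) ^ k) 0) (n : ℤ) : f n = 0 := by
  have : Fact (0 < 2 * Real.pi) := ⟨Real.two_pi_pos⟩
  have hsum : HasSum (fun k : ℤ => f k • fourier (T := 2 * Real.pi) k) 0 := by
    have hsummable : Summable fun k : ℤ => f k • fourier (T := 2 * Real.pi) k :=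
      .of_norm (by simpa [norm_smul, fourier_norm] using hf)
    convert! hsummable.hasSum
    ext x
    refine (h (AddCircle.toCircle x)).unique ?_
    convert! hsummable.hasSum.mapL (ContinuousMap.evalCLM ℂ x) using 2 with k
    simp [fourier_apply, AddCircle.toCircle_zsmul]
  have hcoeff := (hsum.mapL (ContinuousMap.toLp (E := ℂ) 2
    (AddCircle.haarAddCircle (T := 2 * Real.pi)) ℂ)).mapL
      (innerSL ℂ (fourierLp (T := 2 * Real.pi) 2 n))
  simp only [map_zero] at hcoeff
  refine (hasSum_ite_eq n (f n)).unique ?_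
  convert! hcoeff using 2 with k
  rw [map_smul, map_smul]
  change _ = f k • inner ℂ (fourierLp 2 n) (fourierLp 2 k)
  rw [orthonormal_iff_ite.mp orthonormal_fourier n k]
  simp only [eq_comm (a := k), smul_eq_mul]
  split_ifs with hnk <;> simp [hnk]

end FourierUniqueness

/-! ### Loops, singularities and rotational symmetry -/

section CircleLoop

/-- The circle with centre `q` through the origin, run through once counterclockwise on
`[0, 1]`. -/
noncomputable def circleLoop (q : ℂ) (s : ℝ) : ℂ := q * (1 - exp (2 * Real.pi * I * s))

/-- A branch of `log ((z - c) / (-c))` along `circleLoop q`, where `c` lies inside the circle. It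
comes from `z - c = -q e (1 - (1 - c / q) / e)` with `e = exp (2 π i s)`. -/
noncomputable def circleLog (q c : ℂ) (s : ℝ) : ℂ :=
  2 * Real.pi * I * s + log (1 + -((1 - c / q) * exp (-(2 * Real.pi * I * s)))) - log (c / q)

variable {q c : ℂ}

lemma circleLoop_intCast (q : ℂ) (k : ℤ) : circleLoop q k = 0 := by
  simp [circleLoop, mul_comm _ (k : ℂ), exp_int_mul_two_pi_mul_I]

lemma circleLog_intCast (q c : ℂ) (k : ℤ) : circleLog q c k = 2 * Real.pi * I * k := by
  simp [circleLog, mul_comm _ (k : ℂ), exp_neg, exp_int_mul_two_pi_mul_I]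

lemma norm_exp_two_pi_mul_I_mul (s : ℝ) : ‖exp (2 * Real.pi * I * s)‖ = 1 := by
  rw [← norm_exp_ofReal_mul_I (2 * Real.pi * s)]
  push_cast
  ring_nf

lemma norm_circleLoop_sub_centre (q : ℂ) (s : ℝ) : ‖circleLoop q s - q‖ = ‖q‖ := by
  rw [circleLoop, show q * (1 - exp (2 * Real.pi * I * s)) - q = -(q * exp (2 * Real.pi * I * s))
    by ring, norm_neg, norm_mul, norm_exp_two_pi_mul_I_mul, mul_one]

lemma circleLoop_ne (hc : ‖c - q‖ < ‖q‖) (s : ℝ) : circleLoop q s ≠ c := by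
  rintro rfl
  exact hc.ne (norm_circleLoop_sub_centre q s)

lemma hasDerivAt_circleLoop (q : ℂ) (s : ℝ) :
    HasDerivAt (circleLoop q) (-(2 * Real.pi * I * q * exp (2 * Real.pi * I * s))) s := by
  convert! ((((ofRealCLM.hasDerivAt (x := s)).const_mul (2 * Real.pi * I)).cexp.const_sub
    1).const_mul q) using 1
  simp
  ring

lemma hasDerivAt_circleLog (hc : ‖c - q‖ < ‖q‖) (s : ℝ) :
    HasDerivAt (circleLog q c) (deriv (circleLoop q) s / (circleLoop q s - c)) s := by
  have hq : q ≠ 0 := norm_pos_iff.mp ((norm_nonneg _).trans_lt hc)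
  have hslit : 1 + -((1 - c / q) * exp (-(2 * Real.pi * I * s))) ∈ slitPlane := by
    refine mem_slitPlane_of_norm_lt_one ?_
    rw [norm_neg, norm_mul, exp_neg, norm_inv, norm_exp_two_pi_mul_I_mul, inv_one, mul_one,
      one_sub_div hq, norm_div, div_lt_one (norm_pos_iff.mpr hq), norm_sub_rev]
    exact hc
  have hangle := (ofRealCLM.hasDerivAt (x := s)).const_mul (2 * Real.pi * I)
  convert! (hangle.add (((hangle.neg.cexp.const_mul (1 - c / q)).neg.const_add 1).clog_real
    hslit)).sub_const (log (c / q)) using 1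
  have hfactor : circleLoop q s - c = -(q * exp (2 * Real.pi * I * s) *
      (1 + -((1 - c / q) * exp (-(2 * Real.pi * I * s))))) := by
    rw [circleLoop, exp_neg]
    field_simp
    ring
  rw [(hasDerivAt_circleLoop q s).deriv, hfactor]
  have hlog := slitPlane_ne_zero hslit
  simp only [ofRealCLM_apply, ofReal_one, Pi.neg_apply]
  generalize hu : 1 + -((1 - c / q) * exp (-(2 * Real.pi * I * s))) = u at *
  have hexp := exp_ne_zero (2 * Real.pi * I * s)
  field_simp
  rw [← hu]
  field_simp
  ring

end CircleLoop

section Poles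

/-- The radius of the loops `γ_j`. -/
noncomputable def loopRadius (m : ℕ) : ℝ := (2 * Real.cos (Real.pi / nSing m))⁻¹

variable {m : ℕ}

lemma nSing_pos (m : ℕ) : (0 : ℝ) < nSing m := by
  rw [nSing]
  positivity

lemma nSing_ne_zero (m : ℕ) : (nSing m : ℂ) ≠ 0 := by exact_mod_cast (nSing_pos m).ne'

lemma pi_div_nSing_pos (m : ℕ) : 0 < Real.pi / nSing m := div_pos Real.pi_pos (nSing_pos m)

lemma cos_pi_div_nSing_mem_Ioo (hm : 1 ≤ m) :
    Real.cos (Real.pi / nSing m) ∈ Set.Ioo (1 / 2) 1 := by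
  have hn : (4 : ℝ) ≤ nSing m := by exact_mod_cast show 4 ≤ 2 * m + 2 by lia
  have hpos := pi_div_nSing_pos m
  have hle : Real.pi / nSing m ≤ Real.pi / 4 :=
    div_le_div_of_nonneg_left Real.pi_pos.le four_pos hn
  constructor
  · rw [← Real.cos_pi_div_three]
    exact Real.cos_lt_cos_of_nonneg_of_le_pi hpos.le (by linarith) (by linarith)
  · rw [← Real.cos_zero]
    exact Real.cos_lt_cos_of_nonneg_of_le_pi le_rfl (by linarith) hpos

lemma loopRadius_mem_Ioo (hm : 1 ≤ m) : loopRadius m ∈ Set.Ioo (1 / 2) 1 := by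
  obtain ⟨hlow, hup⟩ := cos_pi_div_nSing_mem_Ioo hm
  refine ⟨?_, inv_lt_one_of_one_lt₀ (by linarith)⟩
  rw [loopRadius, lt_inv_comm₀ (by norm_num) (by linarith)]
  linarith

lemma cos_angle_pole_lt {j : ℕ} (h₀ : 0 < j) (hj : j < nSing m) :
    Real.cos (2 * Real.pi * j / nSing m) < Real.cos (Real.pi / nSing m) := by
  have hn := nSing_pos m
  have hone : (1 : ℝ) ≤ j := by exact_mod_cast h₀
  have hsucc : (j : ℝ) + 1 ≤ nSing m := by exact_mod_cast hj
  have hlow : Real.pi / nSing m < 2 * Real.pi * j / nSing m :=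
    div_lt_div_of_pos_right (by nlinarith [Real.pi_pos]) hn
  have hup : 2 * Real.pi * j / nSing m < 2 * Real.pi - Real.pi / nSing m := by
    rw [lt_sub_iff_add_lt, ← add_div, div_lt_iff₀ hn]
    nlinarith [Real.pi_pos]
  have hpos := (pi_div_nSing_pos m).le
  rcases le_total (2 * Real.pi * j / nSing m) Real.pi with hle | hge
  · exact Real.cos_lt_cos_of_nonneg_of_le_pi hpos hle hlow
  · rw [← Real.cos_two_pi_sub]
    exact Real.cos_lt_cos_of_nonneg_of_le_pi hpos (by linarith) (by linarith)

lemma loopRadius_lt_norm_pole_sub (hm : 1 ≤ m) {j : ℕ} (h₀ : 0 < j) (hj : j < nSing m) :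
    loopRadius m < ‖pole m j - loopRadius m‖ := by
  have hradius := (loopRadius_mem_Ioo hm).1
  have hcos := (cos_pi_div_nSing_mem_Ioo hm).1
  have hangle := cos_angle_pole_lt h₀ hj
  have hpole : pole m j = exp ((2 * Real.pi * j / nSing m : ℝ) * I) := by
    rw [pole]
    push_cast
    ring_nf
  have hinv : loopRadius m * (2 * Real.cos (Real.pi / nSing m)) = 1 :=
    inv_mul_cancel₀ (by linarith)
  refine lt_of_pow_lt_pow_left₀ 2 (norm_nonneg _) ?_
  rw [Complex.sq_norm, normSq_apply, hpole]
  simp only [sub_re, sub_im, exp_ofReal_mul_I_re, exp_ofReal_mul_I_im, ofReal_re, ofReal_im]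
  nlinarith [Real.sin_sq_add_cos_sq (2 * Real.pi * j / nSing m)]

/-- A disc about the centre of the loop `γ_0` that contains the loop and the pole `1` and keeps
the distance `margin` to the other poles. -/
structure IsolatingDisc (m : ℕ) where
  radius : ℝ
  margin : ℝ
  loopRadius_lt : loopRadius m < radius
  norm_one_sub_lt : ‖(1 : ℂ) - loopRadius m‖ < loopRadius m
  margin_pos : 0 < margin
  le_norm_pole_sub : ∀ j, 0 < j → j < nSing m → radius + margin ≤ ‖pole m j - loopRadius m‖

lemma nonempty_isolatingDisc (hm : 1 ≤ m) : Nonempty (IsolatingDisc m) := by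
  obtain ⟨hlow, hup⟩ := loopRadius_mem_Ioo hm
  obtain ⟨j, hj, hmin⟩ := Finset.exists_min_image (Finset.Ico 1 (nSing m))
    (fun j => ‖pole m j - loopRadius m‖) ⟨1, by simp [nSing]⟩
  rw [Finset.mem_Ico] at hj
  have hlt := loopRadius_lt_norm_pole_sub hm hj.1 hj.2
  refine ⟨(loopRadius m + ‖pole m j - loopRadius m‖) / 2,
    (‖pole m j - loopRadius m‖ - loopRadius m) / 2, by linarith, ?_, by linarith,
    fun k hk₀ hk => ?_⟩
  · rw [← ofReal_one, ← ofReal_sub, Complex.norm_of_nonneg (by linarith)]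
    linarith
  · linarith [hmin k (Finset.mem_Ico.mpr ⟨hk₀, hk⟩)]

lemma pole_zero (m : ℕ) : pole m 0 = 1 := by simp [pole]

lemma pole_add (m j k : ℕ) : pole m (j + k) = pole m j * pole m k := by
  rw [pole, pole, pole, ← exp_add]
  push_cast
  ring_nf

lemma pole_succ (m j : ℕ) : pole m (j + 1) = pole m 1 * pole m j := by
  rw [add_comm, pole_add]

lemma pole_ne_zero (m j : ℕ) : pole m j ≠ 0 := exp_ne_zero _

lemma pole_nSing (m : ℕ) : pole m (nSing m) = 1 := by
  rw [pole, mul_div_assoc, div_self (nSing_ne_zero m), mul_one, exp_two_pi_mul_I]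

lemma loopAt_zero (m : ℕ) : loopAt m 0 = circleLoop (loopRadius m) := by
  funext s
  rw [loopAt, pole_zero, one_mul, circleLoop, loopRadius, ofReal_inv]

lemma loopAt_succ (m j : ℕ) (s : ℝ) : loopAt m (j + 1) s = pole m 1 * loopAt m j s := by
  rw [loopAt, loopAt, pole_succ]
  ring

end Poles

section Continuation

open scoped Matrix.Norms.Operator

variable {η : ℂ → Matrix (Fin 2) (Fin 2) ℂ} {γ : ℝ → ℂ} {X Z : ℝ → Matrix (Fin 2) (Fin 2) ℂ}

lemma hasDerivAt_matrix_iff {X' : Matrix (Fin 2) (Fin 2) ℂ} {s : ℝ} :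
    HasDerivAt X X' s ↔ ∀ i k, HasDerivAt (fun u => X u i k) (X' i k) s :=
  hasDerivAt_pi.trans (forall_congr' fun _ => hasDerivAt_pi)

lemma isContinuation_iff : IsContinuation η γ X ↔
    X 0 = 1 ∧ ∀ s, HasDerivAt X (deriv γ s • (X s * η (γ s))) s := by
  simp only [IsContinuation, hasDerivAt_matrix_iff]

lemma adjugate_eq_neg_of_trace_eq_zero {R : Type*} [CommRing R] {A : Matrix (Fin 2) (Fin 2) R}
    (hA : A.trace = 0) : A.adjugate = -A := by
  rw [trace_fin_two] at hA
  rw [adjugate_fin_two]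
  ext i k
  fin_cases i <;> fin_cases k <;> simp [eq_neg_of_add_eq_zero_left hA]

lemma hasDerivAt_adjugate {X' : Matrix (Fin 2) (Fin 2) ℂ} {s : ℝ} (h : HasDerivAt X X' s) :
    HasDerivAt (fun u => (X u).adjugate) X'.adjugate s := by
  rw [hasDerivAt_matrix_iff] at h ⊢
  intro i k
  simp only [adjugate_fin_two]
  fin_cases i <;> fin_cases k
  exacts [h 1 1, (h 0 1).neg, (h 1 0).neg, h 0 0]

/-- For a trace-free potential `Z adj(X)` has derivative `Z η adj(X) - Z η adj(X) = 0`. -/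
lemma IsContinuation.mul_adjugate_eq_one (htr : ∀ z, (η z).trace = 0)
    (hX : IsContinuation η γ X) (hZ : IsContinuation η γ Z) (s : ℝ) :
    Z s * (X s).adjugate = 1 := by
  rw [isContinuation_iff] at hX hZ
  have hderiv (s : ℝ) : HasDerivAt (fun u => Z u * (X u).adjugate) 0 s := by
    convert! (hZ.2 s).mul (hasDerivAt_adjugate (hX.2 s)) using 1
    rw [adjugate_smul, adjugate_mul_distrib, adjugate_eq_neg_of_trace_eq_zero (htr _)]
    simp [mul_assoc]
  have hconst := is_const_of_deriv_eq_zero (𝕜 := ℝ) (fun s => (hderiv s).differentiableAt)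
    (fun s => (hderiv s).deriv) s 0
  simpa [hX.1, hZ.1] using hconst

lemma IsContinuation.unique (htr : ∀ z, (η z).trace = 0) (hX : IsContinuation η γ X)
    (hZ : IsContinuation η γ Z) : Z = X := by
  funext s
  have hinv : (X s).adjugate * X s = 1 := mul_eq_one_comm.mp (hX.mul_adjugate_eq_one htr hX s)
  calc Z s = Z s * (X s).adjugate * X s := by rw [mul_assoc, hinv, mul_one]
    _ = X s := by rw [hX.mul_adjugate_eq_one htr hZ s, one_mul]

lemma IsContinuation.monodromy_eq (htr : ∀ z, (η z).trace = 0) (hX : IsContinuation η γ X) :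
    monodromy η γ = X 1 := by
  have hex : ∃ X, IsContinuation η γ X := ⟨X, hX⟩
  rw [monodromy, dif_pos hex, hX.unique htr hex.choose_spec]

end Continuation

section RotationalSymmetry

/-- The square of the upper left entry of `D`; conjugation by `D` multiplies the lower left entry
of a matrix by it. -/
noncomputable def twist (m : ℕ) : ℂ := exp (2 * Real.pi * I * m / nSing m)

variable {m : ℕ} {x : Param}

lemma twist_ne_zero (m : ℕ) : twist m ≠ 0 := exp_ne_zero _

lemma isUnit_det_matD (m : ℕ) : IsUnit (matD m).det := by
  simp [matD, det_fin_two_of, ← exp_add]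

lemma matD_conj (m : ℕ) (p q r s : ℂ) : (matD m)⁻¹ * !![p, q; r, s] * matD m =
    !![p, (twist m)⁻¹ * q; twist m * r, s] := by
  have hD : (matD m)⁻¹ = !![exp (-(I * Real.pi * m / nSing m)), 0;
      0, exp (I * Real.pi * m / nSing m)] :=
    inv_eq_right_inv (by simp [matD, ← exp_add, one_fin_two])
  have htwist : twist m = exp (I * Real.pi * m / nSing m) ^ 2 := by
    rw [twist, ← exp_nat_mul]
    ring_nf
  have hexp := exp_ne_zero (I * Real.pi * m / nSing m)
  rw [hD, matD, htwist, exp_neg]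
  ext i k
  fin_cases i <;> fin_cases k <;> simp <;> field_simp

lemma twist_pow_nSing (m : ℕ) : twist m ^ nSing m = 1 := by
  rw [twist, ← exp_nat_mul, mul_div_cancel₀ _ (nSing_ne_zero m), mul_comm, exp_nat_mul_two_pi_mul_I]

lemma pole_one_pow (m : ℕ) : pole m 1 ^ m = twist m := by
  rw [pole, twist, ← exp_nat_mul]
  push_cast
  ring_nf

lemma matA_eq (m : ℕ) (x : Param) (j : ℕ) (lam : ℂ) : matA m x j lam =
    !![evalLoop x.a ((-1) ^ j * lam),
      (twist m ^ j)⁻¹ * (((-1) ^ j * lam)⁻¹ * evalLoop x.b ((-1) ^ j * lam));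
      twist m ^ j * (((-1) ^ j * lam) * evalLoop x.c ((-1) ^ j * lam)),
      -evalLoop x.a ((-1) ^ j * lam)] := by
  induction j generalizing lam with
  | zero => simp [matA]
  | succ j ih =>
    have hsign : (-1 : ℂ) ^ j * -lam = (-1) ^ (j + 1) * lam := by ring
    rw [matA, ih (-lam), hsign, matD_conj, ← mul_assoc (twist m)⁻¹, ← mul_inv, ← pow_succ',
      ← mul_assoc (twist m), ← pow_succ']

lemma trace_matA (m : ℕ) (x : Param) (j : ℕ) (lam : ℂ) : (matA m x j lam).trace = 0 := by
  simp [matA_eq, trace_fin_two]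

lemma det_matA (m : ℕ) (x : Param) (j : ℕ) {lam : ℂ} (hlam : lam ≠ 0) : (matA m x j lam).det =
    -(evalLoop x.a ((-1) ^ j * lam) ^ 2 +
      evalLoop x.b ((-1) ^ j * lam) * evalLoop x.c ((-1) ^ j * lam)) := by
  have htwist := twist_ne_zero m
  rw [matA_eq, det_fin_two_of]
  field_simp
  ring

lemma matA_nSing (m : ℕ) (x : Param) (lam : ℂ) : matA m x (nSing m) lam = matA m x 0 lam := by
  have heven : Even (nSing m) := ⟨m + 1, by rw [nSing]; ring⟩
  rw [matA_eq, matA_eq, twist_pow_nSing, heven.neg_one_pow, pow_zero, pow_zero]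

lemma trace_potential (m : ℕ) (t : ℝ) (x : Param) (lam z : ℂ) :
    (potential m t x lam z).trace = 0 := by
  simp [potential, trace_sum, trace_matA, trace_fin_two_of]

lemma sum_residues_rotate (m : ℕ) (x : Param) (lam z : ℂ) :
    pole m 1 • ∑ j ∈ Finset.range (nSing m), (pole m 1 * z - pole m j)⁻¹ • matA m x j lam =
      (matD m)⁻¹ * (∑ j ∈ Finset.range (nSing m), (z - pole m j)⁻¹ • matA m x j (-lam)) *
        matD m := by
  have hcyclic := Finset.sum_range_succ_comm
    (fun j => (pole m 1 * z - pole m j)⁻¹ • matA m x j lam) (nSing m)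
  rw [Finset.sum_range_succ', pole_nSing, matA_nSing, pole_zero, add_comm] at hcyclic
  rw [← add_left_cancel hcyclic, Finset.smul_sum, Finset.mul_sum, Finset.sum_mul]
  refine Finset.sum_congr rfl fun j _ => ?_
  rw [pole_succ m j, ← mul_sub, mul_inv, mul_smul, smul_inv_smul₀ (pole_ne_zero m 1), matA,
    mul_smul_comm, smul_mul_assoc]

lemma potential_rotate (hm : 1 ≤ m) (t : ℝ) (x : Param) (lam z : ℂ) :
    pole m 1 • potential m t x lam (pole m 1 * z) =
      (matD m)⁻¹ * potential m t x (-lam) z * matD m := by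
  rw [potential, potential, smul_add, mul_add, add_mul, matD_conj, mul_smul_comm, smul_mul_assoc,
    smul_comm, sum_residues_rotate, ← pole_one_pow]
  congr 1
  obtain ⟨k, rfl⟩ := Nat.exists_eq_add_of_le' hm
  ext i k
  fin_cases i <;> fin_cases k <;> simp
  ring

lemma IsContinuation.rotate (hm : 1 ≤ m) {t : ℝ} {lam : ℂ} {j : ℕ}
    {X : ℝ → Matrix (Fin 2) (Fin 2) ℂ}
    (hX : IsContinuation (potential m t x (-lam)) (loopAt m j) X) :
    IsContinuation (potential m t x lam) (loopAt m (j + 1))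
      (fun s => (matD m)⁻¹ * X s * matD m) := by
  open scoped Matrix.Norms.Operator in
  rw [isContinuation_iff] at hX ⊢
  refine ⟨by simp only [hX.1, mul_one, nonsing_inv_mul _ (isUnit_det_matD m)], fun s => ?_⟩
  have hloop : deriv (loopAt m (j + 1)) s = pole m 1 * deriv (loopAt m j) s := by
    rw [funext (loopAt_succ m j), deriv_const_mul_field]
  convert! ((hX.2 s).const_mul (matD m)⁻¹).mul_const (matD m) using 1
  rw [hloop, mul_comm, mul_smul, loopAt_succ, ← mul_smul_comm (pole m 1), potential_rotate hm]
  simp only [mul_smul_comm, smul_mul_assoc, mul_assoc]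
  rw [mul_nonsing_inv_cancel_left _ _ (isUnit_det_matD m)]

lemma exists_isContinuation_loopAt (hm : 1 ≤ m) {t : ℝ}
    (hex : ∀ lam : Circle, ∃ X, IsContinuation (potential m t x lam) (loopAt m 0) X) (j : ℕ)
    {lam : ℂ} (hlam : ‖lam‖ = 1) : ∃ X, IsContinuation (potential m t x lam) (loopAt m j) X := by
  induction j generalizing lam with
  | zero => exact hex ⟨lam, mem_sphere_zero_iff_norm.mpr hlam⟩
  | succ j ih =>
    obtain ⟨X, hX⟩ := ih (lam := -lam) (by rwa [norm_neg])
    exact ⟨_, hX.rotate hm⟩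

lemma matM_succ (hm : 1 ≤ m) {t : ℝ}
    (hex : ∀ lam : Circle, ∃ X, IsContinuation (potential m t x lam) (loopAt m 0) X) (j : ℕ)
    {lam : ℂ} (hlam : ‖lam‖ = 1) :
    matM m (j + 1) t x lam = (matD m)⁻¹ * matM m j t x (-lam) * matD m := by
  obtain ⟨X, hX⟩ := exists_isContinuation_loopAt hm hex j (lam := -lam) (by rwa [norm_neg])
  rw [matM, matM, hX.monodromy_eq (trace_potential m t x _),
    (hX.rotate hm).monodromy_eq (trace_potential m t x _)]

lemma diagExp_conj_matD (m : ℕ) (t : ℝ) : (matD m)⁻¹ * diagExp t * matD m = diagExp t := by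
  rw [diagExp, matD_conj, mul_zero, mul_zero]

lemma diagExp_inv (t : ℝ) : (diagExp t)⁻¹ = diagExp (-t) :=
  inv_eq_right_inv (by simp [diagExp, ← exp_add, one_fin_two])

lemma matM_eq_diagExp_of_matM_zero (hm : 1 ≤ m) {t : ℝ}
    (hex : ∀ lam : Circle, ∃ X, IsContinuation (potential m t x lam) (loopAt m 0) X)
    (hone : matM m 0 t x 1 = diagExp t) (hneg : matM m 0 t x (-1) = diagExp (-t)) (j : ℕ) :
    matM m j t x 1 = diagExp t ^ ((-1 : ℤ) ^ j) ∧
      matM m j t x (-1) = diagExp (-t) ^ ((-1 : ℤ) ^ j) := by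
  have hinv (t : ℝ) (j : ℕ) : diagExp (-t) ^ ((-1 : ℤ) ^ j) = diagExp t ^ ((-1 : ℤ) ^ (j + 1)) := by
    rcases neg_one_pow_eq_or ℤ j with h | h <;> simp [pow_succ, h, diagExp_inv, Matrix.zpow_neg_one]
  have hconj (t : ℝ) (j : ℕ) : (matD m)⁻¹ * diagExp t ^ ((-1 : ℤ) ^ j) * matD m =
      diagExp t ^ ((-1 : ℤ) ^ j) := by
    rcases neg_one_pow_eq_or ℤ j with h | h <;>
      simp [h, diagExp_inv, Matrix.zpow_neg_one, diagExp_conj_matD]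
  induction j with
  | zero => simp [hone, hneg]
  | succ j ih =>
    rw [matM_succ hm hex j (by simp), matM_succ hm hex j (by simp), neg_neg, ih.1, ih.2, hconj,
      hconj, hinv, ← hinv (-t), neg_neg]
    exact ⟨rfl, rfl⟩

end RotationalSymmetry

/-! ### The dressed potential over the loop algebra -/

section UnipotentDressing

variable {E : Type*}

/-- The conjugate `(1 + s N) B (1 + s N)⁻¹` of `B`, for `N ^ 2 = 0`. -/
def unipotentConj [Ring E] [Algebra ℂ E] (N : E) (s : ℂ) (B : E) : E :=
  (1 + s • N) * B * (1 - s • N)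

lemma unipotentConj_eq [Ring E] [Algebra ℂ E] (N : E) (s : ℂ) (B : E) :
    unipotentConj N s B = B + s • (N * B - B * N) - s ^ 2 • (N * B * N) := by
  simp only [unipotentConj, mul_sub, add_mul, mul_one, one_mul, mul_smul_comm, smul_mul_assoc,
    smul_sub, smul_add, smul_smul, sq]
  abel

lemma unipotentConj_mul [Ring E] [Algebra ℂ E] {N : E} (hN : N * N = 0) (s : ℂ) (B : E) :
    unipotentConj N s B * (1 + s • N) = (1 + s • N) * B := by
  have hinv : (1 - s • N) * (1 + s • N) = 1 := by
    simp [mul_add, sub_mul, hN]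
  rw [unipotentConj, mul_assoc, hinv, mul_one]

lemma hasDerivAt_mul_one_add_smul [NormedRing E] [NormedAlgebra ℂ E] {N B : E} (hN : N * N = 0)
    {Y : ℝ → E} {γ : ℝ → ℂ} {γ' : ℂ} {f : ℂ → ℂ} {f' : ℂ} {s : ℝ} (hγ : HasDerivAt γ γ' s)
    (hf : HasDerivAt f f' (γ s))
    (hY : HasDerivAt Y (γ' • (Y s * unipotentConj N (f (γ s)) B)) s) :
    HasDerivAt (fun s => Y s * (1 + f (γ s) • N))
      (γ' • (Y s * (1 + f (γ s) • N) * (f' • N + B))) s := by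
  refine (hY.mul (((hf.scomp s hγ).smul_const N).const_add 1)).congr_deriv ?_
  have hconj := unipotentConj_mul hN (f (γ s)) B
  simp only [Function.comp_apply, smul_mul_assoc, mul_assoc, hconj]
  simp only [mul_add, add_mul, one_mul, mul_smul_comm, smul_mul_assoc, hN, smul_zero, add_zero]
  module

end UnipotentDressing

section LoopMatrices

open scoped Matrix.Norms.Operator lp

variable {ρ : ℝ} [Fact (1 ≤ ρ)]

/-- The Banach algebra of `2 × 2` matrices over the loop algebra. -/
abbrev LoopMat (ρ : ℝ) [Fact (1 ≤ ρ)] : Type := Matrix (Fin 2) (Fin 2) (LoopAlg ρ)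

instance : @CompleteSpace (LoopMat ρ) PseudoMetricSpace.toUniformSpace :=
  inferInstanceAs (CompleteSpace (Fin 2 → Fin 2 → LoopAlg ρ))

/-- Evaluation of the entries at a point of the unit circle. -/
noncomputable def evalMat (lam : Circle) : LoopMat ρ →ₐ[ℂ] Matrix (Fin 2) (Fin 2) ℂ :=
  (LoopAlg.evalHom lam).mapMatrix

lemma evalMat_apply (lam : Circle) (M : LoopMat ρ) (i k : Fin 2) :
    evalMat lam M i k = LoopAlg.evalHom lam (M i k) := rfl

lemma continuous_evalMat (lam : Circle) : Continuous (evalMat (ρ := ρ) lam) :=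
  continuous_id.matrix_map (LoopAlg.continuous_evalHom lam)

lemma evalMat_exp (lam : Circle) (M : LoopMat ρ) :
    evalMat lam (NormedSpace.exp M) = NormedSpace.exp (evalMat lam M) :=
  letI : NormedAlgebra ℚ (LoopMat ρ) := NormedAlgebra.restrictScalars ℚ ℂ _
  NormedSpace.map_exp (evalMat lam) (continuous_evalMat lam) M

/-- The Banach space of parameters `(r, a, b, c)`. A loop with coefficients `f_k` is represented by
the absolutely summable sequence `f_k ρ ^ k`. -/
abbrev ParamSpace := ℝ × ℓ¹(ℕ, ℝ) × ℓ¹(ℕ, ℝ) × ℓ¹(ℕ, ℝ)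

/-- The parameter represented by a point of the Banach space of parameters. -/
noncomputable def toParam (ρ : ℝ) (v : ParamSpace) : Param where
  r := v.1
  a := fun k => v.2.1 k / ρ ^ k
  b := fun k => v.2.2.1 k / ρ ^ k
  c := fun k => v.2.2.2 k / ρ ^ k

/-- The residue matrix `A_j` over the loop algebra. -/
noncomputable def loopA (ρ : ℝ) [Fact (1 ≤ ρ)] (m j : ℕ) : ParamSpace →L[ℝ] LoopMat ρ :=
  let ε : ℤˣ := (-1) ^ j
  let mulShift (u : ℂ) (k : ℤ) : LoopAlg ρ →L[ℝ] LoopAlg ρ :=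
    (ContinuousLinearMap.mul ℂ (LoopAlg ρ)
      ((u * ((ε : ℤ) : ℂ)) • LoopAlg.shift ρ k)).restrictScalars ℝ
  let a : ParamSpace →L[ℝ] LoopAlg ρ := (LoopAlg.ofSeq ε).comp
    ((ContinuousLinearMap.fst ℝ _ _).comp (ContinuousLinearMap.snd ℝ _ _))
  let b : ParamSpace →L[ℝ] LoopAlg ρ := (LoopAlg.ofSeq ε).comp ((ContinuousLinearMap.fst ℝ _ _).comp
    ((ContinuousLinearMap.snd ℝ _ _).comp (ContinuousLinearMap.snd ℝ _ _)))
  let c : ParamSpace →L[ℝ] LoopAlg ρ := (LoopAlg.ofSeq ε).comp ((ContinuousLinearMap.snd ℝ _ _).comp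
    ((ContinuousLinearMap.snd ℝ _ _).comp (ContinuousLinearMap.snd ℝ _ _)))
  ContinuousLinearMap.pi fun i => ContinuousLinearMap.pi fun k =>
    !![a, mulShift (twist m ^ j)⁻¹ (-1) ∘L b; mulShift (twist m ^ j) 1 ∘L c, -a] i k

lemma loopA_apply (m j : ℕ) (v : ParamSpace) : loopA ρ m j v =
    !![LoopAlg.ofSeq ((-1) ^ j) v.2.1,
      ((twist m ^ j)⁻¹ * (((-1 : ℤˣ) ^ j : ℤˣ) : ℤ)) • LoopAlg.shift ρ (-1) *
        LoopAlg.ofSeq ((-1) ^ j) v.2.2.1;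
      (twist m ^ j * (((-1 : ℤˣ) ^ j : ℤˣ) : ℤ)) • LoopAlg.shift ρ 1 *
        LoopAlg.ofSeq ((-1) ^ j) v.2.2.2,
      -LoopAlg.ofSeq ((-1) ^ j) v.2.1] := by
  ext i k
  fin_cases i <;> fin_cases k <;> rfl

lemma evalMat_loopA (lam : Circle) (m j : ℕ) (v : ParamSpace) :
    evalMat lam (loopA ρ m j v) = matA m (toParam ρ v) j lam := by
  have hinv : ((-1 : ℂ) ^ j)⁻¹ = (-1) ^ j := by rw [← inv_pow, inv_neg, inv_one]
  ext i k
  rw [evalMat_apply, loopA_apply, matA_eq]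
  fin_cases i <;> fin_cases k <;>
    simp [LoopAlg.evalHom_ofSeq, LoopAlg.evalHom_shift, toParam, hinv, mul_assoc,
      mul_left_comm _ (lam : ℂ)⁻¹]

/-- The nilpotent matrix `N = (0, 0; 1, 0)`, of which the unperturbed potential is a scalar
multiple. -/
noncomputable def lowerNilpotent (ρ : ℝ) [Fact (1 ≤ ρ)] : LoopMat ρ := !![0, 0; 1, 0]

lemma lowerNilpotent_mul_self : lowerNilpotent ρ * lowerNilpotent ρ = 0 := by
  ext i k
  fin_cases i <;> fin_cases k <;> simp [lowerNilpotent]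

/-- The potential `η_t` over the loop algebra. -/
noncomputable def loopPotential (ρ : ℝ) [Fact (1 ≤ ρ)] (m : ℕ) (t : ℝ) (v : ParamSpace) (z : ℂ) :
    LoopMat ρ :=
  ((m : ℂ) * v.1 * z ^ (m - 1)) • lowerNilpotent ρ +
    (t : ℂ) • ∑ j ∈ Finset.range (nSing m), (z - pole m j)⁻¹ • loopA ρ m j v

lemma evalMat_loopPotential (lam : Circle) (m : ℕ) (t : ℝ) (v : ParamSpace) (z : ℂ) :
    evalMat lam (loopPotential ρ m t v z) = potential m t (toParam ρ v) lam z := by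
  have hN : evalMat lam (lowerNilpotent ρ) = !![0, 0; 1, 0] := by
    ext i k
    fin_cases i <;> fin_cases k <;> simp [evalMat_apply, lowerNilpotent]
  rw [loopPotential, potential, map_add, map_smul, map_smul, map_sum, hN]
  simp only [map_smul, evalMat_loopA]
  simp [toParam]

end LoopMatrices

section DressedPotential

open Metric BoundedHolomorphic
open scoped Matrix.Norms.Operator

variable {ρ : ℝ} [Fact (1 ≤ ρ)] {m : ℕ}

namespace IsolatingDisc

/-- The underlying disc. -/
abbrev disc (D : IsolatingDisc m) : Set ℂ := ball (loopRadius m : ℂ) D.radius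

variable (D : IsolatingDisc m)

lemma one_mem : (1 : ℂ) ∈ D.disc :=
  mem_ball_iff_norm.mpr (D.norm_one_sub_lt.trans D.loopRadius_lt)

include D in
lemma norm_loopRadius : ‖(loopRadius m : ℂ)‖ = loopRadius m :=
  Complex.norm_of_nonneg ((norm_nonneg _).trans D.norm_one_sub_lt.le)

lemma loopAt_mem (s : ℝ) : loopAt m 0 s ∈ D.disc := by
  rw [mem_ball_iff_norm, loopAt_zero, norm_circleLoop_sub_centre, D.norm_loopRadius]
  exact D.loopRadius_lt

lemma margin_le_norm_sub {j : ℕ} (hj : j ∈ Set.Ioo 0 (nSing m)) {z : ℂ} (hz : z ∈ D.disc) :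
    D.margin ≤ ‖z - pole m j‖ := by
  have hpole := D.le_norm_pole_sub j hj.1 hj.2
  have htriangle := norm_sub_le_norm_sub_add_norm_sub (pole m j) z (loopRadius m : ℂ)
  have hz' := mem_ball_iff_norm.mp hz
  rw [norm_sub_rev z]
  linarith

/-- The function `1 / (z - p_j)` on the disc, for `j ≠ 0`. -/
noncomputable def invSub {j : ℕ} (hj : j ∈ Set.Ioo 0 (nSing m)) : BoundedHolomorphic D.disc ℂ :=
  ofBound (fun z => (z - pole m j)⁻¹)
    ((differentiableOn_id.sub_const _).inv fun _ hz => norm_pos_iff.mp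
      (D.margin_pos.trans_le (D.margin_le_norm_sub hj hz))) D.margin⁻¹ fun z hz => by
    rw [norm_inv]
    exact inv_anti₀ D.margin_pos (D.margin_le_norm_sub hj hz)

open Classical in
/-- The regular part at `p_0 = 1` of `z ^ k / (z - p_j)`. -/
noncomputable def regularPart (j k : ℕ) : BoundedHolomorphic D.disc ℂ :=
  if hj : j ∈ Set.Ioo 0 (nSing m) then D.invSub hj * coord _ _ ^ k
  else ∑ i ∈ Finset.range k, coord _ _ ^ i

lemma evalAt_regularPart {j : ℕ} (hj : j < nSing m) (k : ℕ) {z : ℂ} (hz : z ∈ D.disc)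
    (hne : z ≠ 1) : evalAt z (D.regularPart j k) =
      (z - pole m j)⁻¹ * z ^ k - if j = 0 then (z - 1)⁻¹ else 0 := by
  rcases Nat.eq_zero_or_pos j with rfl | hpos
  · have hsub : z - 1 ≠ 0 := sub_ne_zero.mpr hne
    rw [regularPart, dif_neg (by simp), map_sum]
    simp only [evalAt_pow _ hz, evalAt_coord hz, pole_zero, if_true]
    rw [geom_sum_eq hne]
    field_simp
  · have hinv : evalAt z (D.invSub ⟨hpos, hj⟩) = (z - pole m j)⁻¹ :=
      evalAt_ofBound (g := fun z => (z - pole m j)⁻¹) hz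
    rw [regularPart, dif_pos ⟨hpos, hj⟩, evalAt_mul, hinv, evalAt_pow _ hz, evalAt_coord hz,
      if_neg hpos.ne', sub_zero]

end IsolatingDisc

/-- The residue at `p_0 = 1` of the potential dressed by `Φ_0(z) = 1 + r z ^ m N`. -/
noncomputable def dressedResidue (ρ : ℝ) [Fact (1 ≤ ρ)] (m : ℕ) (v : ParamSpace) : LoopMat ρ :=
  unipotentConj (lowerNilpotent ρ) v.1 (loopA ρ m 0 v)

/-- The regular part at `p_0 = 1` of the potential dressed by `Φ_0(z) = 1 + r z ^ m N`. -/
noncomputable def dressedRegularPart (D : IsolatingDisc m) (v : ParamSpace) :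
    BoundedHolomorphic D.disc (LoopMat ρ) :=
  let N := lowerNilpotent ρ
  ∑ j ∈ Finset.range (nSing m), (smulConst (D.regularPart j 0) (loopA ρ m j v) +
    (v.1 : ℂ) • smulConst (D.regularPart j m) (N * loopA ρ m j v - loopA ρ m j v * N) -
    (v.1 : ℂ) ^ 2 • smulConst (D.regularPart j (2 * m)) (N * loopA ρ m j v * N))

variable (D : IsolatingDisc m)

lemma dressedResidue_add_dressedRegularPart (v : ParamSpace) {z : ℂ} (hz : z ∈ D.disc)
    (hne : z ≠ 1) :
    (z - 1)⁻¹ • dressedResidue ρ m v + evalAt z (dressedRegularPart D v) =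
      unipotentConj (lowerNilpotent ρ) (v.1 * z ^ m)
        (∑ j ∈ Finset.range (nSing m), (z - pole m j)⁻¹ • loopA ρ m j v) := by
  have hresidue : (z - 1)⁻¹ • dressedResidue ρ m v = ∑ j ∈ Finset.range (nSing m),
      (if j = 0 then (z - 1)⁻¹ else 0) •
        unipotentConj (lowerNilpotent ρ) v.1 (loopA ρ m j v) := by
    simp [ite_smul, dressedResidue, nSing]
  rw [hresidue, dressedRegularPart, map_sum, ← Finset.sum_add_distrib, unipotentConj,
    Finset.mul_sum, Finset.sum_mul]
  refine Finset.sum_congr rfl fun j hj => ?_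
  rw [← unipotentConj, unipotentConj_eq, unipotentConj_eq]
  simp only [map_sub, map_add, map_smul, evalAt_smulConst _ _ hz,
    D.evalAt_regularPart (Finset.mem_range.mp hj) _ hz hne, mul_smul_comm, smul_mul_assoc]
  generalize (if j = 0 then (z - 1)⁻¹ else 0) = w
  generalize lowerNilpotent ρ * loopA ρ m j v = B₁
  module

lemma contDiff_ofReal_fst {n : WithTop ℕ∞} : ContDiff ℝ n (fun v : ParamSpace => (v.1 : ℂ)) :=
  ofRealCLM.contDiff.comp contDiff_fst

lemma contDiff_dressedResidue {n : WithTop ℕ∞} : ContDiff ℝ n (dressedResidue ρ m) := by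
  have hN : ContDiff ℝ n fun v : ParamSpace => (v.1 : ℂ) • lowerNilpotent ρ :=
    contDiff_ofReal_fst.smul contDiff_const
  exact ((contDiff_const.add hN).mul (loopA ρ m 0).contDiff).mul (contDiff_const.sub hN)

lemma contDiff_dressedRegularPart {n : WithTop ℕ∞} :
    ContDiff ℝ n (dressedRegularPart (ρ := ρ) D) := by
  have hsmulConst {f : ParamSpace → LoopMat ρ} (hf : ContDiff ℝ n f)
      (s : BoundedHolomorphic D.disc ℂ) : ContDiff ℝ n fun v => smulConst s (f v) :=
    ((smulConst (E := LoopMat ρ) s).restrictScalars ℝ).contDiff.comp hf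
  refine ContDiff.sum fun j _ => ?_
  have hA : ContDiff ℝ n (loopA ρ m j) := (loopA ρ m j).contDiff
  have hN : ContDiff ℝ n fun _ : ParamSpace => lowerNilpotent ρ := contDiff_const
  exact ((hsmulConst hA _).add (contDiff_ofReal_fst.smul (hsmulConst
    ((hN.mul hA).sub (hA.mul hN)) _))).sub
      ((contDiff_ofReal_fst.pow 2).smul (hsmulConst ((hN.mul hA).mul hN) _))

end DressedPotential

section LoopMonodromy

open scoped Matrix.Norms.Operator

variable {ρ : ℝ} [Fact (1 ≤ ρ)] {m : ℕ}

lemma IsolatingDisc.ne_zero (D : IsolatingDisc m) : m ≠ 0 := by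
  rintro rfl
  have hlt := D.norm_one_sub_lt
  norm_num [loopRadius, nSing] at hlt

/-- The data `(t, (R, h))` of the dressed potential, for `p = (t, v)`. -/
noncomputable def dressedData (ρ : ℝ) [Fact (1 ≤ ρ)] (D : IsolatingDisc m) (p : ℝ × ParamSpace) :
    ℝ × LoopMat ρ × BoundedHolomorphic D.disc (LoopMat ρ) :=
  (p.1, dressedResidue ρ m p.2, dressedRegularPart D p.2)

/-- The dressed potential is regular at the base point `0` of the loops. -/
def IsRegular (ρ : ℝ) [Fact (1 ≤ ρ)] (D : IsolatingDisc m) (p : ℝ × ParamSpace) : Prop :=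
  IsRegularAt D.one_mem 0 (dressedData ρ D p)

/-- The logarithm of the monodromy `M_0`, divided by `2 π i t`. Unlike `log M_0 / t`, it makes sense
at `t = 0`. -/
noncomputable def logM (ρ : ℝ) [Fact (1 ≤ ρ)] (D : IsolatingDisc m) (p : ℝ × ParamSpace) :
    LoopMat ρ :=
  logMonodromy D.one_mem 0 (dressedData ρ D p)

/-- The continuation of `Φ_t` along the loop `γ_0`. -/
noncomputable def loopSolution (ρ : ℝ) [Fact (1 ≤ ρ)] (D : IsolatingDisc m) (p : ℝ × ParamSpace)
    (s : ℝ) : LoopMat ρ :=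
  fuchsianSolution D.one_mem 0 (circleLog (loopRadius m) 1) (loopAt m 0) (dressedData ρ D p) s *
    (1 + ((p.2.1 : ℂ) * loopAt m 0 s ^ m) • lowerNilpotent ρ)

variable (D : IsolatingDisc m)

lemma contDiff_dressedData {n : WithTop ℕ∞} : ContDiff ℝ n (dressedData ρ D) :=
  contDiff_fst.prodMk ((contDiff_dressedResidue.comp contDiff_snd).prodMk
    ((contDiff_dressedRegularPart D).comp contDiff_snd))

lemma logM_zero (v : ParamSpace) : logM ρ D (0, v) = dressedResidue ρ m v :=
  logMonodromy_zero _ _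

lemma contDiffAt_logM {n : WithTop ℕ∞} (v : ParamSpace) : ContDiffAt ℝ n (logM ρ D) (0, v) :=
  ContDiffAt.comp (0, v) (contDiffAt_logMonodromy D.one_mem _) (contDiff_dressedData D).contDiffAt

lemma eventually_isRegular (v : ParamSpace) : ∀ᶠ p in nhds ((0 : ℝ), v), IsRegular ρ D p :=
  (contDiff_dressedData (n := 0) D).continuous.continuousAt.eventually
    (eventually_isRegularAt D.one_mem _)

variable {D} {p : ℝ × ParamSpace}

lemma IsRegular.loopSolution_intCast (hp : IsRegular ρ D p) (k : ℤ) : loopSolution ρ D p k =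
    NormedSpace.exp (((p.1 : ℂ) * (2 * Real.pi * I * k)) • logM ρ D p) := by
  have hloop : loopAt m 0 (k : ℝ) = 0 := by rw [loopAt_zero, circleLoop_intCast]
  rw [loopSolution, fuchsianSolution_of_eq hp hloop, circleLog_intCast, hloop,
    zero_pow D.ne_zero, mul_zero, zero_smul, add_zero, mul_one]
  rfl

lemma IsRegular.hasDerivAt_loopSolution (hp : IsRegular ρ D p) (s : ℝ) :
    HasDerivAt (loopSolution ρ D p) (deriv (loopAt m 0) s •
      (loopSolution ρ D p s * loopPotential ρ m p.1 p.2 (loopAt m 0 s))) s := by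
  have hone : ‖(1 : ℂ) - loopRadius m‖ < ‖(loopRadius m : ℂ)‖ :=
    D.norm_loopRadius.symm ▸ D.norm_one_sub_lt
  have hne : loopAt m 0 s ≠ 1 := by
    rw [loopAt_zero]
    exact circleLoop_ne hone s
  have hγ : HasDerivAt (loopAt m 0) (deriv (loopAt m 0) s) s := by
    rw [loopAt_zero]
    exact (hasDerivAt_circleLoop _ s).differentiableAt.hasDerivAt
  have hlog : HasDerivAt (circleLog (loopRadius m) 1)
      (deriv (loopAt m 0) s / (loopAt m 0 s - 1)) s := by
    rw [loopAt_zero]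
    exact hasDerivAt_circleLog hone s
  have hpow : HasDerivAt (fun z : ℂ => (p.2.1 : ℂ) * z ^ m)
      ((m : ℂ) * p.2.1 * loopAt m 0 s ^ (m - 1)) (loopAt m 0 s) := by
    convert! (hasDerivAt_pow m (loopAt m 0 s)).const_mul (p.2.1 : ℂ) using 1
    ring
  have hdressed := hasDerivAt_fuchsianSolution hp hγ (D.loopAt_mem s) hne hlog
  rw [show (loopAt m 0 s - 1)⁻¹ • (dressedData ρ D p).2.1 +
    BoundedHolomorphic.evalAt _ (dressedData ρ D p).2.2 = _ from
    dressedResidue_add_dressedRegularPart D p.2 (D.loopAt_mem s) hne] at hdressed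
  refine hasDerivAt_mul_one_add_smul (f := fun z => (p.2.1 : ℂ) * z ^ m)
    lowerNilpotent_mul_self hγ hpow ?_
  simp only [unipotentConj, mul_smul_comm, smul_mul_assoc] at hdressed ⊢
  exact hdressed

lemma IsRegular.isContinuation (hp : IsRegular ρ D p) (lam : Circle) :
    IsContinuation (potential m p.1 (toParam ρ p.2) lam) (loopAt m 0)
      (fun s => evalMat lam (loopSolution ρ D p s)) := by
  refine isContinuation_iff.mpr ⟨?_, fun s => ?_⟩
  · have hzero := hp.loopSolution_intCast 0
    rw [Int.cast_zero, Int.cast_zero, mul_zero, mul_zero, zero_smul, NormedSpace.exp_zero] at hzero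
    rw [hzero, map_one]
  · let evalL : LoopMat ρ →L[ℂ] Matrix (Fin 2) (Fin 2) ℂ :=
      ⟨(evalMat lam).toLinearMap, continuous_evalMat lam⟩
    have hderiv := (evalL.restrictScalars ℝ).hasFDerivAt.comp_hasDerivAt s
      (hp.hasDerivAt_loopSolution s)
    convert! hderiv using 1
    change _ = evalMat lam (deriv (loopAt m 0) s • _)
    rw [map_smul, map_mul, evalMat_loopPotential]

lemma IsRegular.matM_eq (hp : IsRegular ρ D p) (lam : Circle) : matM m 0 p.1 (toParam ρ p.2) lam =
    NormedSpace.exp ((2 * Real.pi * I * p.1 : ℂ) • evalMat lam (logM ρ D p)) := by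
  have hone := hp.loopSolution_intCast 1
  rw [Int.cast_one, Int.cast_one, mul_one, mul_comm] at hone
  rw [matM, (hp.isContinuation lam).monodromy_eq (trace_potential m _ _ _), hone, evalMat_exp,
    map_smul]

end LoopMonodromy

/-! ### The system as a map between Banach spaces -/

open scoped ComplexConjugate

section ConjugationSymmetry

lemma conj_evalLoop (f : ℕ → ℝ) (lam : ℂ) : conj (evalLoop f lam) = evalLoop f (conj lam) := by
  rw [evalLoop, evalLoop, conj_tsum]
  simp

lemma norm_pole (m j : ℕ) : ‖pole m j‖ = 1 := by
  rw [pole, ← norm_exp_ofReal_mul_I (2 * Real.pi * j / nSing m)]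
  push_cast
  ring_nf

lemma norm_twist (m : ℕ) : ‖twist m‖ = 1 := by
  rw [← pole_one_pow, norm_pow, norm_pole, one_pow]

lemma conj_pole (m : ℕ) {j : ℕ} (hj : j ≤ nSing m) :
    conj (pole m j) = pole m (nSing m - j) := by
  rw [← inv_eq_conj (norm_pole m j)]
  refine inv_eq_of_mul_eq_one_right ?_
  rw [← pole_add, Nat.add_sub_cancel' hj, pole_nSing]

lemma conj_matA (m : ℕ) (x : Param) {j : ℕ} (hj : j ≤ nSing m) (lam : ℂ) :
    (matA m x j (conj lam)).map conj = matA m x (nSing m - j) lam := by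
  have hsign : (-1 : ℂ) ^ (nSing m - j) = (-1) ^ j := by
    refine neg_one_pow_congr ?_
    rw [Nat.even_sub hj]
    simp [nSing, parity_simps]
  have htwist : twist m ^ (nSing m - j) = (twist m ^ j)⁻¹ := by
    refine (inv_eq_of_mul_eq_one_right ?_).symm
    rw [← pow_add, Nat.add_sub_cancel' hj, twist_pow_nSing]
  have hconj : conj (twist m ^ j) = (twist m ^ j)⁻¹ :=
    (inv_eq_conj (by rw [norm_pow, norm_twist, one_pow])).symm
  have harg : conj ((-1 : ℂ) ^ j * conj lam) = (-1) ^ j * lam := by simp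
  rw [matA_eq, matA_eq, hsign, htwist]
  ext i k
  fin_cases i <;> fin_cases k <;>
    simp only [Fin.mk_one, Fin.zero_eta, map_apply, of_apply, cons_val', cons_val_zero,
      cons_val_one, cons_val_fin_one, map_mul, map_inv₀, map_neg, conj_evalLoop, hconj, inv_inv] <;>
    simp only [← map_mul, harg]

lemma sum_range_tsub_of_eq {M : Type*} [AddCancelCommMonoid M] {f : ℕ → M} {n : ℕ}
    (hf : f n = f 0) : ∑ j ∈ Finset.range n, f (n - j) = ∑ j ∈ Finset.range n, f j := by
  have hreflect := Finset.sum_range_reflect f (n + 1)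
  simp only [add_tsub_cancel_right] at hreflect
  rw [Finset.sum_range_succ, Finset.sum_range_succ, Nat.sub_self, hf] at hreflect
  exact add_right_cancel hreflect

lemma conj_potential (m : ℕ) (t : ℝ) (x : Param) (lam z : ℂ) :
    (potential m t x (conj lam) (conj z)).map conj = potential m t x lam z := by
  have hterm (j : ℕ) (hj : j ∈ Finset.range (nSing m)) :
      ((conj z - pole m j)⁻¹ • matA m x j (conj lam)).map conj =
        (z - pole m (nSing m - j))⁻¹ • matA m x (nSing m - j) lam := by
    have hle := (Finset.mem_range.mp hj).le
    rw [Matrix.map_smul' _ _ _ (map_mul conj), conj_matA m x hle, map_inv₀, map_sub, conj_conj,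
      conj_pole m hle]
  have hsum : (∑ j ∈ Finset.range (nSing m), (conj z - pole m j)⁻¹ • matA m x j (conj lam)).map
      conj = ∑ j ∈ Finset.range (nSing m), (z - pole m j)⁻¹ • matA m x j lam := by
    rw [← RingHom.mapMatrix_apply, map_sum, ← sum_range_tsub_of_eq
      (f := fun j => (z - pole m j)⁻¹ • matA m x j lam) (by simp only [pole_nSing, pole_zero,
        matA_nSing])]
    exact Finset.sum_congr rfl hterm
  rw [potential, potential, Matrix.map_add _ (map_add conj), Matrix.map_smul' _ _ _ (map_mul conj),
    hsum, conj_ofReal]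
  congr 1
  ext i k
  fin_cases i <;> fin_cases k <;> simp

lemma IsContinuation.conj_neg {η η' : ℂ → Matrix (Fin 2) (Fin 2) ℂ} {γ : ℝ → ℂ}
    {X : ℝ → Matrix (Fin 2) (Fin 2) ℂ} (hX : IsContinuation η γ X)
    (hη : ∀ z, (η (conj z)).map conj = η' z) (hγ : ∀ s, γ (-s) = conj (γ s))
    (hdiff : Differentiable ℝ γ) :
    IsContinuation η' γ (fun s => (X (-s)).map conj) := by
  have hconj {f : ℝ → ℂ} {f' : ℂ} {s : ℝ} (hf : HasDerivAt f f' (-s)) :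
      HasDerivAt (fun u => conj (f (-u))) (-conj f') s := by
    simpa using! conjCLE.toContinuousLinearMap.hasFDerivAt.comp_hasDerivAt s
      (hf.scomp s (hasDerivAt_neg s))
  have hderiv (s : ℝ) : deriv γ s = -conj (deriv γ (-s)) := by
    have hsymm : γ = fun u => conj (γ (-u)) := funext fun u => by rw [hγ, conj_conj]
    conv_lhs => rw [hsymm]
    exact (hconj (hdiff (-s)).hasDerivAt).deriv
  refine ⟨?_, fun s i k => (hconj (hX.2 (-s) i k)).congr_deriv ?_⟩
  · change (X (-0)).map conj = 1
    rw [neg_zero, hX.1, Matrix.map_one _ (map_zero conj) (map_one conj)]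
  · have hη' : (η (γ (-s))).map conj = η' (γ s) := by rw [hγ, hη]
    rw [hderiv s, ← hη', ← Matrix.map_mul, Matrix.smul_apply, Matrix.smul_apply, Matrix.map_apply,
      smul_eq_mul, smul_eq_mul, map_mul, neg_mul]

end ConjugationSymmetry

section SmallMonodromy

open scoped Matrix.Norms.Operator

variable {ρ : ℝ} [Fact (1 ≤ ρ)] {m : ℕ}

/-- The function `a^2 + b c = -det A_0`, over the loop algebra. -/
noncomputable def loopNegDet (ρ : ℝ) [Fact (1 ≤ ρ)] (v : ParamSpace) : LoopAlg ρ :=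
  LoopAlg.ofSeq 1 v.2.1 * LoopAlg.ofSeq 1 v.2.1 + LoopAlg.ofSeq 1 v.2.2.1 * LoopAlg.ofSeq 1 v.2.2.2

lemma continuous_loopNegDet : Continuous (loopNegDet ρ) := by
  have hofSeq : Continuous (LoopAlg.ofSeq (ρ := ρ) 1) := ContinuousLinearMap.continuous _
  unfold loopNegDet
  fun_prop

lemma evalHom_loopNegDet (lam : Circle) (v : ParamSpace) : LoopAlg.evalHom lam (loopNegDet ρ v) =
    evalLoop (toParam ρ v).a lam ^ 2 +
      evalLoop (toParam ρ v).b lam * evalLoop (toParam ρ v).c lam := by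
  simp [loopNegDet, LoopAlg.evalHom_ofSeq, toParam, sq]

lemma det_matA_toParam_zero (m : ℕ) (lam : Circle) (v : ParamSpace) :
    (matA m (toParam ρ v) 0 lam).det = -LoopAlg.evalHom lam (loopNegDet ρ v) := by
  rw [det_matA _ _ _ (Circle.coe_ne_zero lam), pow_zero, one_mul, evalHom_loopNegDet]

/-- Regular data for which `M_0` is close enough to the identity for `log M_0` to be recovered from
the power series of the logarithm. -/
structure IsSmall (ρ : ℝ) [Fact (1 ≤ ρ)] (D : IsolatingDisc m) (p : ℝ × ParamSpace) : Prop where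
  regular : IsRegular ρ D p
  small : (2 * Real.pi * p.1) ^ 2 * ‖LoopAlg.weightedCoeff (loopNegDet ρ p.2)‖ < 1 / 4

lemma eventually_isSmall (D : IsolatingDisc m) (v : ParamSpace) :
    ∀ᶠ p in nhds ((0 : ℝ), v), IsSmall ρ D p := by
  have hcont : Continuous fun p : ℝ × ParamSpace =>
      (2 * Real.pi * p.1) ^ 2 * ‖LoopAlg.weightedCoeff (loopNegDet ρ p.2)‖ :=
    (by fun_prop : Continuous fun p : ℝ × ParamSpace => (2 * Real.pi * p.1) ^ 2).mul
      (LoopAlg.weightedCoeff.continuous.comp (continuous_loopNegDet.comp continuous_snd)).norm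
  filter_upwards [eventually_isRegular (ρ := ρ) D v,
    (hcont.tendsto ((0 : ℝ), v)).eventually_lt_const (u := 1 / 4) (by simp)] with p hreg hsmall
  exact ⟨hreg, hsmall⟩

variable {D : IsolatingDisc m} {p : ℝ × ParamSpace}

lemma IsRegular.exists_units_conj (hp : IsRegular ρ D p) :
    ∃ U : (LoopMat ρ)ˣ, logM ρ D p = (U⁻¹ : (LoopMat ρ)ˣ) * loopA ρ m 0 p.2 * U := by
  have hN := lowerNilpotent_mul_self (ρ := ρ)
  obtain ⟨u, hu⟩ := hp.2
  let g : (LoopMat ρ)ˣ := ⟨1 + (p.2.1 : ℂ) • lowerNilpotent ρ, 1 - (p.2.1 : ℂ) • lowerNilpotent ρ,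
    by simp [mul_sub, add_mul, hN], by simp [mul_add, sub_mul, hN]⟩
  refine ⟨g⁻¹ * u, ?_⟩
  rw [logM, logMonodromy, ← hu, Ring.inverse_unit, _root_.mul_inv_rev, inv_inv, Units.val_mul,
    Units.val_mul]
  simp only [dressedData, dressedResidue, unipotentConj, mul_assoc]
  rfl

lemma IsRegular.exists_units_conj_evalMat (hp : IsRegular ρ D p) (lam : Circle) :
    ∃ U : (Matrix (Fin 2) (Fin 2) ℂ)ˣ, evalMat lam (logM ρ D p) =
      (U⁻¹ : (Matrix (Fin 2) (Fin 2) ℂ)ˣ) * matA m (toParam ρ p.2) 0 lam * U := by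
  obtain ⟨U, hU⟩ := hp.exists_units_conj
  refine ⟨Units.map (evalMat lam).toRingHom.toMonoidHom U, ?_⟩
  rw [hU, map_mul, map_mul, evalMat_loopA, ← map_inv]
  rfl

lemma IsRegular.trace_logM (hp : IsRegular ρ D p) (lam : Circle) :
    (evalMat lam (logM ρ D p)).trace = 0 := by
  obtain ⟨U, hU⟩ := hp.exists_units_conj_evalMat lam
  rw [hU, trace_units_conj', trace_matA]

lemma IsRegular.det_logM (hp : IsRegular ρ D p) (lam : Circle) :
    (evalMat lam (logM ρ D p)).det = -LoopAlg.evalHom lam (loopNegDet ρ p.2) := by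
  obtain ⟨U, hU⟩ := hp.exists_units_conj_evalMat lam
  rw [hU, det_units_conj', det_matA_toParam_zero]

lemma mul_self_of_trace_eq_zero {R : Type*} [CommRing R] {A : Matrix (Fin 2) (Fin 2) R}
    (hA : A.trace = 0) : A * A = (-A.det) • (1 : Matrix (Fin 2) (Fin 2) R) := by
  rw [neg_smul, ← mul_adjugate, adjugate_eq_neg_of_trace_eq_zero hA, mul_neg, neg_neg]

lemma IsSmall.exists_mul_self_eq_smul_one (hp : IsSmall ρ D p) (lam : Circle) {s : ℂ}
    (hs : ‖s‖ = ‖2 * Real.pi * p.1‖) : ∃ w : ℂ, ‖w‖ < 1 / 4 ∧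
      (s • evalMat lam (logM ρ D p)) * (s • evalMat lam (logM ρ D p)) = w • 1 := by
  refine ⟨s ^ 2 * LoopAlg.evalHom lam (loopNegDet ρ p.2), ?_, ?_⟩
  · refine lt_of_le_of_lt ?_ hp.small
    rw [norm_mul, norm_pow, hs, Real.norm_eq_abs, sq_abs]
    gcongr
    exact LoopAlg.norm_evalHom_le _ _
  · rw [smul_mul_smul_comm, mul_self_of_trace_eq_zero (hp.regular.trace_logM lam), smul_smul,
      hp.regular.det_logM, neg_neg, sq]

lemma norm_two_pi_I_mul (t : ℝ) : ‖(2 * Real.pi * I * t : ℂ)‖ = ‖2 * Real.pi * t‖ := by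
  simp

lemma IsSmall.matLog_matM (hp : IsSmall ρ D p) (lam : Circle) :
    matLog (matM m 0 p.1 (toParam ρ p.2) lam) =
      (2 * Real.pi * I * p.1 : ℂ) • evalMat lam (logM ρ D p) := by
  obtain ⟨w, hw, hsq⟩ := hp.exists_mul_self_eq_smul_one lam (norm_two_pi_I_mul p.1)
  rw [hp.regular.matM_eq, matLog_exp hsq hw]

lemma IsSmall.matMtilde_eq (hp : IsSmall ρ D p) (ht : p.1 ≠ 0) (lam : Circle) :
    matMtilde m p.1 (toParam ρ p.2) lam = (2 * Real.pi * I : ℂ) • evalMat lam (logM ρ D p) := by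
  rw [matMtilde, hp.matLog_matM, mul_comm, mul_smul, inv_smul_smul₀ (ofReal_ne_zero.mpr ht)]

lemma map_conj_exp (Y : Matrix (Fin 2) (Fin 2) ℂ) :
    (NormedSpace.exp Y).map conj = NormedSpace.exp (Y.map conj) :=
  NormedSpace.map_exp ((starRingEnd ℂ).mapMatrix (m := Fin 2))
    (continuous_id.matrix_map continuous_conj) Y

lemma IsRegular.matM_eq_map_conj (hp : IsRegular ρ D p) (lam : Circle) :
    matM m 0 p.1 (toParam ρ p.2) lam =
      NormedSpace.exp ((2 * Real.pi * I * p.1 : ℂ) • (evalMat lam⁻¹ (logM ρ D p)).map conj) := by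
  have hneg (s : ℝ) : loopAt m 0 (-s) = conj (loopAt m 0 s) := by
    simp [loopAt_zero, circleLoop, ← exp_conj, map_ofNat]
  have hdiff : Differentiable ℝ (loopAt m 0) := by
    rw [loopAt_zero]
    exact fun s => (hasDerivAt_circleLoop _ s).differentiableAt
  have hX := hp.isContinuation lam⁻¹
  rw [Circle.coe_inv_eq_conj] at hX
  have hsolution := hp.loopSolution_intCast (-1)
  rw [Int.cast_neg, Int.cast_one, Int.cast_neg, Int.cast_one] at hsolution
  rw [matM, (hX.conj_neg (conj_potential m p.1 _ lam) hneg hdiff).monodromy_eq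
    (trace_potential m _ _ _), hsolution, evalMat_exp, map_smul, map_conj_exp,
    Matrix.map_smul' _ _ _ (map_mul conj)]
  congr 2
  simp [map_ofNat]
  ring

lemma IsSmall.map_conj_evalMat_logM (hp : IsSmall ρ D p) (ht : p.1 ≠ 0) (lam : Circle) :
    (evalMat lam⁻¹ (logM ρ D p)).map conj = evalMat lam (logM ρ D p) := by
  have hne : (2 * Real.pi * I * p.1 : ℂ) ≠ 0 := by simp [ht, Real.pi_ne_zero]
  obtain ⟨w, hw, hsq⟩ := hp.exists_mul_self_eq_smul_one lam⁻¹
    (s := -(2 * Real.pi * I * p.1)) (by rw [norm_neg, norm_two_pi_I_mul])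
  have hsq_conj : ((2 * Real.pi * I * p.1 : ℂ) • (evalMat lam⁻¹ (logM ρ D p)).map conj) *
      ((2 * Real.pi * I * p.1 : ℂ) • (evalMat lam⁻¹ (logM ρ D p)).map conj) = conj w • 1 := by
    have hmap := congrArg (fun M : Matrix (Fin 2) (Fin 2) ℂ => M.map conj) hsq
    rw [Matrix.map_mul, Matrix.map_smul' _ _ _ (map_mul conj),
      Matrix.map_smul' _ _ _ (map_mul conj), Matrix.map_one _ (map_zero conj) (map_one conj)]
      at hmap
    simpa [map_ofNat] using hmap
  have hlog := hp.matLog_matM lam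
  rw [hp.regular.matM_eq_map_conj, matLog_exp hsq_conj (by rwa [RCLike.norm_conj])] at hlog
  exact smul_right_injective _ hne hlog

lemma IsSmall.conj_coeff_logM (hp : IsSmall ρ D p) (ht : p.1 ≠ 0) (i k : Fin 2) (n : ℤ) :
    conj (LoopAlg.coeff n (logM ρ D p i k)) = LoopAlg.coeff n (logM ρ D p i k) := by
  have hsummable : Summable fun n => ‖conj (LoopAlg.coeff n (logM ρ D p i k)) -
      LoopAlg.coeff n (logM ρ D p i k)‖ := by
    have hcoeff := LoopAlg.summable_norm_coeff (logM ρ D p i k)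
    refine .of_nonneg_of_le (fun _ => norm_nonneg _) (fun n => norm_sub_le _ _) ?_
    simpa only [RCLike.norm_conj] using hcoeff.add hcoeff
  refine sub_eq_zero.mp (eq_zero_of_forall_hasSum_circle hsummable (fun lam => ?_) n)
  have hconj := (LoopAlg.hasSum_evalHom lam⁻¹ (logM ρ D p i k)).mapL
    conjCLE.toContinuousLinearMap
  have hsymm : conj (LoopAlg.evalHom lam⁻¹ (logM ρ D p i k)) =
      LoopAlg.evalHom lam (logM ρ D p i k) :=
    congrFun (congrFun (hp.map_conj_evalMat_logM ht lam) i) k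
  have hsub := hconj.sub (LoopAlg.hasSum_evalHom lam (logM ρ D p i k))
  simp only [ContinuousLinearEquiv.coe_coe, conjCLE_apply, hsymm, sub_self] at hsub
  convert! hsub using 2 with n
  rw [map_mul, map_zpow₀, Circle.coe_inv_eq_conj, conj_conj, sub_mul]

end SmallMonodromy

open scoped lp Matrix.Norms.Operator

section RealFourierCoefficients

variable {ρ : ℝ} [Fact (1 ≤ ρ)]

namespace LoopAlg

lemma evalHom_eq_conj_iff {S T : LoopAlg ρ} : (∀ lam, evalHom lam S = conj (evalHom lam T)) ↔
    ∀ k, coeff k S = conj (coeff (-k) T) := by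
  have hsum (lam : Circle) : HasSum (fun k => (coeff k S - conj (coeff (-k) T)) * (lam : ℂ) ^ k)
      (evalHom lam S - conj (evalHom lam T)) := by
    have hconj := (hasSum_evalHom lam T).mapL conjCLE.toContinuousLinearMap
    rw [← (Equiv.neg ℤ).hasSum_iff] at hconj
    convert! (hasSum_evalHom lam S).sub hconj using 2 with k
    simp [sub_mul, ← Circle.coe_inv_eq_conj]
  refine ⟨fun h => ?_, fun h lam => sub_eq_zero.mp ((hsum lam).unique ?_)⟩
  · have hsummable : Summable fun k => ‖coeff k S - conj (coeff (-k) T)‖ := by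
      refine .of_nonneg_of_le (fun _ => norm_nonneg _) (fun n => norm_sub_le _ _) ?_
      simp only [RCLike.norm_conj]
      exact (summable_norm_coeff S).add ((summable_norm_coeff T).comp_injective neg_injective)
    refine fun k => sub_eq_zero.mp (eq_zero_of_forall_hasSum_circle hsummable (fun lam => ?_) k)
    exact sub_eq_zero.mpr (h lam) ▸ hsum lam
  · simp only [h, sub_self, zero_mul, hasSum_zero]

/-- The real parts of the weighted Fourier coefficients along an injective sequence of indices. -/
noncomputable def reCoeff (ρ : ℝ) [Fact (1 ≤ ρ)] (φ : ℕ ↪ ℤ) : LoopAlg ρ →L[ℝ] ℓ¹(ℕ, ℝ) :=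
  have hle (f : ℓ¹(ℤ, ℂ)) (k : ℕ) : ‖(f (φ k)).re‖ ≤ ‖f (φ k)‖ := Complex.abs_re_le_norm _
  have hsummable (f : ℓ¹(ℤ, ℂ)) : Summable fun k => ‖(f (φ k)).re‖ :=
    .of_nonneg_of_le (fun _ => norm_nonneg _) (hle f)
      ((summable_norm_ell1 f).comp_injective φ.injective)
  have hmem (f : ℓ¹(ℤ, ℂ)) : Memℓp (fun k => (f (φ k)).re) 1 :=
    memℓp_gen (by simpa using hsummable f)
  let restrict : ℓ¹(ℤ, ℂ) →ₗ[ℝ] ℓ¹(ℕ, ℝ) :=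
    { toFun := fun f => ⟨fun k => (f (φ k)).re, hmem f⟩
      map_add' := fun f g => lp.ext (funext fun k => add_re _ _)
      map_smul' := fun c f => lp.ext (funext fun k => smul_re c _) }
  (restrict.mkContinuous 1 fun f => by
    rw [one_mul, norm_ell1, norm_ell1]
    exact ((hsummable f).tsum_le_tsum (hle f)
      ((summable_norm_ell1 f).comp_injective φ.injective)).trans
        (tsum_comp_le_tsum_of_inj (summable_norm_ell1 f) (fun _ => norm_nonneg _) φ.injective)).comp
    ((weightedCoeff (ρ := ρ)).restrictScalars ℝ)

lemma reCoeff_apply (φ : ℕ ↪ ℤ) (T : LoopAlg ρ) (n : ℕ) :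
    reCoeff ρ φ T n = (coeff (φ n) T).re * weight ρ (φ n) := by
  have hcoeff : reCoeff ρ φ T n = (weightedCoeff T (φ n)).re := rfl
  rw [hcoeff, weightedCoeff_eq, re_mul_ofReal]

/-- The real parts of the weighted Fourier coefficients of index `k + j`. -/
noncomputable def posCoeff (ρ : ℝ) [Fact (1 ≤ ρ)] (j : ℤ) : LoopAlg ρ →L[ℝ] ℓ¹(ℕ, ℝ) :=
  reCoeff ρ (Nat.castEmbedding.trans (addRightEmbedding j))

/-- The real parts of the weighted Fourier coefficients of index `-(k + j)`. -/
noncomputable def negCoeff (ρ : ℝ) [Fact (1 ≤ ρ)] (j : ℤ) : LoopAlg ρ →L[ℝ] ℓ¹(ℕ, ℝ) :=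
  reCoeff ρ ((Nat.castEmbedding.trans (addRightEmbedding j)).trans (Equiv.neg ℤ).toEmbedding)

lemma posCoeff_apply (j : ℤ) (T : LoopAlg ρ) (n : ℕ) :
    posCoeff ρ j T n = (coeff (n + j) T).re * weight ρ (n + j) :=
  reCoeff_apply _ _ _

lemma negCoeff_apply (j : ℤ) (T : LoopAlg ρ) (n : ℕ) :
    negCoeff ρ j T n = (coeff (-(n + j)) T).re * weight ρ (n + j) := by
  have hweight : weight ρ (-(n + j)) = weight ρ (n + j) := by rw [weight, weight, Int.natAbs_neg]
  rw [← hweight]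
  exact reCoeff_apply _ _ _

/-- The real part of the value at a point of the unit circle. -/
noncomputable def reEval (ρ : ℝ) [Fact (1 ≤ ρ)] (lam : Circle) : LoopAlg ρ →L[ℝ] ℝ :=
  reCLM.comp (((evalSeq ρ lam).comp weightedCoeff).restrictScalars ℝ)

lemma reEval_apply (lam : Circle) (T : LoopAlg ρ) : reEval ρ lam T = (evalHom lam T).re := rfl

variable {S T : LoopAlg ρ}

lemma posCoeff_eq_negCoeff_iff (hS : ∀ k, conj (coeff k S) = coeff k S)
    (hT : ∀ k, conj (coeff k T) = coeff k T) (j : ℤ) :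
    posCoeff ρ j S = negCoeff ρ j T ↔
      ∀ n : ℕ, coeff (n + j) S = conj (coeff (-(n + j)) T) := by
  rw [lp.ext_iff, funext_iff]
  refine forall_congr' fun n => ?_
  rw [posCoeff_apply, negCoeff_apply, mul_left_inj' (weight_pos _).ne', hT, Complex.ext_iff,
    conj_eq_iff_im.mp (hS _), conj_eq_iff_im.mp (hT _), and_iff_left rfl]

lemma negCoeff_eq_posCoeff_iff (hS : ∀ k, conj (coeff k S) = coeff k S)
    (hT : ∀ k, conj (coeff k T) = coeff k T) (j : ℤ) :
    negCoeff ρ j S = posCoeff ρ j T ↔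
      ∀ n : ℕ, coeff (-(n + j)) S = conj (coeff (n + j) T) := by
  rw [eq_comm, posCoeff_eq_negCoeff_iff hT hS]
  refine forall_congr' fun n => ?_
  rw [hS, hT, eq_comm]

lemma evalHom_eq_conj_iff_coeff (hS : ∀ k, conj (coeff k S) = coeff k S)
    (hT : ∀ k, conj (coeff k T) = coeff k T) :
    (∀ lam, evalHom lam S = conj (evalHom lam T)) ↔
      posCoeff ρ 0 S = negCoeff ρ 0 T ∧ negCoeff ρ 1 S = posCoeff ρ 1 T := by
  rw [evalHom_eq_conj_iff, posCoeff_eq_negCoeff_iff hS hT, negCoeff_eq_posCoeff_iff hS hT]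
  refine ⟨fun h => ⟨fun n => h _, fun n => by simpa using h (-(n + 1))⟩, fun ⟨hpos, hneg⟩ k => ?_⟩
  rcases lt_or_ge k 0 with hk | hk
  · obtain ⟨n, rfl⟩ : ∃ n : ℕ, k = -((n : ℤ) + 1) := ⟨(-k - 1).toNat, by lia⟩
    rw [hneg n, neg_neg]
  · obtain ⟨n, rfl⟩ : ∃ n : ℕ, k = (n : ℤ) + 0 := ⟨k.toNat, by lia⟩
    exact hpos n

lemma evalHom_eq_conj_self_iff_coeff (hT : ∀ k, conj (coeff k T) = coeff k T) :
    (∀ lam, evalHom lam T = conj (evalHom lam T)) ↔ posCoeff ρ 1 T = negCoeff ρ 1 T := by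
  rw [evalHom_eq_conj_iff_coeff hT hT, eq_comm (a := negCoeff ρ 1 T), and_iff_right_iff_imp]
  intro h
  rw [posCoeff_eq_negCoeff_iff hT hT] at h ⊢
  rintro (_ | n)
  · simp [hT]
  · simpa using h n

end LoopAlg

end RealFourierCoefficients

section System

/-- The constant coefficient of `a^2 + b c - 1`. -/
noncomputable def sysK (v : ParamSpace) : ℝ := v.2.1 0 ^ 2 + v.2.2.1 0 * v.2.2.2 0 - 1

lemma eqK_toParam_eq_one_iff (ρ : ℝ) (v : ParamSpace) : eqK (toParam ρ v) = 1 ↔ sysK v = 0 := by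
  simp [eqK, sysK, toParam, sub_eq_zero]

variable {ρ : ℝ} [Fact (1 ≤ ρ)] {m : ℕ} {D : IsolatingDisc m} {p : ℝ × ParamSpace}

lemma conj_two_pi_I : conj (2 * Real.pi * I : ℂ) = -(2 * Real.pi * I) := by simp [map_ofNat]

lemma IsSmall.eqF_eq (hp : IsSmall ρ D p) (ht : p.1 ≠ 0) (lam : Circle) :
    eqF m p.1 (toParam ρ p.2) lam = LoopAlg.evalHom lam (logM ρ D p 0 0) -
      conj (LoopAlg.evalHom lam (logM ρ D p 0 0)) := by
  rw [eqF, hp.matMtilde_eq ht, Matrix.smul_apply, evalMat_apply, smul_eq_mul, map_mul,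
    conj_two_pi_I]
  field_simp
  ring

lemma IsSmall.eqG_eq (hp : IsSmall ρ D p) (ht : p.1 ≠ 0) (lam : Circle) :
    eqG m p.1 (toParam ρ p.2) lam = LoopAlg.evalHom lam (logM ρ D p 1 0) -
      conj (LoopAlg.evalHom lam (logM ρ D p 0 1)) := by
  rw [eqG, hp.matMtilde_eq ht, Matrix.smul_apply, Matrix.smul_apply, evalMat_apply, evalMat_apply,
    smul_eq_mul, smul_eq_mul, map_mul, conj_two_pi_I]
  field_simp
  ring

lemma IsSmall.eqH_eq (hp : IsSmall ρ D p) (ht : p.1 ≠ 0) (lam : Circle) :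
    eqH m p.1 (toParam ρ p.2) lam = LoopAlg.evalHom lam (logM ρ D p 0 1) := by
  rw [eqH, hp.matMtilde_eq ht, Matrix.smul_apply, evalMat_apply, smul_eq_mul,
    inv_mul_cancel_left₀ two_pi_I_ne_zero]

lemma forall_norm_eq_one_iff {P : ℂ → Prop} :
    (∀ lam : ℂ, ‖lam‖ = 1 → P lam) ↔ ∀ lam : Circle, P lam :=
  ⟨fun h lam => h lam lam.norm_coe, fun h lam hlam => h ⟨lam, mem_sphere_zero_iff_norm.mpr hlam⟩⟩

lemma IsSmall.solvesSystem_iff_evalHom (hp : IsSmall ρ D p) (ht : p.1 ≠ 0) :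
    SolvesSystem m p.1 (toParam ρ p.2) ↔
      (∀ lam, LoopAlg.evalHom lam (logM ρ D p 0 0) =
        conj (LoopAlg.evalHom lam (logM ρ D p 0 0))) ∧
      (∀ lam, LoopAlg.evalHom lam (logM ρ D p 1 0) =
        conj (LoopAlg.evalHom lam (logM ρ D p 0 1))) ∧
      LoopAlg.evalHom 1 (logM ρ D p 0 1) = 0 ∧ LoopAlg.evalHom (-1) (logM ρ D p 0 1) = 0 ∧
      eqK (toParam ρ p.2) = 1 := by
  have hone := hp.eqH_eq ht 1
  have hneg := hp.eqH_eq ht (-1)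
  rw [Circle.coe_one] at hone
  rw [Circle.coe_neg, Circle.coe_one] at hneg
  simp only [SolvesSystem, forall_norm_eq_one_iff, hp.eqF_eq ht, hp.eqG_eq ht, hone, hneg,
    sub_eq_zero]

/-- The target of the system: the coefficients of `F` and `G`, and the values `H_1`, `H_2`. -/
abbrev SysSpace := ℓ¹(ℕ, ℝ) × ℓ¹(ℕ, ℝ) × ℓ¹(ℕ, ℝ) × ℝ × ℝ

/-- The linear equations `F = 0`, `G = 0`, `H_1 = H_2 = 0`, for a logarithm of the monodromy with
real Fourier coefficients. As `F^* = -F`, its coefficients of positive index suffice. -/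
noncomputable def sysL (ρ : ℝ) [Fact (1 ≤ ρ)] : LoopMat ρ →L[ℝ] SysSpace :=
  let entry (i k : Fin 2) : LoopMat ρ →L[ℝ] LoopAlg ρ :=
    (ContinuousLinearMap.proj (R := ℝ) (φ := fun _ : Fin 2 => LoopAlg ρ) k).comp
      (ContinuousLinearMap.proj (R := ℝ) (φ := fun _ : Fin 2 => Fin 2 → LoopAlg ρ) i)
  ((LoopAlg.posCoeff ρ 1 - LoopAlg.negCoeff ρ 1).comp (entry 0 0)).prod <|
    ((LoopAlg.posCoeff ρ 0).comp (entry 1 0) - (LoopAlg.negCoeff ρ 0).comp (entry 0 1)).prod <|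
    ((LoopAlg.negCoeff ρ 1).comp (entry 1 0) - (LoopAlg.posCoeff ρ 1).comp (entry 0 1)).prod <|
    ((LoopAlg.reEval ρ 1).comp (entry 0 1)).prod ((LoopAlg.reEval ρ (-1)).comp (entry 0 1))

lemma sysL_apply (M : LoopMat ρ) : sysL ρ M =
    (LoopAlg.posCoeff ρ 1 (M 0 0) - LoopAlg.negCoeff ρ 1 (M 0 0),
      LoopAlg.posCoeff ρ 0 (M 1 0) - LoopAlg.negCoeff ρ 0 (M 0 1),
      LoopAlg.negCoeff ρ 1 (M 1 0) - LoopAlg.posCoeff ρ 1 (M 0 1),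
      LoopAlg.reEval ρ 1 (M 0 1), LoopAlg.reEval ρ (-1) (M 0 1)) := rfl

/-- The system as a map between Banach spaces, which is defined at `t = 0` as well. -/
noncomputable def sys (ρ : ℝ) [Fact (1 ≤ ρ)] (D : IsolatingDisc m) (p : ℝ × ParamSpace) :
    SysSpace × ℝ :=
  (sysL ρ (logM ρ D p), sysK p.2)

lemma IsSmall.evalHom_logM_eq_zero_iff (hp : IsSmall ρ D p) (ht : p.1 ≠ 0) {lam : Circle}
    (hlam : lam⁻¹ = lam) (i k : Fin 2) : LoopAlg.evalHom lam (logM ρ D p i k) = 0 ↔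
      LoopAlg.reEval ρ lam (logM ρ D p i k) = 0 := by
  have hreal := congrFun (congrFun (hp.map_conj_evalMat_logM ht lam) i) k
  rw [hlam, Matrix.map_apply, evalMat_apply, conj_eq_iff_im] at hreal
  rw [LoopAlg.reEval_apply, Complex.ext_iff, hreal]
  exact and_iff_left rfl

lemma IsSmall.solvesSystem_iff (hp : IsSmall ρ D p) (ht : p.1 ≠ 0) :
    SolvesSystem m p.1 (toParam ρ p.2) ↔ sys ρ D p = 0 := by
  rw [hp.solvesSystem_iff_evalHom ht,
    LoopAlg.evalHom_eq_conj_self_iff_coeff (hp.conj_coeff_logM ht 0 0),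
    LoopAlg.evalHom_eq_conj_iff_coeff (hp.conj_coeff_logM ht 1 0) (hp.conj_coeff_logM ht 0 1),
    hp.evalHom_logM_eq_zero_iff ht inv_one, hp.evalHom_logM_eq_zero_iff ht inv_neg_one,
    eqK_toParam_eq_one_iff, sys, sysL_apply]
  simp only [Prod.mk_eq_zero, sub_eq_zero, and_assoc]

end System

section Solutions

variable {ρ : ℝ} [Fact (1 ≤ ρ)] {m : ℕ} {D : IsolatingDisc m} {p : ℝ × ParamSpace}

lemma coeff_loopNegDet_of_neg (v : ParamSpace) {k : ℤ} (hk : k < 0) :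
    LoopAlg.coeff k (loopNegDet ρ v) = 0 := by
  rw [loopNegDet, map_add, LoopAlg.coeff_ofSeq_mul_ofSeq_of_neg _ _ hk,
    LoopAlg.coeff_ofSeq_mul_ofSeq_of_neg _ _ hk, add_zero]

lemma coeff_zero_loopNegDet (v : ParamSpace) :
    LoopAlg.coeff 0 (loopNegDet ρ v) = eqK (toParam ρ v) := by
  rw [loopNegDet, map_add, LoopAlg.coeff_zero_ofSeq_mul_ofSeq, LoopAlg.coeff_zero_ofSeq_mul_ofSeq]
  simp [eqK, toParam, sq]

/-- A power series which takes real values on the unit circle is constant. -/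
lemma evalHom_loopNegDet_eq_eqK {v : ParamSpace}
    (hreal : ∀ lam, LoopAlg.evalHom lam (loopNegDet ρ v) =
      conj (LoopAlg.evalHom lam (loopNegDet ρ v))) (lam : Circle) :
    LoopAlg.evalHom lam (loopNegDet ρ v) = eqK (toParam ρ v) := by
  have hcoeff (k : ℤ) (hk : k ≠ 0) : LoopAlg.coeff k (loopNegDet ρ v) = 0 := by
    rcases hk.lt_or_gt with hneg | hpos
    · exact coeff_loopNegDet_of_neg v hneg
    · rw [LoopAlg.evalHom_eq_conj_iff.mp hreal, coeff_loopNegDet_of_neg v (neg_lt_zero.mpr hpos),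
        map_zero]
  refine (LoopAlg.hasSum_evalHom lam _).unique ?_
  simpa [coeff_zero_loopNegDet] using hasSum_single (f := fun k : ℤ =>
    LoopAlg.coeff k (loopNegDet ρ v) * (lam : ℂ) ^ k) 0 fun k hk => by rw [hcoeff k hk, zero_mul]

lemma IsRegular.logM_one_one (hp : IsRegular ρ D p) (lam : Circle) :
    LoopAlg.evalHom lam (logM ρ D p 1 1) = -LoopAlg.evalHom lam (logM ρ D p 0 0) := by
  have htrace := hp.trace_logM lam
  rw [trace_fin_two, evalMat_apply, evalMat_apply] at htrace
  exact eq_neg_of_add_eq_zero_right htrace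

lemma IsRegular.evalHom_loopNegDet (hp : IsRegular ρ D p) (lam : Circle) :
    LoopAlg.evalHom lam (loopNegDet ρ p.2) = LoopAlg.evalHom lam (logM ρ D p 0 0) ^ 2 +
      LoopAlg.evalHom lam (logM ρ D p 0 1) * LoopAlg.evalHom lam (logM ρ D p 1 0) := by
  have hdet := hp.det_logM lam
  simp only [det_fin_two, evalMat_apply, hp.logM_one_one] at hdet
  linear_combination hdet

/-- Under `F = G = 0` the function `-det A_0` is real on the unit circle. -/
lemma IsSmall.evalHom_loopNegDet_eq_one (hp : IsSmall ρ D p) (ht : p.1 ≠ 0)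
    (hsolves : SolvesSystem m p.1 (toParam ρ p.2)) (lam : Circle) :
    LoopAlg.evalHom lam (loopNegDet ρ p.2) = 1 := by
  obtain ⟨hF, hG, -, -, hK⟩ := (hp.solvesSystem_iff_evalHom ht).mp hsolves
  rw [evalHom_loopNegDet_eq_eqK (fun lam => ?_), hK, ofReal_one]
  rw [hp.regular.evalHom_loopNegDet, hG, map_add, map_pow, map_mul, conj_conj, ← hF, mul_comm]

lemma IsSmall.det_matA_eq (hp : IsSmall ρ D p) (ht : p.1 ≠ 0)
    (hsolves : SolvesSystem m p.1 (toParam ρ p.2)) (j : ℕ) {lam : ℂ} (hlam : ‖lam‖ = 1) :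
    (matA m (toParam ρ p.2) j lam).det = -1 := by
  have hconst := (evalHom_loopNegDet _ p.2).symm.trans (hp.evalHom_loopNegDet_eq_one ht hsolves
    ⟨(-1) ^ j * lam, mem_sphere_zero_iff_norm.mpr (by simp [hlam])⟩)
  rw [det_matA m _ _ (norm_ne_zero_iff.mp (hlam ▸ one_ne_zero)), hconst]

lemma exp_smul_diagonal (s e : ℝ) : NormedSpace.exp ((2 * Real.pi * I * s : ℂ) •
    (!![(e : ℂ), 0; 0, -e] : Matrix (Fin 2) (Fin 2) ℂ)) = diagExp (e * s) := by
  have hdiag : (2 * Real.pi * I * s : ℂ) • !![(e : ℂ), 0; 0, -e] = Matrix.diagonal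
      ![(2 * Real.pi * I * (e * s : ℝ) : ℂ), -(2 * Real.pi * I * (e * s : ℝ))] := by
    ext i k
    fin_cases i <;> fin_cases k <;> simp <;> ring
  rw [hdiag, Matrix.exp_diagonal, diagExp]
  ext i k
  fin_cases i <;> fin_cases k <;> simp [Matrix.diagonal, ← Complex.exp_eq_exp_ℂ, Pi.coe_exp]

lemma IsSmall.matM_zero_eq_diagExp (hp : IsSmall ρ D p) (ht : p.1 ≠ 0)
    (hsolves : SolvesSystem m p.1 (toParam ρ p.2)) {lam : Circle}
    (hH : LoopAlg.evalHom lam (logM ρ D p 0 1) = 0) {e : ℝ} (he : |e| = 1)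
    (hclose : ‖LoopAlg.evalHom lam (logM ρ D p 0 0) - e‖ < 1) :
    matM m 0 p.1 (toParam ρ p.2) lam = diagExp (e * p.1) := by
  have hG := ((hp.solvesSystem_iff_evalHom ht).mp hsolves).2.1 lam
  have hsq := (hp.regular.evalHom_loopNegDet lam).symm.trans
    (hp.evalHom_loopNegDet_eq_one ht hsolves lam)
  have he_sq : (e : ℂ) ^ 2 = 1 := by rw [← ofReal_pow, ← sq_abs, he, one_pow, ofReal_one]
  have hdiag : LoopAlg.evalHom lam (logM ρ D p 0 0) = e := by
    rw [hH, zero_mul, add_zero, ← he_sq] at hsq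
    refine (sq_eq_sq_iff_eq_or_eq_neg.mp hsq).resolve_right fun hneg => ?_
    rw [hneg, ← neg_add', norm_neg, ← two_mul, norm_mul, Complex.norm_real, Real.norm_eq_abs,
      he] at hclose
    norm_num at hclose
  have hmat : evalMat lam (logM ρ D p) = !![(e : ℂ), 0; 0, -e] := by
    ext i k
    rw [evalMat_apply]
    fin_cases i <;> fin_cases k <;> simp [hdiag, hH, hG, hp.regular.logM_one_one]
  rw [hp.regular.matM_eq, hmat, exp_smul_diagonal]

end Solutions

/-! ### The linearized system -/

lemma hasDerivAt_unipotentConj {E : Type*} [NormedRing E] [NormedAlgebra ℂ E] (N : E) {s : ℝ → ℂ}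
    {s' : ℂ} {B : ℝ → E} {B' : E} {u : ℝ} (hs : HasDerivAt s s' u) (hB : HasDerivAt B B' u) :
    HasDerivAt (fun u => unipotentConj N (s u) (B u)) (unipotentConj N (s u) B' +
      s' • (N * B u * (1 - s u • N) - (1 + s u • N) * B u * N)) u := by
  refine ((((hs.smul_const N).const_add 1).mul hB).mul
    ((hs.smul_const N).const_sub 1)).congr_deriv ?_
  simp only [unipotentConj, Pi.mul_apply, smul_sub, smul_mul_assoc, add_mul, mul_neg, mul_smul_comm]
  abel

section Centre

variable {ρ : ℝ} [Fact (1 ≤ ρ)]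

lemma LoopAlg.ofSeq_single (k : ℕ) (c : ℝ) :
    ofSeq 1 (lp.single 1 k c) = ((c / ρ ^ k : ℝ) : ℂ) • shift ρ k := by
  rw [ofSeq, sumSMul_single, Complex.coe_smul, smul_smul]
  simp [div_eq_mul_inv]

lemma LoopAlg.shift_mul_shift (i j : ℤ) : shift ρ i * shift ρ j = shift ρ (i + j) :=
  Subtype.ext (by rw [add_comm]; exact shiftOp_mul i j)

lemma unipotentConj_lowerNilpotent (s : ℂ) (a b c : LoopAlg ρ) :
    unipotentConj (lowerNilpotent ρ) s !![a, b; c, -a] =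
      !![a - s • b, b; c + (2 * s) • a - s ^ 2 • b, -(a - s • b)] := by
  rw [unipotentConj_eq]
  ext i k : 2
  fin_cases i <;> fin_cases k <;>
    simp only [lowerNilpotent, Fin.zero_eta, Fin.mk_one, Matrix.smul_of, Matrix.mul_fin_two] <;>
    simp <;> module

lemma loopA_zero (m : ℕ) (v : ParamSpace) : loopA ρ m 0 v =
    !![LoopAlg.ofSeq 1 v.2.1, LoopAlg.shift ρ (-1) * LoopAlg.ofSeq 1 v.2.2.1;
      LoopAlg.shift ρ 1 * LoopAlg.ofSeq 1 v.2.2.2, -LoopAlg.ofSeq 1 v.2.1] := by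
  simp [loopA_apply]

/-- The point of the Banach space of parameters which represents the central value. -/
noncomputable def centreV (ρ : ℝ) : ParamSpace :=
  (1, lp.single 1 1 ρ, lp.single 1 2 (ρ ^ 2 / 2 : ℝ) - lp.single 1 0 (1 / 2 : ℝ),
    lp.single 1 0 (-2 : ℝ))

lemma toParam_centreV : toParam ρ (centreV ρ) = centre := by
  have hρ : ρ ≠ 0 := (zero_lt_one.trans_le Fact.out).ne'
  ext k
  · rfl
  · by_cases hk : k = 1
    · simp [toParam, centreV, centre, hk, div_self hρ]
    · simp [toParam, centreV, centre, hk]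
  · by_cases h0 : k = 0
    · simp [toParam, centreV, centre, h0]
      norm_num
    · by_cases h2 : k = 2
      · simp [toParam, centreV, centre, h2]
        field_simp
      · simp [toParam, centreV, centre, h0, h2]
  · by_cases hk : k = 0 <;> simp [toParam, centreV, centre, hk]

lemma loopA_zero_centreV (m : ℕ) : loopA ρ m 0 (centreV ρ) =
    !![LoopAlg.shift ρ 1, (1 / 2 : ℂ) • (LoopAlg.shift ρ 1 - LoopAlg.shift ρ (-1));
      (-2 : ℂ) • LoopAlg.shift ρ 1, -LoopAlg.shift ρ 1] := by
  have hρ : (ρ : ℂ) ≠ 0 := ofReal_ne_zero.mpr (zero_lt_one.trans_le Fact.out).ne'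
  have hb : LoopAlg.shift ρ (-1) * LoopAlg.ofSeq 1 (centreV ρ).2.2.1 =
      (1 / 2 : ℂ) • (LoopAlg.shift ρ 1 - LoopAlg.shift ρ (-1)) := by
    simp [centreV, LoopAlg.ofSeq_single, mul_sub, LoopAlg.shift_mul_shift, smul_sub,
      div_right_comm, div_self (pow_ne_zero 2 hρ)]
  rw [loopA_zero, hb]
  simp [centreV, LoopAlg.ofSeq_single, LoopAlg.shift_mul_shift, hρ]

lemma dressedResidue_centreV (m : ℕ) : dressedResidue ρ m (centreV ρ) =
    (1 / 2 : ℂ) • !![LoopAlg.shift ρ 1 + LoopAlg.shift ρ (-1),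
        LoopAlg.shift ρ 1 - LoopAlg.shift ρ (-1);
      LoopAlg.shift ρ (-1) - LoopAlg.shift ρ 1,
        -(LoopAlg.shift ρ 1 + LoopAlg.shift ρ (-1))] := by
  rw [dressedResidue, loopA_zero_centreV, unipotentConj_lowerNilpotent]
  ext i k : 2
  fin_cases i <;> fin_cases k <;> simp [centreV] <;> module

end Centre

section Linearization

variable {ρ : ℝ} [Fact (1 ≤ ρ)] {m : ℕ}

/-- The derivative of the dressed residue at the central value, in the direction `w`. -/
noncomputable def linearizedResidue (ρ : ℝ) [Fact (1 ≤ ρ)] (w : ParamSpace) : LoopMat ρ :=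
  let a := LoopAlg.ofSeq 1 w.2.1
  let b := LoopAlg.shift ρ (-1) * LoopAlg.ofSeq 1 w.2.2.1
  let c := LoopAlg.shift ρ 1 * LoopAlg.ofSeq 1 w.2.2.2
  let d := a - b - (w.1 / 2 : ℂ) • (LoopAlg.shift ρ 1 - LoopAlg.shift ρ (-1))
  !![d, b; c + (2 : ℂ) • a - b + (w.1 : ℂ) • (LoopAlg.shift ρ 1 + LoopAlg.shift ρ (-1)), -d]

lemma hasDerivAt_dressedResidue_centreV (w : ParamSpace) :
    HasDerivAt (fun u : ℝ => dressedResidue ρ m (centreV ρ + u • w)) (linearizedResidue ρ w) 0 := by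
  have hline : HasDerivAt (fun u : ℝ => centreV ρ + u • w) w 0 := by
    simpa using ((hasDerivAt_id (0 : ℝ)).smul_const w).const_add (centreV ρ)
  have hr : HasDerivAt (fun u : ℝ => (((centreV ρ + u • w).1 : ℝ) : ℂ)) w.1 0 :=
    ofRealCLM.hasFDerivAt.comp_hasDerivAt (0 : ℝ) hline.fst
  have hA : HasDerivAt (fun u : ℝ => loopA ρ m 0 (centreV ρ + u • w)) (loopA ρ m 0 w) 0 :=
    (loopA ρ m 0).hasFDerivAt.comp_hasDerivAt (0 : ℝ) hline
  refine (hasDerivAt_unipotentConj (lowerNilpotent ρ) hr hA).congr_deriv ?_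
  simp only [zero_smul, add_zero]
  rw [loopA_zero_centreV, loopA_zero, unipotentConj_lowerNilpotent, linearizedResidue]
  ext i k : 2
  fin_cases i <;> fin_cases k <;> simp [centreV, lowerNilpotent, Matrix.one_fin_two] <;>
    module

end Linearization

section Coefficients

variable {ρ : ℝ} [Fact (1 ≤ ρ)]

namespace LoopAlg

lemma coeff_ofSeq_of_nonneg (v : ℓ¹(ℕ, ℝ)) {k : ℤ} (hk : 0 ≤ k) :
    coeff k (ofSeq (ρ := ρ) 1 v) = ((v k.toNat / ρ ^ k.toNat : ℝ) : ℂ) := by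
  rw [coeff_ofSeq_one, if_pos hk]

lemma coeff_ofSeq_of_neg (v : ℓ¹(ℕ, ℝ)) {k : ℤ} (hk : k < 0) :
    coeff k (ofSeq (ρ := ρ) 1 v) = 0 := by
  rw [coeff_ofSeq_one, if_neg hk.not_ge]

lemma coeff_shift_of_ne {j k : ℤ} (hk : k ≠ j) : coeff k (shift ρ j) = 0 := by
  rw [coeff_shift, if_neg hk]

lemma coeff_shift_self (j : ℤ) : coeff j (shift ρ j) = 1 := by
  rw [coeff_shift, if_pos rfl]

end LoopAlg

open LoopAlg

lemma sysL_fst_apply (M : LoopMat ρ) (n : ℕ) : (sysL ρ M).1 n =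
    ((coeff (n + 1) (M 0 0)).re - (coeff (-(n + 1)) (M 0 0)).re) * weight ρ (n + 1) := by
  rw [sub_mul, ← posCoeff_apply, ← negCoeff_apply]
  rfl

lemma sysL_snd_fst_apply (M : LoopMat ρ) (n : ℕ) : (sysL ρ M).2.1 n =
    ((coeff n (M 1 0)).re - (coeff (-n) (M 0 1)).re) * weight ρ n := by
  have hpos := posCoeff_apply 0 (M 1 0) n
  have hneg := negCoeff_apply 0 (M 0 1) n
  rw [add_zero] at hpos hneg
  rw [sub_mul, ← hpos, ← hneg]
  rfl

lemma sysL_snd_snd_fst_apply (M : LoopMat ρ) (n : ℕ) : (sysL ρ M).2.2.1 n =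
    ((coeff (-(n + 1)) (M 1 0)).re - (coeff (n + 1) (M 0 1)).re) * weight ρ (n + 1) := by
  rw [sub_mul, ← posCoeff_apply, ← negCoeff_apply]
  rfl

variable (w : ParamSpace) (n : ℕ)

lemma sysL_linearizedResidue_fst_zero : (sysL ρ (linearizedResidue ρ w)).1 0 =
    ((toParam ρ w).a 1 - (toParam ρ w).b 2 + (toParam ρ w).b 0 - w.1) * ρ := by
  rw [sysL_fst_apply]
  simp (disch := lia) [linearizedResidue, coeff_shift_mul, coeff_ofSeq_of_nonneg,
    coeff_ofSeq_of_neg, coeff_shift_of_ne, coeff_shift_self, toParam, weight, -ofReal_div,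
    -mul_eq_mul_right_iff]
  ring

lemma sysL_linearizedResidue_fst_succ : (sysL ρ (linearizedResidue ρ w)).1 (n + 1) =
    ((toParam ρ w).a (n + 2) - (toParam ρ w).b (n + 3)) * ρ ^ (n + 2) := by
  rw [sysL_fst_apply]
  simp (disch := lia) [linearizedResidue, coeff_shift_mul, coeff_ofSeq_of_nonneg,
    coeff_ofSeq_of_neg, coeff_shift_of_ne, -ofReal_div]
  rfl

lemma sysL_linearizedResidue_snd_fst_zero : (sysL ρ (linearizedResidue ρ w)).2.1 0 =
    2 * ((toParam ρ w).a 0 - (toParam ρ w).b 1) := by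
  rw [sysL_snd_fst_apply]
  simp (disch := lia) [linearizedResidue, coeff_shift_mul, coeff_ofSeq_of_nonneg,
    coeff_ofSeq_of_neg, coeff_shift_of_ne, toParam, weight, -ofReal_div]
  ring

lemma sysL_linearizedResidue_snd_fst_one : (sysL ρ (linearizedResidue ρ w)).2.1 1 =
    ((toParam ρ w).c 0 + 2 * (toParam ρ w).a 1 - (toParam ρ w).b 2 - (toParam ρ w).b 0 + w.1) *
      ρ := by
  rw [sysL_snd_fst_apply]
  simp (disch := lia) [linearizedResidue, coeff_shift_mul, coeff_ofSeq_of_nonneg,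
    coeff_shift_of_ne, coeff_shift_self, toParam, weight, -ofReal_div,
    -mul_eq_mul_right_iff]
  ring

lemma sysL_linearizedResidue_snd_fst_add_two : (sysL ρ (linearizedResidue ρ w)).2.1 (n + 2) =
    ((toParam ρ w).c (n + 1) + 2 * (toParam ρ w).a (n + 2) - (toParam ρ w).b (n + 3)) *
      ρ ^ (n + 2) := by
  rw [sysL_snd_fst_apply]
  simp (disch := lia) [linearizedResidue, coeff_shift_mul, coeff_ofSeq_of_nonneg,
    coeff_ofSeq_of_neg, coeff_shift_of_ne, -ofReal_div]
  rfl

lemma sysL_linearizedResidue_snd_snd_fst_zero : (sysL ρ (linearizedResidue ρ w)).2.2.1 0 =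
    (w.1 - (toParam ρ w).b 0 - (toParam ρ w).b 2) * ρ := by
  rw [sysL_snd_snd_fst_apply]
  simp (disch := lia) [linearizedResidue, coeff_shift_mul, coeff_ofSeq_of_nonneg,
    coeff_ofSeq_of_neg, coeff_shift_of_ne, coeff_shift_self, toParam, weight, -ofReal_div,
    -mul_eq_mul_right_iff]
  ring

lemma sysL_linearizedResidue_snd_snd_fst_succ : (sysL ρ (linearizedResidue ρ w)).2.2.1 (n + 1) =
    -(toParam ρ w).b (n + 3) * ρ ^ (n + 2) := by
  rw [sysL_snd_snd_fst_apply]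
  simp (disch := lia) [linearizedResidue, coeff_shift_mul, coeff_ofSeq_of_nonneg,
    coeff_ofSeq_of_neg, coeff_shift_of_ne, -ofReal_div]
  rfl

lemma LoopAlg.hasSum_re_evalHom_ofSeq {lam : Circle} {e : ℝ} (hlam : (lam : ℂ) = e)
    (v : ℓ¹(ℕ, ℝ)) :
    HasSum (fun k : ℕ => v k / ρ ^ k * e ^ k) (evalHom lam (ofSeq (ρ := ρ) 1 v)).re := by
  convert! (hasSum_ofSeq 1 v ((evalSeq ρ lam).comp weightedCoeff)).mapL reCLM using 2 with k
  have hshift : ((evalSeq ρ lam).comp weightedCoeff) (shift ρ k) = ((e ^ k : ℝ) : ℂ) := by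
    rw [ofReal_pow, ← hlam, ← zpow_natCast (lam : ℂ) k, ← evalHom_shift (ρ := ρ)]
    rfl
  rw [hshift, reCLM_apply, re_ofReal_mul]
  simp [-ofReal_pow]

lemma reEval_linearizedResidue {lam : Circle} {e : ℝ} (hlam : (lam : ℂ) = e) (he : e ^ 2 = 1) :
    reEval ρ lam (linearizedResidue ρ w 0 1) =
      e * ((toParam ρ w).b 0 + (toParam ρ w).b 2) + (toParam ρ w).b 1 +
        ∑' k, (toParam ρ w).b (k + 3) * e ^ k := by
  have hinv : (lam : ℂ)⁻¹ = e := by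
    rw [hlam, ← ofReal_inv, inv_eq_of_mul_eq_one_right ((sq e).symm.trans he)]
  have htail := (hasSum_nat_add_iff' 3).mpr
    ((hasSum_re_evalHom_ofSeq (ρ := ρ) hlam w.2.2.1).mul_left e)
  have htsum : ∑' k, (toParam ρ w).b (k + 3) * e ^ k =
      ∑' k, e * (w.2.2.1 (k + 3) / ρ ^ (k + 3) * e ^ (k + 3)) :=
    tsum_congr fun k => by
      simp only [toParam]
      linear_combination (-(w.2.2.1 (k + 3) / ρ ^ (k + 3) * e ^ k) * (e ^ 2 + 1)) * he
  have hval : reEval ρ lam (linearizedResidue ρ w 0 1) =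
      e * (evalHom lam (ofSeq (ρ := ρ) 1 w.2.2.1)).re := by
    rw [reEval_apply, ← re_ofReal_mul, ← hinv, ← _root_.zpow_neg_one,
      ← evalHom_shift (ρ := ρ), ← map_mul]
    rfl
  rw [hval, htsum, htail.tsum_eq]
  simp only [Finset.sum_range_succ, Finset.sum_range_zero, toParam]
  linear_combination (w.2.2.1 1 / ρ ^ 1 + e * (w.2.2.1 2 / ρ ^ 2)) * he

end Coefficients

section LinearizedSystem

variable {ρ : ℝ} [Fact (1 ≤ ρ)] {m : ℕ}

/-- The partial derivative of the system in the parameters at `t = 0` and the central value. -/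
noncomputable def linearizedSys (ρ : ℝ) [Fact (1 ≤ ρ)] (w : ParamSpace) : SysSpace × ℝ :=
  (sysL ρ (linearizedResidue ρ w), -(w.2.2.2 0 / 2) - 2 * w.2.2.1 0)

lemma contDiff_sysK {n : WithTop ℕ∞} : ContDiff ℝ n sysK := by
  have heval : ContDiff ℝ n fun v : ℓ¹(ℕ, ℝ) => v 0 :=
    (lp.evalCLM ℝ (fun _ : ℕ => ℝ) 1 0).contDiff
  have ha : ContDiff ℝ n fun v : ParamSpace => v.2.1 0 := heval.comp (by fun_prop)
  have hb : ContDiff ℝ n fun v : ParamSpace => v.2.2.1 0 := heval.comp (by fun_prop)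
  have hc : ContDiff ℝ n fun v : ParamSpace => v.2.2.2 0 := heval.comp (by fun_prop)
  exact ((ha.pow 2).add (hb.mul hc)).sub contDiff_const

lemma contDiffAt_sys (D : IsolatingDisc m) {n : WithTop ℕ∞} (v : ParamSpace) :
    ContDiffAt ℝ n (sys ρ D) (0, v) :=
  ((sysL ρ).contDiff.contDiffAt.comp _ (contDiffAt_logM D v)).prodMk
    (contDiff_sysK.comp contDiff_snd).contDiffAt

lemma sys_zero (D : IsolatingDisc m) (v : ParamSpace) :
    sys ρ D (0, v) = (sysL ρ (dressedResidue ρ m v), sysK v) := by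
  rw [sys, logM_zero]

lemma LoopAlg.coeff_neg_shift (j k : ℤ) : coeff (-k) (shift ρ j) = coeff k (shift ρ (-j)) := by
  rw [coeff_shift, coeff_shift]
  exact if_congr neg_eq_iff_eq_neg rfl rfl

lemma sys_centreV (D : IsolatingDisc m) : sys ρ D (0, centreV ρ) = 0 := by
  have hfst : (sysL ρ (dressedResidue ρ m (centreV ρ))).1 = 0 := lp.ext <| funext fun n => by
    rw [sysL_fst_apply, dressedResidue_centreV]
    simp [LoopAlg.coeff_neg_shift, add_comm, -neg_add_rev]
  have hsnd : (sysL ρ (dressedResidue ρ m (centreV ρ))).2.1 = 0 := lp.ext <| funext fun n => by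
    rw [sysL_snd_fst_apply, dressedResidue_centreV]
    simp [LoopAlg.coeff_neg_shift, -neg_add_rev]
  have hthd : (sysL ρ (dressedResidue ρ m (centreV ρ))).2.2.1 = 0 := lp.ext <| funext fun n => by
    rw [sysL_snd_snd_fst_apply, dressedResidue_centreV]
    simp [LoopAlg.coeff_neg_shift, -neg_add_rev]
  rw [sys_zero]
  refine Prod.ext (Prod.ext hfst (Prod.ext hsnd (Prod.ext hthd (Prod.ext ?_ ?_)))) ?_
  · simp [sysL_apply, dressedResidue_centreV, LoopAlg.reEval_apply, LoopAlg.evalHom_shift]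
  · simp [sysL_apply, dressedResidue_centreV, LoopAlg.reEval_apply, LoopAlg.evalHom_shift]
  · simp [sysK, centreV]

lemma hasDerivAt_sysK_centreV (w : ParamSpace) :
    HasDerivAt (fun u : ℝ => sysK (centreV ρ + u • w)) (linearizedSys ρ w).2 0 := by
  have hline (x y : ℝ) : HasDerivAt (fun u : ℝ => x + u * y) y 0 := by
    simpa using ((hasDerivAt_id (0 : ℝ)).mul_const y).const_add x
  refine ((((hline 0 (w.2.1 0)).pow 2).add
    ((hline (-1 / 2) (w.2.2.1 0)).mul (hline (-2) (w.2.2.2 0)))).sub_const 1).congr_deriv ?_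
    |>.congr_of_eventuallyEq (.of_eq (funext fun u => ?_))
  · simp [linearizedSys]
    ring
  · simp only [sysK, centreV, Prod.fst_add, Prod.snd_add, Prod.smul_fst, Prod.smul_snd,
      lp.coeFn_add, lp.coeFn_sub, lp.coeFn_smul, Pi.add_apply, Pi.sub_apply, Pi.smul_apply]
    simp [neg_div]

lemma apply_inr_of_hasFDerivAt_sys {D : IsolatingDisc m} {f' : ℝ × ParamSpace →L[ℝ] SysSpace × ℝ}
    (hf : HasFDerivAt (sys ρ D) f' (0, centreV ρ)) (w : ParamSpace) :
    f' (0, w) = linearizedSys ρ w := by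
  have hline : HasDerivAt (fun u : ℝ => ((0 : ℝ), centreV ρ + u • w)) (0, w) 0 := by
    simpa using (hasDerivAt_const (0 : ℝ) (0 : ℝ)).prodMk
      (((hasDerivAt_id (0 : ℝ)).smul_const w).const_add (centreV ρ))
  have hcomp := HasFDerivAt.comp_hasDerivAt (0 : ℝ) (l := sys ρ D) (l' := f')
    (by simpa using hf) hline
  refine hcomp.unique ?_
  have hres := (sysL ρ).hasFDerivAt.comp_hasDerivAt (0 : ℝ)
    (hasDerivAt_dressedResidue_centreV (ρ := ρ) (m := m) w)
  exact (hres.prodMk (hasDerivAt_sysK_centreV w)).congr_of_eventuallyEq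
    (.of_eq (funext fun u => sys_zero D _))

end LinearizedSystem

section ParamSpace

variable {ρ : ℝ} [Fact (1 ≤ ρ)]

lemma MemLoop.exists_ell1_eq {f : ℕ → ℝ} (hf : MemLoop ρ f) :
    ∃ α : ℓ¹(ℕ, ℝ), (fun k => α k / ρ ^ k) = f := by
  have hρ : 0 < ρ := zero_lt_one.trans_le Fact.out
  refine ⟨⟨fun k => f k * ρ ^ k, memℓp_gen ?_⟩, funext fun k =>
    mul_div_cancel_right₀ _ (pow_ne_zero k hρ.ne')⟩
  simpa [MemLoop, abs_mul, abs_of_pos hρ] using hf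

lemma memLoop_of_summable {f g : ℕ → ℝ} (hg : Summable g) (d e : ℕ)
    (h : ∀ n, f (n + d) = g n / ρ ^ (n + e)) : MemLoop ρ f := by
  have hρ : 0 < ρ := zero_lt_one.trans_le Fact.out
  rw [MemLoop, ← summable_nat_add_iff d]
  refine (hg.abs.mul_right (ρ ^ d / ρ ^ e)).congr fun n => ?_
  rw [h, abs_div, abs_of_pos (pow_pos hρ _), pow_add, pow_add]
  field_simp

lemma exists_toParam_eq {x : Param} (ha : MemLoop ρ x.a) (hb : MemLoop ρ x.b)
    (hc : MemLoop ρ x.c) : ∃ v, toParam ρ v = x := by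
  obtain ⟨α, hα⟩ := ha.exists_ell1_eq
  obtain ⟨β, hβ⟩ := hb.exists_ell1_eq
  obtain ⟨γ, hγ⟩ := hc.exists_ell1_eq
  exact ⟨(x.r, α, β, γ), Param.ext rfl hα hβ hγ⟩

lemma memLoop_toParam (v : ℓ¹(ℕ, ℝ)) : MemLoop ρ fun k => v k / ρ ^ k :=
  memLoop_of_summable (summable_norm_ell1 v).of_norm 0 0 fun _ => rfl

end ParamSpace

section LinearizedSystem

/-- The equations of the linearized system with right-hand side `y` which involve only the
coefficients of index at least `2` of `a`, `3` of `b` and `1` of `c`. -/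
structure IsTailSolution (ρ : ℝ) (x : Param) (y : SysSpace × ℝ) : Prop where
  a_eq (n : ℕ) : x.a (n + 2) = (y.1.1 (n + 1) - y.1.2.2.1 (n + 1)) / ρ ^ (n + 2)
  b_eq (n : ℕ) : x.b (n + 3) = -y.1.2.2.1 (n + 1) / ρ ^ (n + 2)
  c_eq (n : ℕ) : x.c (n + 1) =
    (y.1.2.1 (n + 2) - 2 * y.1.1 (n + 1) + y.1.2.2.1 (n + 1)) / ρ ^ (n + 2)

/-- The remaining equations of the linearized system with right-hand side `y`, for the parameter
`r` and the first coefficients of `a`, `b`, `c`. -/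
structure IsHeadSolution (ρ : ℝ) (x : Param) (y : SysSpace × ℝ) : Prop where
  fst_zero : x.a 1 - x.b 2 + x.b 0 - x.r = y.1.1 0 / ρ
  snd_zero : x.a 0 - x.b 1 = y.1.2.1 0 / 2
  snd_one : x.c 0 + 2 * x.a 1 - x.b 2 - x.b 0 + x.r = y.1.2.1 1 / ρ
  thd_zero : x.r - x.b 0 - x.b 2 = y.1.2.2.1 0 / ρ
  eval_one : x.b 0 + x.b 2 + x.b 1 = y.1.2.2.2.1 - ∑' k, x.b (k + 3) * 1 ^ k
  eval_neg_one : -(x.b 0 + x.b 2) + x.b 1 = y.1.2.2.2.2 - ∑' k, x.b (k + 3) * (-1) ^ k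
  normalization : x.c 0 + 4 * x.b 0 = -2 * y.2

variable {ρ : ℝ} [Fact (1 ≤ ρ)] {w : ParamSpace} {y : SysSpace × ℝ}

lemma sysL_linearizedResidue_eval_one :
    (sysL ρ (linearizedResidue ρ w)).2.2.2.1 = (toParam ρ w).b 0 + (toParam ρ w).b 2 +
      (toParam ρ w).b 1 + ∑' k, (toParam ρ w).b (k + 3) * 1 ^ k := by
  simpa [sysL_apply] using reEval_linearizedResidue w (lam := 1) (e := 1) (by simp) (by simp)

lemma sysL_linearizedResidue_eval_neg_one :
    (sysL ρ (linearizedResidue ρ w)).2.2.2.2 = -((toParam ρ w).b 0 + (toParam ρ w).b 2) +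
      (toParam ρ w).b 1 + ∑' k, (toParam ρ w).b (k + 3) * (-1) ^ k := by
  simpa [sysL_apply] using reEval_linearizedResidue w (lam := -1) (e := -1) (by simp) (by simp)

lemma linearizedSys_snd :
    (linearizedSys ρ w).2 = -((toParam ρ w).c 0 / 2) - 2 * (toParam ρ w).b 0 := by
  simp [linearizedSys, toParam]

lemma isTailSolution_linearizedSys (w : ParamSpace) :
    IsTailSolution ρ (toParam ρ w) (linearizedSys ρ w) := by
  have hpow (n : ℕ) : ρ ^ n ≠ 0 := pow_ne_zero n (zero_lt_one.trans_le Fact.out).ne'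
  refine ⟨fun n => ?_, fun n => ?_, fun n => ?_⟩
  · rw [eq_div_iff (hpow _), linearizedSys, sysL_linearizedResidue_fst_succ,
      sysL_linearizedResidue_snd_snd_fst_succ]
    ring
  · rw [eq_div_iff (hpow _), linearizedSys, sysL_linearizedResidue_snd_snd_fst_succ]
    ring
  · rw [eq_div_iff (hpow _), linearizedSys, sysL_linearizedResidue_fst_succ,
      sysL_linearizedResidue_snd_fst_add_two, sysL_linearizedResidue_snd_snd_fst_succ]
    ring

lemma isHeadSolution_linearizedSys (w : ParamSpace) :
    IsHeadSolution ρ (toParam ρ w) (linearizedSys ρ w) := by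
  have hρ : ρ ≠ 0 := (zero_lt_one.trans_le Fact.out).ne'
  have hr : (toParam ρ w).r = w.1 := rfl
  constructor
  · rw [eq_div_iff hρ, linearizedSys, sysL_linearizedResidue_fst_zero, hr]
  · rw [linearizedSys, sysL_linearizedResidue_snd_fst_zero]
    ring
  · rw [eq_div_iff hρ, linearizedSys, sysL_linearizedResidue_snd_fst_one, hr]
  · rw [eq_div_iff hρ, linearizedSys, sysL_linearizedResidue_snd_snd_fst_zero, hr]
  · rw [linearizedSys, sysL_linearizedResidue_eval_one, add_sub_cancel_right]
  · rw [linearizedSys, sysL_linearizedResidue_eval_neg_one, add_sub_cancel_right]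
  · rw [linearizedSys_snd]
    ring

lemma linearizedSys_eq (htail : IsTailSolution ρ (toParam ρ w) y)
    (hhead : IsHeadSolution ρ (toParam ρ w) y) : linearizedSys ρ w = y := by
  have hρ : ρ ≠ 0 := (zero_lt_one.trans_le Fact.out).ne'
  have hpow (n : ℕ) : ρ ^ n ≠ 0 := pow_ne_zero n hρ
  have hr : (toParam ρ w).r = w.1 := rfl
  refine Prod.ext (Prod.ext (lp.ext ?_) (Prod.ext (lp.ext ?_) (Prod.ext (lp.ext ?_)
    (Prod.ext ?_ ?_)))) ?_
  · ext (_ | n)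
    · rw [linearizedSys, sysL_linearizedResidue_fst_zero, ← hr, hhead.fst_zero,
        div_mul_cancel₀ _ hρ]
    · rw [linearizedSys, sysL_linearizedResidue_fst_succ, htail.a_eq, htail.b_eq, ← sub_div,
        div_mul_cancel₀ _ (hpow _)]
      ring
  · ext (_ | _ | n)
    · rw [linearizedSys, sysL_linearizedResidue_snd_fst_zero, hhead.snd_zero]
      ring
    · rw [linearizedSys, sysL_linearizedResidue_snd_fst_one, ← hr, hhead.snd_one,
        div_mul_cancel₀ _ hρ]
    · rw [linearizedSys, sysL_linearizedResidue_snd_fst_add_two, htail.a_eq, htail.b_eq,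
        htail.c_eq]
      field_simp [hpow]
      ring
  · ext (_ | n)
    · rw [linearizedSys, sysL_linearizedResidue_snd_snd_fst_zero, ← hr, hhead.thd_zero,
        div_mul_cancel₀ _ hρ]
    · rw [linearizedSys, sysL_linearizedResidue_snd_snd_fst_succ, htail.b_eq, neg_div, neg_neg,
        div_mul_cancel₀ _ (hpow _)]
  · rw [linearizedSys, sysL_linearizedResidue_eval_one, hhead.eval_one, sub_add_cancel]
  · rw [linearizedSys, sysL_linearizedResidue_eval_neg_one, hhead.eval_neg_one,
      sub_add_cancel]
  · rw [linearizedSys_snd]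
    linear_combination -(1 / 2) * hhead.normalization

end LinearizedSystem

section LinearizedSystem

variable {ρ : ℝ} [Fact (1 ≤ ρ)] {m : ℕ}

lemma linearizedSys_injective {w : ParamSpace} (hw : linearizedSys ρ w = 0) : w = 0 := by
  obtain ⟨ha, hb, hc⟩ := hw ▸ isTailSolution_linearizedSys (ρ := ρ) w
  obtain ⟨h₁, h₂, h₃, h₄, h₅, h₆, h₇⟩ := hw ▸ isHeadSolution_linearizedSys (ρ := ρ) w
  have hb' (n : ℕ) : (toParam ρ w).b (n + 3) = 0 := (hb n).trans (by simp)
  simp only [hb', zero_mul, tsum_zero, Prod.fst_zero, Prod.snd_zero, lp.coeFn_zero,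
    Pi.zero_apply, zero_div, mul_zero, sub_zero] at h₁ h₂ h₃ h₄ h₅ h₆ h₇
  have hzero {α : ℓ¹(ℕ, ℝ)} (h : ∀ n, α n / ρ ^ n = 0) : α = 0 := lp.ext <| funext fun n =>
    (div_eq_zero_iff.mp (h n)).resolve_right
      (pow_ne_zero n (zero_lt_one.trans_le (Fact.out : 1 ≤ ρ)).ne')
  refine Prod.ext ?_ (Prod.ext (hzero ?_) (Prod.ext (hzero ?_) (hzero ?_)))
  · change (toParam ρ w).r = 0
    linarith
  · change ∀ n, (toParam ρ w).a n = 0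
    rintro (_ | _ | n)
    · linarith
    · linarith
    · exact (ha n).trans (by simp)
  · change ∀ n, (toParam ρ w).b n = 0
    rintro (_ | _ | _ | n)
    · linarith
    · linarith
    · linarith
    · exact hb' n
  · change ∀ n, (toParam ρ w).c n = 0
    rintro (_ | n)
    · linarith
    · exact (hc n).trans (by simp)

lemma exists_headSystem (e₁ e₂ e₃ e₄ e₅ e₆ e₇ : ℝ) : ∃ r a₀ a₁ b₀ b₁ b₂ c₀ : ℝ,
    a₁ - b₂ + b₀ - r = e₁ ∧ a₀ - b₁ = e₂ ∧ c₀ + 2 * a₁ - b₂ - b₀ + r = e₃ ∧ r - b₀ - b₂ = e₄ ∧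
      b₀ + b₂ + b₁ = e₅ ∧ -(b₀ + b₂) + b₁ = e₆ ∧ c₀ + 4 * b₀ = e₇ := by
  obtain ⟨s, hs⟩ : ∃ s, s = (e₅ - e₆) / 2 := ⟨_, rfl⟩
  obtain ⟨b₀, hb₀⟩ : ∃ b₀, b₀ = (e₇ + 2 * e₁ + s + 3 * (e₄ + s) - e₃) / 8 := ⟨_, rfl⟩
  refine ⟨e₄ + s, e₂ + (e₅ + e₆) / 2, e₁ + (s - b₀) - b₀ + (e₄ + s), b₀, (e₅ + e₆) / 2, s - b₀,
    e₇ - 4 * b₀, ?_⟩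
  refine ⟨?_, ?_, ?_, ?_, ?_, ?_, ?_⟩ <;> linarith

lemma exists_isTailSolution_isHeadSolution (ρ : ℝ) (y : SysSpace × ℝ) :
    ∃ x, IsTailSolution ρ x y ∧ IsHeadSolution ρ x y := by
  let b (n : ℕ) : ℝ := -y.1.2.2.1 (n + 1) / ρ ^ (n + 2)
  obtain ⟨r, a₀, a₁, b₀, b₁, b₂, c₀, h₁, h₂, h₃, h₄, h₅, h₆, h₇⟩ := exists_headSystem
    (y.1.1 0 / ρ) (y.1.2.1 0 / 2) (y.1.2.1 1 / ρ) (y.1.2.2.1 0 / ρ)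
    (y.1.2.2.2.1 - ∑' k, b k * 1 ^ k) (y.1.2.2.2.2 - ∑' k, b k * (-1) ^ k) (-2 * y.2)
  let x : Param :=
    { r := r
      a := fun
        | 0 => a₀
        | 1 => a₁
        | n + 2 => (y.1.1 (n + 1) - y.1.2.2.1 (n + 1)) / ρ ^ (n + 2)
      b := fun
        | 0 => b₀
        | 1 => b₁
        | 2 => b₂
        | n + 3 => b n
      c := fun
        | 0 => c₀
        | n + 1 => (y.1.2.1 (n + 2) - 2 * y.1.1 (n + 1) + y.1.2.2.1 (n + 1)) / ρ ^ (n + 2) }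
  exact ⟨x, ⟨fun _ => rfl, fun _ => rfl, fun _ => rfl⟩, ⟨h₁, h₂, h₃, h₄, h₅, h₆, h₇⟩⟩

lemma linearizedSys_surjective (y : SysSpace × ℝ) : ∃ w, linearizedSys ρ w = y := by
  obtain ⟨x, htail, hhead⟩ := exists_isTailSolution_isHeadSolution ρ y
  have hsum (u : ℓ¹(ℕ, ℝ)) (d : ℕ) : Summable fun n => u (n + d) :=
    (summable_nat_add_iff d).mpr (summable_norm_ell1 u).of_norm
  obtain ⟨w, rfl⟩ := exists_toParam_eq
    (memLoop_of_summable ((hsum _ 1).sub (hsum _ 1)) 2 2 htail.a_eq)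
    (memLoop_of_summable (hsum _ 1).neg 3 2 htail.b_eq)
    (memLoop_of_summable (((hsum _ 2).sub ((hsum _ 1).mul_left 2)).add (hsum _ 1)) 1 2 htail.c_eq)
  exact ⟨w, linearizedSys_eq htail hhead⟩

lemma isInvertible_fderiv_sys (D : IsolatingDisc m) :
    (fderiv ℝ (sys ρ D) (0, centreV ρ) ∘L .inr ℝ ℝ ParamSpace).IsInvertible := by
  let A := fderiv ℝ (sys ρ D) (0, centreV ρ) ∘L .inr ℝ ℝ ParamSpace
  have hA (w : ParamSpace) : A w = linearizedSys ρ w := apply_inr_of_hasFDerivAt_sys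
    ((contDiffAt_sys D _).differentiableAt one_ne_zero).hasFDerivAt w
  refine ⟨.ofBijective A (LinearMap.ker_eq_bot'.mpr fun w hw => ?_)
    (LinearMap.range_eq_top.mpr fun y => ?_), rfl⟩
  · exact linearizedSys_injective (hA w ▸ hw)
  · obtain ⟨w, hw⟩ := linearizedSys_surjective (ρ := ρ) y
    exact ⟨w, (hA w).trans hw⟩

end LinearizedSystem

/-! ### Existence, uniqueness and monodromy -/

section ParamBall

variable {ρ : ℝ} [Fact (1 ≤ ρ)]

lemma loopNorm_sub (v w : ℓ¹(ℕ, ℝ)) :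
    loopNorm ρ ((fun k => v k / ρ ^ k) - fun k => w k / ρ ^ k) = ‖v - w‖ := by
  have hρ : 0 < ρ := zero_lt_one.trans_le Fact.out
  rw [loopNorm, norm_ell1]
  refine tsum_congr fun k => ?_
  rw [Pi.sub_apply, ← sub_div, abs_div, abs_of_pos (pow_pos hρ k),
    div_mul_cancel₀ _ (pow_pos hρ k).ne']
  rfl

lemma toParam_mem_paramBall_iff {δ : ℝ} {v : ParamSpace} :
    toParam ρ v ∈ paramBall ρ δ ↔ ‖v - centreV ρ‖ < δ := by
  simp only [Prod.norm_def, max_lt_iff, paramBall, ← toParam_centreV (ρ := ρ), Set.mem_ofPred_eq,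
    toParam, memLoop_toParam, true_and, loopNorm_sub, Prod.fst_sub, Prod.snd_sub,
    Real.norm_eq_abs]

end ParamBall

section Solution

variable {ρ : ℝ} [Fact (1 ≤ ρ)] {m : ℕ} (D : IsolatingDisc m)

lemma evalHom_dressedResidue_centreV {lam : Circle} (hlam : lam⁻¹ = lam) :
    LoopAlg.evalHom lam (dressedResidue ρ m (centreV ρ) 0 0) = lam := by
  have hinv : (lam : ℂ)⁻¹ = lam := by rw [← Circle.coe_inv, hlam]
  simp [dressedResidue_centreV, LoopAlg.evalHom_shift, hinv]
  ring

lemma eventually_norm_evalHom_logM_sub_lt {lam : Circle} (hlam : lam⁻¹ = lam) :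
    ∀ᶠ p in nhds ((0 : ℝ), centreV ρ), ‖LoopAlg.evalHom lam (logM ρ D p 0 0) - lam‖ < 1 := by
  have hentry : Continuous fun M : LoopMat ρ => LoopAlg.evalHom lam (M 0 0) :=
    (LoopAlg.continuous_evalHom lam).comp (continuous_id.matrix_elem 0 0)
  have hlim := (hentry.tendsto (logM ρ D (0, centreV ρ))).comp
    (contDiffAt_logM D (centreV ρ) (n := 0)).continuousAt
  rw [logM_zero, evalHom_dressedResidue_centreV hlam] at hlim
  exact (hlim.eventually (Metric.ball_mem_nhds _ one_pos)).mono fun _ => mem_ball_iff_norm.mp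

variable {D} {p : ℝ × ParamSpace}

lemma IsSmall.matM_eq_diagExp (hp : IsSmall ρ D p) (ht : p.1 ≠ 0)
    (hsolves : SolvesSystem m p.1 (toParam ρ p.2))
    (hone : ‖LoopAlg.evalHom 1 (logM ρ D p 0 0) - (1 : Circle)‖ < 1)
    (hneg : ‖LoopAlg.evalHom (-1) (logM ρ D p 0 0) - (-1 : Circle)‖ < 1) (j : ℕ) :
    matM m j p.1 (toParam ρ p.2) 1 = diagExp p.1 ^ ((-1 : ℤ) ^ j) ∧
      matM m j p.1 (toParam ρ p.2) (-1) = diagExp (-p.1) ^ ((-1 : ℤ) ^ j) := by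
  obtain ⟨-, -, hH₁, hH₂, -⟩ := (hp.solvesSystem_iff_evalHom ht).mp hsolves
  refine matM_eq_diagExp_of_matM_zero (Nat.one_le_iff_ne_zero.mpr D.ne_zero)
    (fun lam => ⟨_, hp.regular.isContinuation lam⟩) ?_ ?_ j
  · simpa using hp.matM_zero_eq_diagExp ht hsolves hH₁ (e := 1) (by simp) (by simpa using hone)
  · simpa using hp.matM_zero_eq_diagExp ht hsolves hH₂ (e := -1) (by simp) (by simpa using hneg)

end Solution

end DPW

open DPW in
theorem mainTheorem6_general (m : ℕ) (hm : 1 ≤ m) (ρ : ℝ) (hρ : 1 ≤ ρ) :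
    ∃ δ : ℝ, 0 < δ ∧ ∃ ε : ℝ, 0 < ε ∧ ∀ t : ℝ, t ≠ 0 → |t| < ε →
      ∃ x : Param, x ∈ paramBall ρ δ ∧ SolvesSystem m t x ∧
        (∀ y : Param, y ∈ paramBall ρ δ → SolvesSystem m t y → y = x) ∧
        (∀ j : ℕ, j < nSing m →
          matM m j t x 1 = diagExp t ^ ((-1 : ℤ) ^ j) ∧
          matM m j t x (-1) = diagExp (-t) ^ ((-1 : ℤ) ^ j)) ∧
        (∀ j : ℕ, j < nSing m → ∀ lam : ℂ, ‖lam‖ = 1 → (matA m x j lam).det = -1) := by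
  have : Fact (1 ≤ ρ) := ⟨hρ⟩
  obtain ⟨D⟩ := nonempty_isolatingDisc hm
  have hgood := (eventually_isSmall (ρ := ρ) D (centreV ρ)).and
    ((eventually_norm_evalHom_logM_sub_lt (ρ := ρ) D inv_one).and
      (eventually_norm_evalHom_logM_sub_lt (ρ := ρ) D (lam := -1) (by simp)))
  obtain ⟨δ, hδ, ε, hε, hball⟩ := exists_ball_existsUnique_eq (contDiffAt_sys D (centreV ρ))
    (isInvertible_fderiv_sys D) hgood
  refine ⟨δ, hδ, ε, hε, fun t ht htε => ?_⟩
  obtain ⟨⟨v, ⟨hv, hsys⟩, hunique⟩, hnear⟩ := hball t htε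
  obtain ⟨hsmall, hone, hneg⟩ := hnear v hv
  rw [sys_centreV] at hsys hunique
  have hsolves : SolvesSystem m t (toParam ρ v) := (hsmall.solvesSystem_iff ht).mpr hsys
  refine ⟨toParam ρ v, toParam_mem_paramBall_iff.mpr hv, hsolves, fun y hy hy_solves => ?_,
    fun j _ => hsmall.matM_eq_diagExp ht hsolves hone hneg j,
    fun j _ _ hlam => hsmall.det_matA_eq ht hsolves j hlam⟩
  obtain ⟨w, rfl⟩ := exists_toParam_eq hy.1 hy.2.1 hy.2.2.1
  have hw := toParam_mem_paramBall_iff.mp hy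
  rw [hunique w ⟨hw, ((hnear w hw).1.solvesSystem_iff ht).mp hy_solves⟩]

theorem mainTheorem6 (m : ℕ) (hm : 1 ≤ m) (ρ : ℝ) (hρ : 1 < ρ) :
    ∃ δ : ℝ, 0 < δ ∧ ∃ ε : ℝ, 0 < ε ∧ ∀ t : ℝ, t ≠ 0 → |t| < ε →
      ∃ x : DPW.Param, x ∈ DPW.paramBall ρ δ ∧ DPW.SolvesSystem m t x ∧
        (∀ y : DPW.Param, y ∈ DPW.paramBall ρ δ → DPW.SolvesSystem m t y → y = x) ∧
        (∀ j : ℕ, j < DPW.nSing m →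
          DPW.matM m j t x 1 = DPW.diagExp t ^ ((-1 : ℤ) ^ j) ∧
          DPW.matM m j t x (-1) = DPW.diagExp (-t) ^ ((-1 : ℤ) ^ j)) ∧
        (∀ j : ℕ, j < DPW.nSing m → ∀ lam : ℂ, ‖lam‖ = 1 →
          (DPW.matA m x j lam).det = -1) :=
  mainTheorem6_general m hm ρ hρ.le
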